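/- Let $d\ge 1$, $\lambda\in\mathbb R$. Densities of weight $\mu$ on $\mathbb R^d$ are written $s(x)|Dx|^\mu$ with $s$ smooth; $\mathcal F=\bigoplus_{\mu\in\mathbb R}\mathcal F_\mu$ is the algebra of densities, $\hat w$ is the weight operator ($\hat w=\mu$ on $\mathcal F_\mu$), and adjoints are taken with respect to the scalar product $\langle s_1|Dx|^\mu,s_2|Dx|^\nu\rangle=\int s_1s_2\,dx$ if $\mu+\nu=1$ and $0$ otherwise, on compactly supported densities. $D^{(n)}_\lambda$ is the space of differential operators of order $\le n$ on $\mathcal F_\lambda$. $D^{(n)}(\widehat M)$ is the space of finite sums of operators $a(x)\hat w^j\partial_{i_1}\cdots\partial_{i_k}$, $j+k\le n$, on $\mathcal F$. A regular pencil lifting is a linear map $\hat\Pi:D^{(n)}_\lambda\to D^{(n)}(\widehat M)$ with $\hat\Pi(\Delta)|_{\hat w=\lambda}=\Delta$. It is $\mathrm{proj}$-equivariant if $\hat\Pi(\mathrm{ad}_K\Delta)=\mathrm{ad}_K\hat\Pi(\Delta)$ for all $K$ in the Lie algebra $\mathrm{proj}(\mathbb R^d)$ spanned by $\partial_i$, $x^k\partial_i$,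 $x^k\sum_i x^i\partial_i$, where $\mathrm{ad}_K$ is the commutator with the Lie derivative of densities. It is (anti-)self-adjoint if $\hat\Pi(\Delta)^*=\hat\Pi(\Delta)$ (resp. $-\hat\Pi(\Delta)$) for all $\Delta$. For a symmetric tensor $S$ of rank $k$ let $$Q_\mu(S)=\sum_{r=0}^k\binom kr\prod_{s=0}^{r-1}\frac{(d+1)\mu+k-1-s}{d+2k-1-s}\;(\partial_{j_1}\cdots\partial_{j_r}S^{j_1\dots j_ri_1\dots i_{k-r}})\,\partial_{i_1}\cdots\partial_{i_{k-r}}$$ be the projective quantisation map, extended linearly to inhomogeneous symbols, and let $\sigma_\lambda=Q_\lambda^{-1}$ be the full symbol map; $\hat\Pi^{\rm DLO}(\Delta)|_{\hat w=\mu}=Q_\mu(\sigma_\lambda(\Delta))$. Decompose $\Delta\in D_\lambda^{(n)}$ as $\Delta=\Delta_n+\dots+\Delta_0$, where $\Delta_k=Q_\lambda$ of the order-$k$ principal symbol of $\Delta-\Delta_n-\dots-\Delta_{k+1}$. Given real polynomials $P_0,\dots,P_n$ with $\deg P_i\le i$ and $P_i(\lambda)\neq0$, put $$\hat\Pi(\Delta)=\sum_{i=0}^n\frac{P_i(\hat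 w)}{P_i(\lambda)}\,\hat\Pi^{\rm DLO}(\Delta_{n-i}).\qquad(\ast)$$ **(1)** $\hat\Pi$ is a regular $\mathrm{proj}$-equivariant pencil lifting. If $n$ is even, $\hat\Pi$ is self-adjoint if and only if $P_i(\hat w)^*=(-1)^iP_i(\hat w)$ for all $i\le n$; if $n$ is odd, $\hat\Pi$ is anti-self-adjoint if and only if the same condition holds. For $i$ even (odd) the condition on $P_i$ says exactly that $P_i$ is an even (odd) polynomial in $\hat w-\tfrac12$. **(2)** Let $n=2$. A lifting of the form $(\ast)$ is self-adjoint if and only if $\lambda\ne\frac12$ and it equals, for some $p,q\in\mathbb R$ with $p+q\lambda(\lambda-1)\ne0$, $$\hat\Pi^{[p:q]}(\Delta)=\hat\Pi^{\rm DLO}(\Delta_2)+\frac{2\hat w-1}{2\lambda-1}\hat\Pi^{\rm DLO}(\Delta_1)+\frac{p+q\hat w(\hat w-1)}{p+q\lambda(\lambda-1)}\Delta_0 .$$ If $\lambda\ne\frac12$, every such $\hat\Pi^{[p:q]}$ is a self-adjoint regular $\mathrm{proj}$-equivariant lifting, and $\hat\Pi^{[p:q]}=\hat\Pi^{[p':q']}$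 if and only if $[p:q]=[p':q']$. **(3)** Let $n=2$, $\lambda\ne0,\frac12,1$ and $\Delta=S^{ik}\partial_i\partial_k+A^i\partial_i+F$ with $S^{ik}$ symmetric. There is a unique self-adjoint $\hat D\in D^{(2)}(\widehat M)$ with $\hat D(1)=0$ and $\hat D|_{\hat w=\lambda}=\Delta$ (the canonical lifting), namely $$\hat D=S^{ik}\partial_i\partial_k+\partial_kS^{ik}\partial_i+(2\hat w-1)B^i\partial_i+\hat w\,\partial_iB^i+\hat w(\hat w-1)C,$$ $$B^i=\frac{A^i-\partial_kS^{ki}}{2\lambda-1},\qquad C=\frac F{\lambda(\lambda-1)}-\frac{\partial_iA^i-\partial_i\partial_kS^{ki}}{(\lambda-1)(2\lambda-1)}.$$ It equals $\hat\Pi^{[0:1]}(\Delta)$, and whenever $p+q\lambda(\lambda-1)\neq0$, $$\hat\Pi^{[p:q]}(\Delta)=\hat D+\Big(\frac{p+q\hat w(\hat w-1)}{p+q\lambda(\lambda-1)}-\frac{\hat w(\hat w-1)}{\lambda(\lambda-1)}\Big)\mathcal S_\Delta ,$$ $$\mathcal S_\Delta=F-\lambda\,\partial_iA^i+(\lambda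 a_d(\lambda)-b_d(\lambda))\,\partial_i\partial_kS^{ki},$$ where $a_d(\lambda)=\frac{2(\lambda(d+1)+1)}{d+3}$ and $b_d(\lambda)=\frac{\lambda(d+1)(\lambda(d+1)+1)}{(d+2)(d+3)}$. **(4)** For every $\lambda$ and every $\Delta\in D^{(2)}_\lambda$, define $\mathcal S_\Delta$ by the same formula. It is a projectively invariant scalar: $\mathcal S_{\mathrm{ad}_K\Delta}=K(\mathcal S_\Delta)$ for all $K\in\mathrm{proj}(\mathbb R^d)$. For an arbitrary smooth vector field $K$ it transforms with the infinitesimal multidimensional Schwarzian cocycle $$\mathcal S_{\mathrm{ad}_K\Delta}-K(\mathcal S_\Delta)=\frac{\lambda(\lambda-1)}{d+2}\Big(2S^{ij}\partial_i\partial_j\partial_mK^m+2\,\partial_jS^{ij}\,\partial_i\partial_mK^m-(d+1)\,\partial_mS^{ij}\,\partial_i\partial_jK^m\Big),$$ and, if $\lambda\ne0,1$, this does not vanish for some $K$ and $\Delta$. -/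

import Mathlib

open scoped ContDiff

noncomputable section

namespace PencilLifting

/-! ### Smooth functions, differential operators and densities on `ℝ^d`

Densities of weight `μ` on `ℝ^d` are written `s(x)|Dx|^μ` in Cartesian coordinates, and are
represented by their coefficient `s`. -/

/-- The algebra of smooth functions on `ℝ^d`. -/
def smoothFunctions (d : ℕ) : Subalgebra ℝ ((Fin d → ℝ) → ℝ) where
  carrier := {f | ContDiff ℝ ∞ f}
  mul_mem' {f g} hf hg := by
    have hf' : ContDiff ℝ ∞ f := hf
    have hg' : ContDiff ℝ ∞ g := hg
    exact hf'.mul hg'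
  add_mem' {f g} hf hg := by
    have hf' : ContDiff ℝ ∞ f := hf
    have hg' : ContDiff ℝ ∞ g := hg
    exact hf'.add hg'
  algebraMap_mem' c := by
    change ContDiff ℝ ∞ (fun _ : Fin d → ℝ => c)
    exact contDiff_const

/-- Smooth functions on `ℝ^d`. -/
def Smooth (d : ℕ) : Type := smoothFunctions d

instance (d : ℕ) : CommRing (Smooth d) := inferInstanceAs (CommRing (smoothFunctions d))

instance (d : ℕ) : Algebra ℝ (Smooth d) := inferInstanceAs (Algebra ℝ (smoothFunctions d))

@[ext]
theorem Smooth.ext {d : ℕ} {f g : Smooth d} (h : ∀ x, f.1 x = g.1 x) : f = g :=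
  Subtype.ext (funext h)

/-- The coordinate function `x^i`. -/
def coord {d : ℕ} (i : Fin d) : Smooth d :=
  ⟨fun x => x i, by
    change ContDiff ℝ ∞ (fun x : Fin d → ℝ => x i)
    exact contDiff_apply ℝ ℝ i⟩

/-- Linear operators on densities of a fixed weight. -/
abbrev Op (d : ℕ) : Type := Module.End ℝ (Smooth d)

theorem contDiff_partial {d : ℕ} (i : Fin d) (f : Smooth d) :
    ContDiff ℝ ∞ (fun x => fderiv ℝ f.1 x (Pi.single i 1)) :=
  (ContDiff.fderiv_right (m := ∞) (n := ∞) f.2 (by simp)).clm_apply contDiff_const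

theorem differentiable_smooth {d : ℕ} (f : Smooth d) : Differentiable ℝ f.1 :=
  ContDiff.differentiable (n := ∞) f.2 (by simp)

/-- The partial derivative `∂_i`. -/
def pd {d : ℕ} (i : Fin d) : Op d where
  toFun f := ⟨fun x => fderiv ℝ f.1 x (Pi.single i 1), contDiff_partial i f⟩
  map_add' f g := by
    ext x
    change fderiv ℝ (f.1 + g.1) x _ = _
    rw [fderiv_add (differentiable_smooth f x) (differentiable_smooth g x)]
    rfl
  map_smul' c f := by
    ext x
    change fderiv ℝ (c • f.1) x _ = _
    rw [fderiv_const_smul (differentiable_smooth f x)]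
    rfl

/-- Multiplication by a smooth function. -/
def mul {d : ℕ} (a : Smooth d) : Op d := LinearMap.mulLeft ℝ a

/-- `∂_{i_1} ⋯ ∂_{i_k}` for a list of indices. -/
def pdList {d : ℕ} (l : List (Fin d)) : Op d := (l.map pd).prod

/-- `D^{(n)}_μ(ℝ^d)`: differential operators of order `≤ n`, i.e. finite sums of
`a(x) ∂_{i_1} ⋯ ∂_{i_k}` with `k ≤ n` and `a` smooth. -/
def diffOps (d n : ℕ) : Submodule ℝ (Op d) :=
  Submodule.span ℝ {T | ∃ (a : Smooth d) (l : List (Fin d)), l.length ≤ n ∧ T = mul a * pdList l}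

/-- The space `⨁_μ F_μ(ℝ^d)` of densities of all weights. -/
abbrev Densities (d : ℕ) : Type := ℝ →₀ Smooth d

/-- Linear operators on the space of densities of all weights. -/
abbrev OpHat (d : ℕ) : Type := Module.End ℝ (Densities d)

/-- The operator on all densities defined by a pencil `{Δ_μ}`; it acts as `Δ_μ` on weight `μ`. -/
def ofPencil {d : ℕ} : (ℝ → Op d) →ₗ[ℝ] OpHat d where
  toFun D := Finsupp.lsum ℝ fun μ => Finsupp.lsingle μ ∘ₗ D μ
  map_add' D E := by ext; simp
  map_smul' c D := by ext; simp

/-- The restriction `D̂|_{ŵ = μ}` of a weight-zero operator to densities of weight `μ`. -/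
def restrictTo {d : ℕ} (μ : ℝ) (D : OpHat d) : Op d :=
  Finsupp.lapply μ ∘ₗ D ∘ₗ Finsupp.lsingle μ

/-- The weight operator `ŵ`. -/
def weightOp (d : ℕ) : OpHat d := ofPencil fun μ => μ • 1

/-- The polynomial `P(ŵ)` in the weight operator. -/
def polyWeight (d : ℕ) (P : Polynomial ℝ) : OpHat d := Polynomial.aeval (weightOp d) P

/-- An expression in `x` and `∂_i` acting in the same way on the coefficients of densities of
every weight. -/
def const {d : ℕ} : Op d →ₗ[ℝ] OpHat d :=
  ofPencil ∘ₗ LinearMap.pi fun _ => LinearMap.id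

/-- Differential operators of weight `0` and order `≤ n` on the algebra of densities: finite sums
of `a(x) ŵ^j ∂_{i_1} ⋯ ∂_{i_k}` with `j + k ≤ n`. -/
def diffOpsHat (d n : ℕ) : Submodule ℝ (OpHat d) :=
  Submodule.span ℝ {T | ∃ (a : Smooth d) (j : ℕ) (l : List (Fin d)),
    j + l.length ≤ n ∧ T = const (mul a) * weightOp d ^ j * const (pdList l)}

/-! ### The canonical scalar product and adjoints -/

/-- The canonical scalar product: `⟨s₁|Dx|^μ, s₂|Dx|^ν⟩ = ∫ s₁ s₂ dx` if `μ + ν = 1`, and `0`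
otherwise. -/
def pairing {d : ℕ} (s₁ s₂ : Densities d) : ℝ :=
  s₁.sum fun μ f => ∫ x, f.1 x * (s₂ (1 - μ)).1 x

/-- A density has compact support. -/
def CompactlySupported {d : ℕ} (s : Densities d) : Prop :=
  ∀ μ : ℝ, HasCompactSupport (s μ).1

/-- `D^* = E` with respect to the canonical scalar product. -/
def AdjointIs {d : ℕ} (D E : OpHat d) : Prop :=
  ∀ s₁ s₂ : Densities d, CompactlySupported s₁ → CompactlySupported s₂ →
    pairing (D s₁) s₂ = pairing s₁ (E s₂)

/-! ### Vector fields and Lie derivatives -/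

/-- Smooth vector fields `K = K^i ∂_i`. -/
abbrev VField (d : ℕ) : Type := Fin d → Smooth d

/-- The derivative `K(f)` of a function along a vector field, as an operator. -/
def dirDeriv {d : ℕ} (K : VField d) : Op d := ∑ i, mul (K i) * pd i

/-- `∂_i K^i`. -/
def divergence {d : ℕ} (K : VField d) : Smooth d := ∑ i, pd i (K i)

/-- The Lie derivative along `K` of densities of weight `μ`. -/
def lieDeriv {d : ℕ} (μ : ℝ) (K : VField d) : Op d := dirDeriv K + μ • mul (divergence K)

/-- The Lie derivative along `K` on the space of all densities. -/
def lieDerivHat {d : ℕ} (K : VField d) : OpHat d := ofPencil fun μ => lieDeriv μ K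

/-- `ad_K Δ` for an operator `Δ` on densities of weight `μ`. -/
def ad {d : ℕ} (μ : ℝ) (K : VField d) (T : Op d) : Op d :=
  lieDeriv μ K * T - T * lieDeriv μ K

/-- `ad_K D̂` for an operator on all densities. -/
def adHat {d : ℕ} (K : VField d) (T : OpHat d) : OpHat d :=
  lieDerivHat K * T - T * lieDerivHat K

/-- The Lie algebra `proj(ℝ^d)`, spanned by `∂_i`, `x^k ∂_i` and `x^k (x^i ∂_i)`
(summation over `i` in the last field). -/
def projFields (d : ℕ) : Submodule ℝ (VField d) :=
  Submodule.span ℝ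
    (Set.range (fun i : Fin d => (Pi.single i 1 : VField d)) ∪
     Set.range (fun p : Fin d × Fin d => (Pi.single p.2 (coord p.1) : VField d)) ∪
     Set.range (fun k : Fin d => (fun i => coord k * coord i : VField d)))

/-! ### Pencil liftings -/

/-- Linear maps from operators of order `≤ n` on densities of a given weight to operators on
the algebra of densities. -/
abbrev LiftMap (d n : ℕ) : Type := diffOps d n →ₗ[ℝ] OpHat d

/-- `Π̂` is a regular pencil lifting on `D^{(n)}_lam`: `Π̂(Δ)` is of order `≤ n` and passes
through `Δ` at weight `lam`. -/
def IsRegularLifting {d n : ℕ} (lam : ℝ) (L : LiftMap d n) : Prop :=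
  ∀ T : diffOps d n, L T ∈ diffOpsHat d n ∧ restrictTo lam (L T) = T

/-- `Π̂(ad_K Δ) = ad_K Π̂(Δ)` for all projective vector fields `K`. -/
def IsProjEquivariant {d n : ℕ} (lam : ℝ) (L : LiftMap d n) : Prop :=
  ∀ K ∈ projFields d, ∀ T : diffOps d n,
    ∃ h : ad lam K (T : Op d) ∈ diffOps d n, L ⟨ad lam K T, h⟩ = adHat K (L T)

/-- The lifting takes values in self-adjoint operators. -/
def IsSelfAdjointLifting {d n : ℕ} (L : LiftMap d n) : Prop :=
  ∀ T : diffOps d n, AdjointIs (L T) (L T)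

/-- The lifting takes values in anti-self-adjoint operators. -/
def IsAntiSelfAdjointLifting {d n : ℕ} (L : LiftMap d n) : Prop :=
  ∀ T : diffOps d n, AdjointIs (L T) (-L T)

/-! ### Symbols, the projective quantisation and the DLO-pencil lifting -/

/-- Contravariant tensor fields of rank `k`, by components `S^{i_1 … i_k}`. -/
abbrev Tensor (d k : ℕ) : Type := (Fin k → Fin d) → Smooth d

/-- The commutator `[T, x^i]`. -/
def commCoord {d : ℕ} (i : Fin d) : Module.End ℝ (Op d) :=
  LinearMap.mulRight ℝ (mul (coord i)) - LinearMap.mulLeft ℝ (mul (coord i))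

/-- Evaluation of an operator at the constant function `1`. -/
def evalOne (d : ℕ) : Op d →ₗ[ℝ] Smooth d := LinearMap.applyₗ (1 : Smooth d)

/-- The components of the principal symbol of order `k`: for
`Δ = S^{i_1 … i_k} ∂_{i_1} ⋯ ∂_{i_k} + (lower order)` with `S` symmetric,
`S^{i_1 … i_k} = (1/k!) [⋯[Δ, x^{i_k}], …, x^{i_1}](1)`. -/
def principalSymbol {d : ℕ} (k : ℕ) : Op d →ₗ[ℝ] Tensor d k :=
  LinearMap.pi fun I =>
    ((k.factorial : ℝ)⁻¹) • (evalOne d ∘ₗ ((List.ofFn I).map commCoord).prod)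

/-- The coefficients of the projective quantisation map. -/
def quantCoeff (d k r : ℕ) (μ : ℝ) : ℝ :=
  (k.choose r : ℝ) * ∏ s ∈ Finset.range r,
    (((d : ℝ) + 1) * μ + k - 1 - s) / ((d : ℝ) + 2 * k - 1 - s)

/-- `S ↦ ∂_{i_1} ⋯ ∂_{i_r} S^{i_1 … i_k} ∂_{i_{r+1}} ⋯ ∂_{i_k}` (summation over all indices; the
first `r` derivatives act on the component of `S` only). -/
def contracted {d k : ℕ} (r : ℕ) : Tensor d k →ₗ[ℝ] Op d where
  toFun S := ∑ I : Fin k → Fin d,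
    mul (pdList ((List.ofFn I).take r) (S I)) * pdList ((List.ofFn I).drop r)
  map_add' S U := by
    simp only [Pi.add_apply, map_add, mul, ← Finset.sum_add_distrib]
    refine Finset.sum_congr rfl fun I _ => ?_
    ext f : 1
    simp [add_mul]
  map_smul' c S := by
    simp only [Pi.smul_apply, map_smul, mul, Finset.smul_sum, RingHom.id_apply]
    refine Finset.sum_congr rfl fun I _ => ?_
    ext f : 1
    simp

/-- The projective quantisation map `Q_μ` on symbols of degree `k`. -/
def quantHom {d : ℕ} (μ : ℝ) (k : ℕ) : Tensor d k →ₗ[ℝ] Op d :=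
  ∑ r ∈ Finset.range (k + 1), quantCoeff d k r μ • contracted r

/-- The projective quantisation map `Q_μ` on (not necessarily homogeneous) symbols of
degree `≤ n`. -/
def quant {d : ℕ} (n : ℕ) (μ : ℝ) : ((k : ℕ) → Tensor d k) →ₗ[ℝ] Op d :=
  ∑ k ∈ Finset.range (n + 1), quantHom μ k ∘ₗ LinearMap.proj k

/-- `Δ - Δ_n - ⋯ - Δ_{n-m+1}` in the canonical decomposition `Δ = Δ_n + ⋯ + Δ_0`. -/
def remainder {d : ℕ} (n : ℕ) (lam : ℝ) : ℕ → (Op d →ₗ[ℝ] Op d)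
  | 0 => LinearMap.id
  | m + 1 => remainder n lam m -
      quantHom lam (n - m) ∘ₗ principalSymbol (n - m) ∘ₗ remainder n lam m

/-- The term `Δ_{n-m} = Q_lam(spr^{(n-m)}(Δ - Δ_n - ⋯ - Δ_{n-m+1}))` of the canonical
decomposition `Δ = Δ_n + ⋯ + Δ_0` of an operator of order `≤ n` (here `m ≤ n`). -/
def component {d : ℕ} (n : ℕ) (lam : ℝ) (m : ℕ) : Op d →ₗ[ℝ] Op d :=
  quantHom lam (n - m) ∘ₗ principalSymbol (n - m) ∘ₗ remainder n lam m

/-- The projective full symbol map `σ_lam`, the inverse of `Q_lam`, on operators of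
order `≤ n`. -/
def fullSymbol {d : ℕ} (n : ℕ) (lam : ℝ) : Op d →ₗ[ℝ] ((k : ℕ) → Tensor d k) :=
  LinearMap.pi fun k => if k ≤ n then principalSymbol k ∘ₗ remainder n lam (n - k) else 0

/-- The DLO-pencil lifting: `Π̂^DLO(Δ)|_{ŵ = μ} = Q_μ(σ_lam(Δ))`. -/
def dloLifting {d : ℕ} (n : ℕ) (lam : ℝ) : Op d →ₗ[ℝ] OpHat d :=
  ofPencil ∘ₗ LinearMap.pi fun μ => quant n μ ∘ₗ fullSymbol n lam

/-- The lifting `Δ ↦ ∑_{i=0}^n (P_i(ŵ) / P_i(lam)) Π̂^DLO(Δ_{n-i})`. -/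
def triangularLifting (d n : ℕ) (lam : ℝ) (P : ℕ → Polynomial ℝ) : LiftMap d n :=
  (∑ i ∈ Finset.range (n + 1), ((P i).eval lam)⁻¹ •
    (LinearMap.mulLeft ℝ (polyWeight d (P i)) ∘ₗ dloLifting n lam ∘ₗ component n lam i)) ∘ₗ
  (diffOps d n).subtype

/-! ### Second order operators -/

/-- The polynomial `p + q w (w - 1)`. -/
def linePoly (p q : ℝ) : Polynomial ℝ :=
  Polynomial.C p + Polynomial.C q * (Polynomial.X * (Polynomial.X - 1))

/-- The lifting `Π̂^{[p:q]}` of second order operators: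
`Π̂^DLO(Δ_2) + (2ŵ-1)/(2lam-1) Π̂^DLO(Δ_1) + (p+qŵ(ŵ-1))/(p+q lam(lam-1)) Δ_0`. -/
def lineLifting (d : ℕ) (lam p q : ℝ) : LiftMap d 2 :=
  (dloLifting 2 lam ∘ₗ component 2 lam 0 +
    (2 * lam - 1)⁻¹ • (LinearMap.mulLeft ℝ (2 • weightOp d - 1) ∘ₗ
      dloLifting 2 lam ∘ₗ component 2 lam 1) +
    (p + q * (lam * (lam - 1)))⁻¹ • (LinearMap.mulLeft ℝ (polyWeight d (linePoly p q)) ∘ₗ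
      const ∘ₗ component 2 lam 2)) ∘ₗ
  (diffOps d 2).subtype

/-- `S^{ik}` for `Δ = S^{ik} ∂_i ∂_k + A^i ∂_i + F` with `S` symmetric. -/
def coeffS {d : ℕ} (T : Op d) (i k : Fin d) : Smooth d :=
  (1 / 2 : ℝ) • evalOne d (commCoord i (commCoord k T))

/-- `A^i` for `Δ = S^{ik} ∂_i ∂_k + A^i ∂_i + F`. -/
def coeffA {d : ℕ} (T : Op d) (i : Fin d) : Smooth d := evalOne d (commCoord i T)

/-- `F` for `Δ = S^{ik} ∂_i ∂_k + A^i ∂_i + F`. -/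
def coeffF {d : ℕ} (T : Op d) : Smooth d := evalOne d T

/-- `B^i = (A^i - ∂_k S^{ki}) / (2 lam - 1)`. -/
def canonicalB {d : ℕ} (lam : ℝ) (T : Op d) (i : Fin d) : Smooth d :=
  (2 * lam - 1)⁻¹ • (coeffA T i - ∑ k, pd k (coeffS T k i))

/-- `C = F / (lam (lam-1)) - (∂_i A^i - ∂_i ∂_k S^{ki}) / ((lam-1) (2 lam - 1))`. -/
def canonicalC {d : ℕ} (lam : ℝ) (T : Op d) : Smooth d :=
  (lam * (lam - 1))⁻¹ • coeffF T -
    ((lam - 1) * (2 * lam - 1))⁻¹ •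
      (∑ i, pd i (coeffA T i) - ∑ i, ∑ k, pd i (pd k (coeffS T k i)))

/-- The canonical lifting
`S^{ik} ∂_i ∂_k + ∂_k S^{ik} ∂_i + (2ŵ-1) B^i ∂_i + ŵ ∂_i B^i + ŵ (ŵ-1) C`. -/
def canonicalLift {d : ℕ} (lam : ℝ) (T : Op d) : OpHat d :=
  const (∑ i, ∑ k, mul (coeffS T i k) * (pd i * pd k)) +
  const (∑ i, mul (∑ k, pd k (coeffS T i k)) * pd i) +
  (2 • weightOp d - 1) * const (∑ i, mul (canonicalB lam T i) * pd i) +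
  weightOp d * const (mul (∑ i, pd i (canonicalB lam T i))) +
  weightOp d * (weightOp d - 1) * const (mul (canonicalC lam T))

/-- `D̂` is a self-adjoint operator of order `≤ 2` with `D̂(1) = 0` which passes through `Δ` at
weight `lam`. -/
def IsCanonicalLift {d : ℕ} (lam : ℝ) (T : Op d) (D : OpHat d) : Prop :=
  D ∈ diffOpsHat d 2 ∧ AdjointIs D D ∧ D (Finsupp.single 0 1) = 0 ∧ restrictTo lam D = T

/-- `a_d(lam) = 2 (lam (d+1) + 1) / (d+3)`. -/
def coeffa (d : ℕ) (lam : ℝ) : ℝ := 2 * (lam * (d + 1) + 1) / (d + 3)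

/-- `b_d(lam) = lam (d+1) (lam (d+1) + 1) / ((d+2) (d+3))`. -/
def coeffb (d : ℕ) (lam : ℝ) : ℝ :=
  lam * (d + 1) * (lam * (d + 1) + 1) / ((d + 2) * (d + 3))

/-- The Schwarzian-type scalar
`F - lam ∂_i A^i + (lam a_d(lam) - b_d(lam)) ∂_i ∂_k S^{ki}`. -/
def schwarzScalar {d : ℕ} (lam : ℝ) (T : Op d) : Smooth d :=
  coeffF T - lam • ∑ i, pd i (coeffA T i) +
    (lam * coeffa d lam - coeffb d lam) • ∑ i, ∑ k, pd i (pd k (coeffS T k i))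

/-- The infinitesimal multidimensional Schwarzian of a vector field `K`, contracted with a
symmetric tensor `S`:
`2 S^{ij} ∂_i ∂_j ∂_m K^m + 2 ∂_j S^{ij} ∂_i ∂_m K^m - (d+1) ∂_m S^{ij} ∂_i ∂_j K^m`. -/
def schwarzCocycle {d : ℕ} (K : VField d) (S : Fin d → Fin d → Smooth d) : Smooth d :=
  (2 : ℝ) • (∑ i, ∑ j, S i j * pd i (pd j (divergence K))) +
  (2 : ℝ) • (∑ i, ∑ j, pd j (S i j) * pd i (divergence K)) -
  ((d : ℝ) + 1) • ∑ i, ∑ j, ∑ m, pd m (S i j) * pd i (pd j (K m))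

end PencilLifting

end

noncomputable section

namespace PencilLifting

variable {d : ℕ}

/-! ### Derivations of the algebra of smooth functions -/

/-! Everything is tested on one family of operators. Symmetric tensors of rank k are spanned by f
v^{⊗k}, with f smooth and v a constant vector, and on such a symbol the quantisation involves a
single direction: Q_μ(f v^k) = Σ_r c_{k,r}(μ) (∂_v^r f) ∂_v^{k-r} (`quantHom_tpow`). As c_{k,0} = 1,
the operators Q_λ(f v^k) with k ≤ n span all operators of order ≤ n (`diffOps_eq_span`, by
polarisation), and each of them has only one term in its canonical decomposition. Hence (∗) sends
Q_λ(S), with S symmetric of rank k, to the pencil μ ↦ P_{n-k}(μ)/P_{n-k}(λ) · Q_μ(S)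
(`triangularLifting_quantHom`), and the claims about liftings become claims about Q_μ.

Regularity holds because c_{k,r} has degree ≤ r in μ. Equivariance holds because, for K projective,
ad_K Q_μ(f v^k) = Q_μ(U) with the same U for every μ (`exists_ad_quantHom`); for the quadratic
fields the recurrence between c_{k,r} and c_{k,r+1} makes all non-tensorial terms telescope
(`ad_quadratic`). Self-adjointness rests on Q_μ(S)^* = (-1)^k Q_{1-μ}(S), which is the
Chu–Vandermonde identity (`formalAdjoint_quantHom`); conversely the constant symbols, with Q_μ(v^k)
= ∂_v^k, force the parity of each P_i.

For n = 2, parity about 1/2 leaves constants, multiples of 2w - 1, and p + q w(w - 1). Two canonical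
liftings agree at λ, hence by self-adjointness at 1 - λ, so they differ by (μ - λ)(μ - 1 + λ) Z with
Z a multiplication operator; vanishing on 1 at weight 0 gives Z = 0 (`IsCanonicalLift.unique`).

The scalar S_Δ vanishes on Q_λ of symbols of degree 1 and 2 and is the identity on functions: it is
the degree-zero component of Δ. This explains both the comparison of Π^{[p:q]} with the canonical
lifting and the projective invariance. The cocycle for general K is computed on f ∂_v^2, the
lower-order parts being covariant under every vector field. -/

theorem pd_mul (i : Fin d) (f g : Smooth d) : pd i (f * g) = pd i f * g + f * pd i g := by
  ext x
  change fderiv ℝ (f.1 * g.1) x _ = fderiv ℝ f.1 x _ * g.1 x + f.1 x * fderiv ℝ g.1 x _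
  rw [fderiv_mul (differentiable_smooth f x) (differentiable_smooth g x)]
  simp
  ring

theorem pd_coord (i j : Fin d) : pd i (coord j) = if i = j then 1 else 0 := by
  ext x
  change fderiv ℝ (fun x : Fin d → ℝ => x j) x _ = _
  rw [(hasFDerivAt_apply j x).fderiv]
  rcases eq_or_ne i j with rfl | h
  · simp; rfl
  · simp [h, Ne.symm h]; rfl

theorem pd_comm (i j : Fin d) (f : Smooth d) : pd i (pd j f) = pd j (pd i f) := by
  have key : ∀ (i j : Fin d) (x : Fin d → ℝ), (pd i (pd j f)).1 x =
      fderiv ℝ (fderiv ℝ f.1) x (Pi.single i 1) (Pi.single j 1) := by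
    intro i j x
    change fderiv ℝ (fun y => fderiv ℝ f.1 y (Pi.single j 1)) x _ = _
    have hd : DifferentiableAt ℝ (fderiv ℝ f.1) x :=
      (ContDiff.differentiable (n := 1)
        (ContDiff.fderiv_right (n := ∞) f.2 (by norm_cast)) (by simp)) x
    rw [fderiv_clm_apply hd (by fun_prop)]
    simp
  ext x
  rw [key, key]
  have hf : ContDiffAt ℝ ∞ f.1 x := ContDiff.contDiffAt f.2
  have h2 : minSmoothness ℝ 2 ≤ ∞ := by
    simp only [minSmoothness_of_isRCLikeNormedField]
    exact WithTop.coe_le_coe.2 le_top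
  exact (hf.isSymmSndFDerivAt h2).eq _ _

theorem pd_one (i : Fin d) : pd i (1 : Smooth d) = 0 := by
  have h := pd_mul i (1 : Smooth d) 1
  simpa using h

/-- The derivative in a constant direction. -/
def dv (v : Fin d → ℝ) : Op d := ∑ i, v i • pd i

theorem dv_def (v : Fin d → ℝ) : dv v = ∑ i, v i • pd i := rfl

theorem dv_apply (v : Fin d → ℝ) (f : Smooth d) : dv v f = ∑ i, v i • pd i f := by
  simp [dv]

theorem dv_mul (v : Fin d → ℝ) (f g : Smooth d) : dv v (f * g) = dv v f * g + f * dv v g := by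
  simp only [dv_apply, pd_mul, Finset.sum_mul, Finset.mul_sum, ← Finset.sum_add_distrib]
  exact Finset.sum_congr rfl fun i _ => by simp

theorem dv_one (v : Fin d → ℝ) : dv v 1 = 0 := by
  simp [dv_apply, pd_one]

theorem dv_coord (v : Fin d → ℝ) (i : Fin d) : dv v (coord i) = v i • 1 := by
  simp [dv_apply, pd_coord]

theorem dv_single (i : Fin d) : dv (Pi.single i 1) = pd i := by
  simp [dv, Pi.single_apply]

theorem dv_add_smul (v w : Fin d → ℝ) (t : ℝ) : dv (v + t • w) = dv v + t • dv w := by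
  simp [dv, add_smul, Finset.sum_add_distrib, Finset.smul_sum, mul_smul]

theorem pd_commute (i j : Fin d) : Commute (pd i) (pd j) :=
  LinearMap.ext fun f => pd_comm i j f

theorem dv_commute (v w : Fin d → ℝ) : Commute (dv v) (dv w) :=
  Commute.sum_left _ _ _ fun i _ => Commute.sum_right _ _ _ fun j _ =>
    ((pd_commute i j).smul_left _).smul_right _

theorem dv_commute_pd (v : Fin d → ℝ) (i : Fin d) : Commute (dv v) (pd i) := by
  simpa only [dv_single] using dv_commute v (Pi.single i 1)

theorem mul_apply (a f : Smooth d) : mul a f = a * f := rfl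

theorem mul_add' (a b : Smooth d) : mul (a + b) = mul a + mul b := by
  ext1 f; simp [mul_apply, add_mul]

theorem mul_smul' (c : ℝ) (a : Smooth d) : mul (c • a) = c • mul a := by
  ext1 f; simp [mul_apply]

/-- `mul` as a linear map. -/
def mulₗ : Smooth d →ₗ[ℝ] Op d where
  toFun := mul
  map_add' := mul_add'
  map_smul' := mul_smul'

theorem mulₗ_apply (a : Smooth d) : mulₗ a = mul a := rfl

theorem dv_mul_mul (v : Fin d → ℝ) (a : Smooth d) : dv v * mul a = mul a * dv v + mul (dv v a) := by
  ext1 f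
  simp [mul_apply, dv_mul, add_comm]

theorem dv_pow_one (v : Fin d → ℝ) {k : ℕ} (hk : k ≠ 0) : (dv v ^ k) (1 : Smooth d) = 0 := by
  obtain ⟨k, rfl⟩ := Nat.exists_eq_succ_of_ne_zero hk
  simp [pow_succ, dv_one]

/-- The commutator [∂_v, x^i] = v^i is a scalar, so commuting x^i past ∂_v^k differentiates the
power. The truncated exponent at k = 0 is harmless because its coefficient vanishes. -/
theorem dv_pow_commute_mul_coord (v : Fin d → ℝ) (i : Fin d) (k : ℕ) :
    dv v ^ k * mul (coord i) = mul (coord i) * dv v ^ k + ((k : ℝ) * v i) • dv v ^ (k - 1) := by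
  induction k with
  | zero => simp
  | succ k ih =>
    have h1 : mul (v i • (1 : Smooth d)) = v i • (1 : Op d) := by
      rw [mul_smul']; congr 1; ext1 f; simp [mul_apply]
    rw [pow_succ', mul_assoc, ih, mul_add, ← mul_assoc, dv_mul_mul, dv_coord, h1]
    rcases k with _ | k
    · simp
    · rw [add_mul, mul_smul_comm, Nat.add_sub_cancel, ← pow_succ' (dv v) k, mul_assoc, add_assoc,
        smul_one_mul, Nat.add_sub_cancel, ← add_smul]
      push_cast
      ring_nf

/-! ### Powers of vectors as tensors -/

/-- The tensor `f v^{⊗k}`. -/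
def tpow (k : ℕ) (f : Smooth d) (v : Fin d → ℝ) : Tensor d k := fun I => (∏ a, v (I a)) • f

/-- The span of the tensors `f v^{⊗k}`, i.e. the symmetric tensors. -/
def symTensors (d k : ℕ) : Submodule ℝ (Tensor d k) :=
  Submodule.span ℝ {S | ∃ f v, S = tpow k f v}

theorem tpow_mem (k : ℕ) (f : Smooth d) (v : Fin d → ℝ) : tpow k f v ∈ symTensors d k :=
  Submodule.subset_span ⟨f, v, rfl⟩

theorem pdList_commute_pd (l : List (Fin d)) (i : Fin d) : Commute (pdList l) (pd i) := by
  induction l with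
  | nil => exact Commute.one_left _
  | cons j l ih =>
    rw [pdList, List.map_cons, List.prod_cons]
    exact (pd_commute j i).mul_left ih

/-- A sum over multi-indices with weight ∏ v(I a) factorises. The induction splits off the first
index, which differentiates f if r > 0 and belongs to the operator if r = 0. -/
theorem contracted_tpow (k r : ℕ) (hr : r ≤ k) (f : Smooth d) (v : Fin d → ℝ) :
    contracted r (tpow k f v) = mul ((dv v ^ r) f) * dv v ^ (k - r) := by
  change ∑ I : Fin k → Fin d, mul (pdList ((List.ofFn I).take r) ((∏ a, v (I a)) • f)) *
    pdList ((List.ofFn I).drop r) = _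
  simp only [map_smul, mul_smul', smul_mul_assoc]
  induction k generalizing r f with
  | zero =>
    obtain rfl : r = 0 := by omega
    simp [pdList]
  | succ k ih =>
    rw [← (Fin.consEquiv fun _ => Fin d).sum_comp, Fintype.sum_prod_type]
    simp only [Fin.consEquiv_apply, Fin.prod_univ_succ, Fin.cons_zero, Fin.cons_succ,
      List.ofFn_succ, mul_smul]
    rcases r with _ | r
    · simp only [List.take_zero, List.drop_zero, pow_zero, Nat.sub_zero]
      have h0 := ih 0 (Nat.zero_le _) f
      simp only [List.take_zero, List.drop_zero, pow_zero, Nat.sub_zero] at h0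
      -- The split-off derivative is moved to the far right, where it leaves the inner sum.
      have hp : ∀ (i : Fin d) (l : List (Fin d)), pdList (i :: l) = pdList l * pd i := by
        intro i l
        rw [(pdList_commute_pd l i).eq]; simp [pdList]
      have hi : ∀ i : Fin d, ∑ I : Fin k → Fin d, v i • (∏ a, v (I a)) •
          (mul (pdList [] f) * pdList (i :: List.ofFn I)) = v i • (mul f * dv v ^ k * pd i) := by
        intro i
        rw [← Finset.smul_sum]
        simp only [← smul_mul_assoc] at h0
        simp only [hp, ← mul_assoc, ← smul_mul_assoc, ← Finset.sum_mul, h0]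
        simp only [smul_mul_assoc]
        rfl
      simp only [hi]
      conv_rhs => rw [pow_succ, ← mul_assoc, dv_def v, Finset.mul_sum]
      simp only [dv_def v, mul_smul_comm]
      rfl
    · have hp : ∀ (i : Fin d) (l : List (Fin d)), pdList (i :: l) f = pdList l (pd i f) := by
        intro i l
        have := congrArg (fun T : Op d => T f) (pdList_commute_pd l i).eq
        simp only [Module.End.mul_apply] at this
        rw [this]; simp [pdList]
      simp only [List.take_succ_cons, List.drop_succ_cons, hp, ← Finset.smul_sum,
        ih r (by omega)]
      rw [pow_succ, Module.End.mul_apply, dv_apply, map_sum, ← mulₗ_apply, map_sum,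
        Finset.sum_mul, Nat.succ_sub_succ]
      exact Finset.sum_congr rfl fun i _ => by simp [mulₗ_apply]

theorem quantHom_tpow (μ : ℝ) (k : ℕ) (f : Smooth d) (v : Fin d → ℝ) :
    quantHom μ k (tpow k f v) =
      ∑ r ∈ Finset.range (k + 1), quantCoeff d k r μ • (mul ((dv v ^ r) f) * dv v ^ (k - r)) := by
  simp only [quantHom, LinearMap.sum_apply, LinearMap.smul_apply]
  refine Finset.sum_congr rfl fun r hr => ?_
  rw [contracted_tpow k r (by simpa [Nat.lt_succ_iff] using hr)]

/-! ### Principal symbols -/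

/-- On symbols the commutator with x^i is the derivative in the i-th momentum. -/
theorem commCoord_mul_dv_pow (i : Fin d) (a : Smooth d) (v : Fin d → ℝ) (j : ℕ) :
    commCoord i (mul a * dv v ^ j) = ((j : ℝ) * v i) • (mul a * dv v ^ (j - 1)) := by
  have hc : mul (coord i) * mul a = mul a * mul (coord i) := by
    ext1 f; simp [mul_apply]; ring
  simp only [commCoord, LinearMap.sub_apply, LinearMap.mulRight_apply, LinearMap.mulLeft_apply]
  rw [mul_assoc, dv_pow_commute_mul_coord, ← mul_assoc, hc, mul_add, mul_assoc,
    add_sub_cancel_left, mul_smul_comm]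

theorem prod_commCoord_mul_dv_pow (l : List (Fin d)) (a : Smooth d) (v : Fin d → ℝ) (j : ℕ) :
    (l.map commCoord).prod (mul a * dv v ^ j) =
      ((j.descFactorial l.length : ℝ) * (l.map v).prod) • (mul a * dv v ^ (j - l.length)) := by
  induction l with
  | nil => simp
  | cons i l ih =>
    rw [List.map_cons, List.prod_cons, Module.End.mul_apply, ih, map_smul, commCoord_mul_dv_pow,
      smul_smul, List.length_cons, Nat.descFactorial_succ, List.map_cons, List.prod_cons,
      Nat.sub_sub]
    push_cast
    ring_nf

/-- For j < k the descending factorial vanishes, for j > k a power of ∂_v is left to kill 1, and for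
j = k the factor k! cancels. So exactly the degree-k part is read off, even from an operator of
higher order. -/
theorem principalSymbol_mul_dv_pow (k j : ℕ) (a : Smooth d) (v : Fin d → ℝ) :
    principalSymbol k (mul a * dv v ^ j) = if j = k then tpow k a v else 0 := by
  funext I
  have h : principalSymbol k (mul a * dv v ^ j) I = ((k.factorial : ℝ)⁻¹ *
      ((j.descFactorial k : ℝ) * ∏ b, v (I b))) • (a * (dv v ^ (j - k)) 1) := by
    simp only [principalSymbol, LinearMap.pi_apply, LinearMap.smul_apply, LinearMap.comp_apply,
      prod_commCoord_mul_dv_pow, evalOne, map_smul, smul_smul]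
    simp only [List.length_ofFn, List.map_ofFn, List.prod_ofFn]
    rfl
  rw [h]
  rcases lt_trichotomy j k with hjk | rfl | hjk
  · simp [Nat.descFactorial_of_lt hjk, hjk.ne]
  · have : (j.factorial : ℝ) ≠ 0 := by positivity
    simp [Nat.descFactorial_self, tpow, this]
  · rw [dv_pow_one v (by omega), if_neg hjk.ne']
    simp

theorem quantCoeff_zero (d k : ℕ) (μ : ℝ) : quantCoeff d k 0 μ = 1 := by simp [quantCoeff]

theorem principalSymbol_quantHom_of_lt {μ : ℝ} {k j : ℕ} (h : k < j) {S : Tensor d k}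
    (hS : S ∈ symTensors d k) : principalSymbol j (quantHom μ k S) = 0 := by
  induction hS using Submodule.span_induction with
  | mem S hS =>
    obtain ⟨f, v, rfl⟩ := hS
    rw [quantHom_tpow, map_sum]
    refine Finset.sum_eq_zero fun r hr => ?_
    rw [map_smul, principalSymbol_mul_dv_pow, if_neg (by omega), smul_zero]
  | zero => simp
  | add S U _ _ hS hU => simp [hS, hU]
  | smul c S _ hS => simp [hS]

theorem principalSymbol_quantHom {μ : ℝ} {k : ℕ} {S : Tensor d k}
    (hS : S ∈ symTensors d k) : principalSymbol k (quantHom μ k S) = S := by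
  induction hS using Submodule.span_induction with
  | mem S hS =>
    obtain ⟨f, v, rfl⟩ := hS
    rw [quantHom_tpow, map_sum, Finset.sum_eq_single 0]
    · simp [principalSymbol_mul_dv_pow, quantCoeff_zero]
    · intro r hr h0
      simp only [Finset.mem_range] at hr
      rw [map_smul, principalSymbol_mul_dv_pow, if_neg (by omega), smul_zero]
    · simp
  | zero => simp
  | add S U _ _ hS hU => simp [hS, hU]
  | smul c S _ hS => simp [hS]

/-- Stripping degrees n, n - 1, … leaves Q_lam(S) untouched while the degree exceeds k, since its
symbols there vanish. Degree k is stripped in passing from m = n - k to n - k + 1, and there the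
whole operator goes, its principal symbol being S. -/
theorem remainder_quantHom {n k : ℕ} (hk : k ≤ n) (lam : ℝ) (m : ℕ) {S : Tensor d k}
    (hS : S ∈ symTensors d k) :
    remainder n lam m (quantHom lam k S) = if m ≤ n - k then quantHom lam k S else 0 := by
  induction m with
  | zero => simp [remainder]
  | succ m ih =>
    simp only [remainder, LinearMap.sub_apply, LinearMap.comp_apply, ih]
    rcases lt_trichotomy m (n - k) with h | rfl | h
    · rw [if_pos h.le, if_pos (by omega), principalSymbol_quantHom_of_lt (by omega) hS]
      simp
    · rw [if_pos le_rfl, if_neg (by omega), Nat.sub_sub_self hk, principalSymbol_quantHom hS,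
        sub_self]
    · rw [if_neg (by omega), if_neg (by omega)]
      simp

theorem component_quantHom {n k : ℕ} (hk : k ≤ n) (lam : ℝ) {m : ℕ} (hm : m ≤ n) {S : Tensor d k}
    (hS : S ∈ symTensors d k) :
    component n lam m (quantHom lam k S) = if m = n - k then quantHom lam k S else 0 := by
  simp only [component, LinearMap.comp_apply, remainder_quantHom hk lam m hS]
  rcases lt_trichotomy m (n - k) with h | rfl | h
  · rw [if_pos h.le, if_neg h.ne, principalSymbol_quantHom_of_lt (by omega) hS, map_zero]
  · rw [if_pos le_rfl, if_pos rfl, Nat.sub_sub_self hk, principalSymbol_quantHom hS]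
  · rw [if_neg (by omega), if_neg h.ne']
    simp

theorem fullSymbol_quantHom {n k : ℕ} (hk : k ≤ n) (lam : ℝ) {S : Tensor d k}
    (hS : S ∈ symTensors d k) :
    fullSymbol n lam (quantHom lam k S) = Pi.single k S := by
  funext j
  simp only [fullSymbol, LinearMap.pi_apply]
  by_cases hj : j ≤ n
  · simp only [if_pos hj, LinearMap.comp_apply, remainder_quantHom hk lam _ hS]
    rcases lt_trichotomy j k with h | rfl | h
    · rw [if_neg (by omega), Pi.single_eq_of_ne h.ne, map_zero]
    · rw [if_pos le_rfl, Pi.single_eq_same, principalSymbol_quantHom hS]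
    · rw [if_pos (by omega), Pi.single_eq_of_ne h.ne', principalSymbol_quantHom_of_lt h hS]
  · rw [if_neg hj, Pi.single_eq_of_ne (by omega)]
    rfl

theorem quant_single {n k : ℕ} (hk : k ≤ n) (μ : ℝ) (S : Tensor d k) :
    quant n μ (Pi.single k S) = quantHom μ k S := by
  simp only [quant, LinearMap.sum_apply, LinearMap.comp_apply, LinearMap.proj_apply]
  rw [Finset.sum_eq_single k]
  · simp
  · intro j _ hj
    rw [Pi.single_eq_of_ne hj, map_zero]
  · intro h
    simp only [Finset.mem_range] at h
    omega

theorem dloLifting_quantHom {n k : ℕ} (hk : k ≤ n) (lam : ℝ) {S : Tensor d k}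
    (hS : S ∈ symTensors d k) :
    dloLifting n lam (quantHom lam k S) = ofPencil fun μ => quantHom μ k S := by
  simp only [dloLifting, LinearMap.comp_apply]
  congr 1
  funext μ
  simp only [LinearMap.pi_apply, LinearMap.comp_apply, fullSymbol_quantHom hk lam hS,
    quant_single hk]

/-! ### Pencils -/

theorem ofPencil_single (D : ℝ → Op d) (μ : ℝ) (f : Smooth d) :
    ofPencil D (Finsupp.single μ f) = Finsupp.single μ (D μ f) := by
  simp [ofPencil]

theorem ofPencil_apply (D : ℝ → Op d) (s : Densities d) (μ : ℝ) :
    ofPencil D s μ = D μ (s μ) := by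
  induction s using Finsupp.induction_linear with
  | zero => simp
  | add s t hs ht => simp [hs, ht]
  | single ν f =>
    rw [ofPencil_single, Finsupp.single_apply, Finsupp.single_apply]
    split_ifs with h
    · rw [h]
    · simp

theorem ofPencil_mul (D E : ℝ → Op d) :
    ofPencil D * ofPencil E = ofPencil fun μ => D μ * E μ := by
  refine LinearMap.ext fun s => Finsupp.ext fun μ => ?_
  rw [Module.End.mul_apply, ofPencil_apply, ofPencil_apply, ofPencil_apply, Module.End.mul_apply]

theorem restrictTo_ofPencil (μ : ℝ) (D : ℝ → Op d) : restrictTo μ (ofPencil D) = D μ := by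
  ext1 f
  simp [restrictTo, ofPencil_single]

theorem ofPencil_injective : Function.Injective (ofPencil (d := d)) := fun D E h => by
  funext μ
  rw [← restrictTo_ofPencil μ D, h, restrictTo_ofPencil]

theorem ofPencil_one : ofPencil (fun _ => (1 : Op d)) = 1 := by
  refine LinearMap.ext fun s => Finsupp.ext fun μ => ?_
  rw [ofPencil_apply]; rfl

theorem const_apply (T : Op d) : const T = ofPencil fun _ => T := rfl

theorem polyWeight_eq (P : Polynomial ℝ) :
    polyWeight d P = ofPencil fun μ => P.eval μ • (1 : Op d) := by
  induction P using Polynomial.induction_on' with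
  | add p q hp hq =>
    simp only [polyWeight, map_add] at hp hq ⊢
    rw [hp, hq, ← map_add]
    congr 1
    funext μ
    simp [add_smul]
  | monomial n a =>
    rw [polyWeight, Polynomial.aeval_monomial]
    have hpow : weightOp d ^ n = ofPencil fun μ => μ ^ n • (1 : Op d) := by
      induction n with
      | zero => simp [ofPencil_one]
      | succ n ih =>
        rw [pow_succ, ih, weightOp, ofPencil_mul]
        congr 1; funext μ
        simp [pow_succ', mul_smul]
    rw [hpow, ← Algebra.smul_def, ← map_smul]
    congr 1; funext μ
    simp [mul_smul]

theorem weightOp_pow (n : ℕ) : weightOp d ^ n = ofPencil fun μ => μ ^ n • (1 : Op d) := by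
  have h := polyWeight_eq (d := d) (Polynomial.X ^ n)
  simpa [polyWeight] using h

/-! ### Polynomial functions of a real parameter -/

section HasLin

variable {V W X : Type*} [AddCommGroup V] [Module ℝ V] [AddCommGroup W] [Module ℝ W]
  [AddCommGroup X] [Module ℝ X]

/-- `F` is a polynomial function of `t` of the form `a + t b + O(t^2)`. -/
inductive HasLin {V : Type*} [AddCommGroup V] [Module ℝ V] : (ℝ → V) → V → V → Prop
  | const (a : V) : HasLin (fun _ => a) a 0
  | add {F G : ℝ → V} {a b a' b' : V} : HasLin F a b → HasLin G a' b' →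
      HasLin (fun t => F t + G t) (a + a') (b + b')
  | smul {F : ℝ → V} {a b : V} : HasLin F a b → HasLin (fun t => t • F t) 0 a

theorem HasLin.map {F : ℝ → V} {a b : V} (h : HasLin F a b) (φ : V →ₗ[ℝ] W) :
    HasLin (fun t => φ (F t)) (φ a) (φ b) := by
  induction h with
  | const a => simpa using HasLin.const (φ a)
  | add _ _ h1 h2 => simpa using h1.add h2
  | smul _ h => simpa using h.smul

/-- The product rule at t = 0. -/
theorem HasLin.map₂ {F : ℝ → V} {G : ℝ → W} {a b : V} {a' b' : W} (hF : HasLin F a b)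
    (hG : HasLin G a' b') (B : V →ₗ[ℝ] W →ₗ[ℝ] X) :
    HasLin (fun t => B (F t) (G t)) (B a a') (B a b' + B b a') := by
  induction hF with
  | const a => simpa using hG.map (B a)
  | add _ _ h1 h2 => simpa [add_add_add_comm] using h1.add h2
  | smul _ h => simpa using h.smul

theorem HasLin.sum {ι : Type*} (s : Finset ι) {F : ι → ℝ → V} {a b : ι → V}
    (h : ∀ i ∈ s, HasLin (F i) (a i) (b i)) :
    HasLin (fun t => ∑ i ∈ s, F i t) (∑ i ∈ s, a i) (∑ i ∈ s, b i) := by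
  classical
  induction s using Finset.induction_on with
  | empty => simpa using HasLin.const (0 : V)
  | insert i s hi ih =>
    simp only [Finset.sum_insert hi]
    exact (h i (Finset.mem_insert_self i s)).add
      (ih fun j hj => h j (Finset.mem_insert_of_mem hj))

theorem HasLin.hasDerivAt {F : ℝ → ℝ} {a b : ℝ} (h : HasLin F a b) :
    F 0 = a ∧ HasDerivAt F b 0 := by
  induction h with
  | const a => exact ⟨rfl, hasDerivAt_const _ _⟩
  | add _ _ h1 h2 => exact ⟨by simp [h1.1, h2.1], h1.2.add h2.2⟩
  | smul _ h =>
    refine ⟨by simp, ?_⟩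
    have := (hasDerivAt_id (0 : ℝ)).mul h.2
    simp only [id, h.1, one_mul, zero_mul, add_zero] at this
    exact this

/-- A curve inside a subspace has its velocity there. As V carries no topology, this is tested with
linear functionals on V/U, which turn the curve into the zero function of t and the velocity into an
ordinary derivative. -/
theorem HasLin.mem {F : ℝ → V} {a b : V} (h : HasLin F a b) (U : Submodule ℝ V)
    (hU : ∀ t, F t ∈ U) : b ∈ U := by
  rw [← Submodule.Quotient.mk_eq_zero U, ← Module.forall_dual_apply_eq_zero_iff ℝ]
  intro φ
  have h1 := (h.map (φ ∘ₗ U.mkQ)).hasDerivAt.2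
  have h0 : (fun t => (φ ∘ₗ U.mkQ) (F t)) = fun _ => 0 := by
    funext t
    simp [(Submodule.Quotient.mk_eq_zero U).2 (hU t)]
  rw [h0] at h1
  simpa using h1.unique (hasDerivAt_const _ _)

theorem HasLin.pow {A : Type*} [Ring A] [Algebra ℝ A] {x y : A} (h : Commute x y) (k : ℕ) :
    HasLin (fun t : ℝ => (x + t • y) ^ k) (x ^ k) ((k : ℝ) • (x ^ (k - 1) * y)) := by
  induction k with
  | zero => simpa using HasLin.const (1 : A)
  | succ k ih =>
    have h1 : HasLin (fun t : ℝ => x + t • y) x y := by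
      simpa using (HasLin.const x).add (HasLin.const y).smul
    have h2 := ih.map₂ h1 (LinearMap.mul ℝ A)
    simp only [LinearMap.mul_apply'] at h2
    have h3 : x ^ k * y + ((k : ℝ) • (x ^ (k - 1) * y)) * x =
        ((k + 1 : ℕ) : ℝ) • (x ^ (k + 1 - 1) * y) := by
      rcases k with _ | k
      · simp
      · rw [smul_mul_assoc, mul_assoc, ← h.eq, ← mul_assoc, Nat.add_sub_cancel, Nat.add_sub_cancel,
          ← pow_succ]
        push_cast
        module
    rw [h3] at h2
    simpa only [pow_succ] using h2

end HasLin

/-! ### Spanning sets of the spaces of differential operators -/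

/-- Polarisation: a ∂_v^l ∂_i is, up to the factor l + 1, the velocity at t = 0 of a ∂_{v+t
e_i}^{l+1}, which stays in the span. -/
theorem mul_mul_pdList_mem (a : Smooth d) (l : List (Fin d)) :
    mul a * pdList l ∈ Submodule.span ℝ {T | ∃ v, T = mul a * dv v ^ l.length} := by
  induction l with
  | nil => exact Submodule.subset_span ⟨0, by simp [pdList]⟩
  | cons i l ih =>
    have hi : mul a * pdList (i :: l) = LinearMap.mulRight ℝ (pd i) (mul a * pdList l) := by
      rw [LinearMap.mulRight_apply, mul_assoc, (pdList_commute_pd l i).eq]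
      simp [pdList]
    rw [hi]
    have hle : Submodule.span ℝ {T | ∃ v, T = mul a * dv v ^ l.length} ≤
        (Submodule.span ℝ {T | ∃ v, T = mul a * dv v ^ (l.length + 1)}).comap
          (LinearMap.mulRight ℝ (pd i)) := by
      rw [Submodule.span_le]
      rintro _ ⟨v, rfl⟩
      have h := (HasLin.pow (dv_commute_pd v i) (l.length + 1)).map (LinearMap.mulLeft ℝ (mul a))
      have hm := h.mem (Submodule.span ℝ {T | ∃ v, T = mul a * dv v ^ (l.length + 1)}) fun t =>
        Submodule.subset_span ⟨v + t • Pi.single i 1, by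
          rw [dv_add_smul, dv_single, LinearMap.mulLeft_apply]⟩
      rw [map_smul, Submodule.smul_mem_iff _ (by positivity)] at hm
      simpa [mul_assoc] using hm
    exact hle ih

theorem diffOps_mono {m n : ℕ} (h : m ≤ n) : diffOps d m ≤ diffOps d n :=
  Submodule.span_mono fun _ ⟨a, l, hl, hT⟩ => ⟨a, l, hl.trans h, hT⟩

theorem contracted_mem (k r : ℕ) (S : Tensor d k) : contracted r S ∈ diffOps d k :=
  Submodule.sum_mem _ fun I _ => Submodule.subset_span ⟨_, _, by simp, rfl⟩

theorem quantHom_mem (μ : ℝ) (k : ℕ) (S : Tensor d k) : quantHom μ k S ∈ diffOps d k := by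
  simp only [quantHom, LinearMap.sum_apply, LinearMap.smul_apply]
  exact Submodule.sum_mem _ fun r _ => Submodule.smul_mem _ _ (contracted_mem k r S)

/-- Q_lam(a v^k) is a ∂_v^k plus terms of lower order in the same direction v, so the relation is
triangular and can be inverted by induction on k. The coefficient function changes along the way,
hence the generalisation over a. -/
theorem mul_mul_dv_pow_mem_span (n : ℕ) (lam : ℝ) (k : ℕ) (hk : k ≤ n) (a : Smooth d)
    (v : Fin d → ℝ) : mul a * dv v ^ k ∈ Submodule.span ℝ
      {T | ∃ k ≤ n, ∃ f v, T = quantHom lam k (tpow k f v)} := by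
  induction k using Nat.strong_induction_on generalizing a with
  | _ k ih =>
    have h := quantHom_tpow lam k a v
    rw [Finset.sum_range_succ'] at h
    simp only [quantCoeff_zero, one_smul, pow_zero, Nat.sub_zero, Module.End.one_apply] at h
    rw [← sub_eq_iff_eq_add'] at h
    rw [← h]
    refine Submodule.sub_mem _ (Submodule.subset_span ⟨k, hk, a, v, rfl⟩)
      (Submodule.sum_mem _ fun r hr => Submodule.smul_mem _ _ ?_)
    rw [Finset.mem_range] at hr
    exact ih _ (by omega) (by omega) _

theorem diffOps_eq_span (n : ℕ) (lam : ℝ) : diffOps d n =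
    Submodule.span ℝ {T | ∃ k ≤ n, ∃ f v, T = quantHom lam k (tpow k f v)} := by
  refine le_antisymm (Submodule.span_le.2 ?_) (Submodule.span_le.2 ?_)
  · rintro _ ⟨a, l, hl, rfl⟩
    refine Submodule.span_le.2 ?_ (mul_mul_pdList_mem a l)
    rintro _ ⟨v, rfl⟩
    exact mul_mul_dv_pow_mem_span n lam _ hl a v
  · rintro _ ⟨k, hk, f, v, rfl⟩
    exact diffOps_mono hk (quantHom_mem _ _ _)

/-- Induction on differential operators, generated by the operators `Q_lam(f v^k)`. -/
theorem diffOps_induction {n : ℕ} (lam : ℝ) {p : Op d → Prop}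
    (gen : ∀ k ≤ n, ∀ f v, p (quantHom lam k (tpow k f v))) (zero : p 0)
    (add : ∀ T ∈ diffOps d n, ∀ U ∈ diffOps d n, p T → p U → p (T + U))
    (smul : ∀ (c : ℝ), ∀ T ∈ diffOps d n, p T → p (c • T)) {T : Op d} (hT : T ∈ diffOps d n) :
    p T := by
  have h := diffOps_eq_span (d := d) n lam
  rw [h] at hT
  induction hT using Submodule.span_induction with
  | mem T hT =>
    obtain ⟨k, hk, f, v, rfl⟩ := hT
    exact gen k hk f v
  | zero => exact zero
  | add T U hT hU h1 h2 => exact add T (h ▸ hT) U (h ▸ hU) h1 h2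
  | smul c T hT h1 => exact smul c T (h ▸ hT) h1

/-! ### Polarised quantisation -/

/-- The derivative of `v ↦ Q_μ(f v^k)` in the direction `w`. -/
def polarQuant (μ : ℝ) (k : ℕ) (f : Smooth d) (v w : Fin d → ℝ) : Op d :=
  ∑ r ∈ Finset.range (k + 1), quantCoeff d k r μ •
    (((k - r : ℕ) : ℝ) • (mul ((dv v ^ r) f) * (dv v ^ (k - r - 1) * dv w)) +
      (r : ℝ) • (mul ((dv v ^ (r - 1)) (dv w f)) * dv v ^ (k - r)))

/-- The velocity argument is run in the space of functions of the weight μ, with `Q` collecting all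
quantisations at once. This is what yields one symmetric tensor serving every μ. -/
theorem exists_quantHom_eq_polarQuant (k : ℕ) (f : Smooth d) (v w : Fin d → ℝ) :
    ∃ U ∈ symTensors d k, ∀ μ, quantHom μ k U = polarQuant μ k f v w := by
  let Q : Tensor d k →ₗ[ℝ] ℝ → Op d := LinearMap.pi fun μ => quantHom μ k
  let c (r : ℕ) : Op d →ₗ[ℝ] ℝ → Op d :=
    LinearMap.pi fun μ => quantCoeff d k r μ • LinearMap.id
  have h : HasLin (fun t => ∑ r ∈ Finset.range (k + 1),
      c r (mul (((dv v + t • dv w) ^ r) f) * (dv v + t • dv w) ^ (k - r)))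
      (∑ r ∈ Finset.range (k + 1), c r (mul ((dv v ^ r) f) * dv v ^ (k - r)))
      (∑ r ∈ Finset.range (k + 1),
        c r (mul ((dv v ^ r) f) * (((k - r : ℕ) : ℝ) • (dv v ^ (k - r - 1) * dv w)) +
          mul (((r : ℝ) • (dv v ^ (r - 1) * dv w)) f) * dv v ^ (k - r))) :=
    HasLin.sum _ fun r _ => HasLin.map
      (((HasLin.pow (dv_commute v w) r).map (mulₗ ∘ₗ LinearMap.applyₗ f)).map₂
        (HasLin.pow (dv_commute v w) (k - r)) (LinearMap.mul ℝ (Op d))) (c r)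
  have hm := h.mem ((symTensors d k).map Q) fun t => ⟨tpow k f (v + t • w), tpow_mem _ _ _, by
    funext μ
    simp [Q, c, quantHom_tpow, dv_add_smul, Finset.sum_apply]⟩
  obtain ⟨U, hU, hQ⟩ := hm
  refine ⟨U, hU, fun μ => ?_⟩
  have := congrFun hQ μ
  rw [show quantHom μ k U = Q U μ from rfl, this, Finset.sum_apply, polarQuant]
  refine Finset.sum_congr rfl fun r _ => ?_
  simp [c, mul_smul']

/-! ### Lie derivatives of operators -/

theorem dirDeriv_apply (K : VField d) (f : Smooth d) : dirDeriv K f = ∑ i, K i * pd i f := by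
  simp [dirDeriv, mul_apply]

theorem dirDeriv_mul (K : VField d) (f g : Smooth d) :
    dirDeriv K (f * g) = dirDeriv K f * g + f * dirDeriv K g := by
  simp only [dirDeriv_apply, pd_mul, Finset.sum_mul, Finset.mul_sum, ← Finset.sum_add_distrib]
  exact Finset.sum_congr rfl fun i _ => by ring

theorem lieDeriv_apply (μ : ℝ) (K : VField d) (f : Smooth d) :
    lieDeriv μ K f = dirDeriv K f + μ • (divergence K * f) := rfl

theorem lieDeriv_add (μ : ℝ) (K K' : VField d) :
    lieDeriv μ (K + K') = lieDeriv μ K + lieDeriv μ K' := by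
  simp only [lieDeriv, dirDeriv, divergence, Pi.add_apply, mul_add', map_add, add_mul,
    Finset.sum_add_distrib, smul_add]
  abel

theorem lieDeriv_smul (μ : ℝ) (c : ℝ) (K : VField d) :
    lieDeriv μ (c • K) = c • lieDeriv μ K := by
  simp only [lieDeriv, dirDeriv, divergence, Pi.smul_apply, mul_smul', map_smul, smul_mul_assoc,
    ← Finset.smul_sum, smul_add, smul_comm μ c]

theorem ad_add_field (μ : ℝ) (K K' : VField d) (T : Op d) :
    ad μ (K + K') T = ad μ K T + ad μ K' T := by
  simp only [ad, lieDeriv_add, add_mul, mul_add]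
  abel

theorem ad_smul_field (μ c : ℝ) (K : VField d) (T : Op d) : ad μ (c • K) T = c • ad μ K T := by
  simp only [ad, lieDeriv_smul, smul_mul_assoc, mul_smul_comm, smul_sub]

theorem ad_add (μ : ℝ) (K : VField d) (T U : Op d) : ad μ K (T + U) = ad μ K T + ad μ K U := by
  simp only [ad, add_mul, mul_add]
  abel

theorem ad_smul (μ c : ℝ) (K : VField d) (T : Op d) : ad μ K (c • T) = c • ad μ K T := by
  simp only [ad, smul_mul_assoc, mul_smul_comm, smul_sub]

/-- `ad_K` as a linear map. -/
def adₗ (μ : ℝ) (K : VField d) : Op d →ₗ[ℝ] Op d where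
  toFun := ad μ K
  map_add' := ad_add μ K
  map_smul' c := ad_smul μ c K

theorem adₗ_apply (μ : ℝ) (K : VField d) (T : Op d) : adₗ μ K T = ad μ K T := rfl

theorem ad_sum {ι : Type*} (s : Finset ι) (μ : ℝ) (K : VField d) (T : ι → Op d) :
    ad μ K (∑ i ∈ s, T i) = ∑ i ∈ s, ad μ K (T i) := by
  simp only [← adₗ_apply, map_sum]

/-- The divergence term of the Lie derivative commutes with multiplication by g, so only the
derivation part sees g. -/
theorem ad_mul_mul (μ : ℝ) (K : VField d) (g : Smooth d) (X : Op d) :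
    ad μ K (mul g * X) = mul (dirDeriv K g) * X + mul g * ad μ K X := by
  ext1 h
  simp only [ad, LinearMap.sub_apply, LinearMap.add_apply, Module.End.mul_apply, lieDeriv_apply,
    mul_apply, dirDeriv_mul, mul_sub, mul_add, mul_smul_comm]
  rw [mul_left_comm g (divergence K)]
  abel

theorem adHat_ofPencil (K : VField d) (D : ℝ → Op d) :
    adHat K (ofPencil D) = ofPencil fun μ => ad μ K (D μ) := by
  rw [adHat, lieDerivHat, ofPencil_mul, ofPencil_mul]
  exact (map_sub ofPencil (fun μ => lieDeriv μ K * D μ) fun μ => D μ * lieDeriv μ K).symm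

/-! ### Projective vector fields -/

theorem dv_pow_coord_mul (v : Fin d → ℝ) (a : Fin d) (j : ℕ) (u : Smooth d) :
    (dv v ^ j) (coord a * u) =
      coord a * (dv v ^ j) u + ((j : ℝ) * v a) • (dv v ^ (j - 1)) u :=
  congrArg (fun T : Op d => T u) (dv_pow_commute_mul_coord v a j)

theorem dv_pow_pd (v : Fin d → ℝ) (i : Fin d) (j : ℕ) (u : Smooth d) :
    (dv v ^ j) (pd i u) = pd i ((dv v ^ j) u) :=
  congrArg (fun T : Op d => T u) ((dv_commute_pd v i).pow_left j).eq

theorem ad_dv_pow_apply (μ : ℝ) (K : VField d) (v : Fin d → ℝ) (j : ℕ) (h : Smooth d) :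
    ad μ K (dv v ^ j) h = dirDeriv K ((dv v ^ j) h) + μ • (divergence K * (dv v ^ j) h) -
      (dv v ^ j) (dirDeriv K h + μ • (divergence K * h)) := rfl

theorem ad_translation (μ : ℝ) (i : Fin d) (k : ℕ) (f : Smooth d) (v : Fin d → ℝ) :
    ad μ (Pi.single i 1) (quantHom μ k (tpow k f v)) = quantHom μ k (tpow k (pd i f) v) := by
  have hK : ∀ u : Smooth d, dirDeriv (Pi.single i 1) u = pd i u := fun u => by
    simp [dirDeriv_apply, Pi.single_apply]
  have hd : divergence (Pi.single i 1 : VField d) = 0 := by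
    rw [divergence]
    refine Finset.sum_eq_zero fun j _ => ?_
    rcases eq_or_ne j i with rfl | hj
    · simp [pd_one]
    · simp [hj]
  rw [quantHom_tpow, quantHom_tpow, ad_sum]
  refine Finset.sum_congr rfl fun r _ => ?_
  rw [ad_smul, ad_mul_mul, hK, dv_pow_pd]
  have h0 : ad μ (Pi.single i 1) (dv v ^ (k - r)) = 0 := by
    ext1 h
    rw [ad_dv_pow_apply, hd, hK, hK]
    simp [dv_pow_pd]
  rw [h0, mul_zero, add_zero]

/-- The divergence of x^a ∂_i is constant and drops out of the commutator with ∂_v^j. What remains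
is the tensorial action on f v^k: differentiate f, and rotate one factor v towards e_i. -/
theorem ad_linear (μ : ℝ) (a i : Fin d) (k : ℕ) (f : Smooth d) (v : Fin d → ℝ) :
    ad μ (Pi.single i (coord a)) (quantHom μ k (tpow k f v)) =
      quantHom μ k (tpow k (coord a * pd i f) v) -
        v a • polarQuant μ k f v (Pi.single i 1) := by
  have hK : ∀ u : Smooth d, dirDeriv (Pi.single i (coord a)) u = coord a * pd i u := fun u => by
    simp [dirDeriv_apply, Pi.single_apply]
  obtain ⟨c, hd⟩ : ∃ c : ℝ, divergence (Pi.single i (coord a) : VField d) = c • 1 := by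
    rw [divergence, Finset.sum_eq_single i]
    · rw [Pi.single_eq_same, pd_coord]
      exact ⟨if i = a then 1 else 0, by split_ifs <;> simp⟩
    · intro j _ hj
      simp [hj]
    · simp
  rw [quantHom_tpow, quantHom_tpow, ad_sum, polarQuant, Finset.smul_sum, ← Finset.sum_sub_distrib]
  refine Finset.sum_congr rfl fun r _ => ?_
  rw [ad_smul, ad_mul_mul, hK, smul_comm (v a)]
  refine Eq.trans ?_ (smul_sub _ _ _)
  congr 1
  ext1 h
  simp only [LinearMap.sub_apply, LinearMap.add_apply, Module.End.mul_apply, LinearMap.smul_apply,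
    mul_apply, ad_dv_pow_apply, hd, hK, dv_single, dv_pow_pd, map_add, map_smul, smul_mul_assoc,
    one_mul, dv_pow_coord_mul]
  simp only [Algebra.smul_def, map_mul]
  ring

/-- The Euler operator `x^i ∂_i`. -/
def euler (d : ℕ) : Op d := ∑ i, mul (coord i) * pd i

theorem euler_apply (f : Smooth d) : euler d f = ∑ i, coord i * pd i f := by
  simp [euler, mul_apply]

theorem dv_pow_euler (v : Fin d → ℝ) (j : ℕ) (u : Smooth d) :
    (dv v ^ j) (euler d u) = euler d ((dv v ^ j) u) + (j : ℝ) • (dv v ^ j) u := by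
  simp only [euler_apply, map_sum, dv_pow_coord_mul, dv_pow_pd, Finset.sum_add_distrib]
  congr 1
  rcases j with _ | j
  · simp
  · simp only [Nat.add_sub_cancel, mul_smul, ← Finset.smul_sum]
    rw [← dv_apply, pow_succ', Module.End.mul_apply]

theorem sum_pd_coord_mul (u : Smooth d) :
    ∑ i, pd i (coord i * u) = (d : ℝ) • u + euler d u := by
  simp [pd_mul, pd_coord, euler_apply, Finset.sum_add_distrib, Algebra.smul_def]

/-- This recurrence characterises the projective coefficients: it is the balance needed for the
cancellation in `ad_quadratic`. Since r < k, the denominator d + 2k - 1 - r is positive. -/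
theorem quantCoeff_succ (μ : ℝ) {k r : ℕ} (hr : r < k) :
    quantCoeff d k (r + 1) μ * (((r + 1 : ℕ) : ℝ) * (d + 2 * k - (r + 1 : ℕ))) =
      quantCoeff d k r μ * (((k - r : ℕ) : ℝ) * ((d + 1) * μ + k - 1 - r)) := by
  have h1 : ((k.choose (r + 1) : ℕ) : ℝ) * ((r + 1 : ℕ) : ℝ) = k.choose r * ((k - r : ℕ) : ℝ) := by
    exact_mod_cast Nat.choose_succ_right_eq k r
  have h2 : (d : ℝ) + 2 * k - 1 - r ≠ 0 := by
    have : (r : ℝ) + 1 ≤ k := by exact_mod_cast hr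
    have : (0 : ℝ) ≤ d := by positivity
    have : (0 : ℝ) ≤ r := by positivity
    linarith
  rw [quantCoeff, quantCoeff, Finset.prod_range_succ]
  have h3 : (((d : ℝ) + 1) * μ + k - 1 - r) / (d + 2 * k - 1 - r) * (d + 2 * k - (r + 1 : ℕ)) =
      (d + 1) * μ + k - 1 - r := by
    rw [show (d : ℝ) + 2 * k - (r + 1 : ℕ) = d + 2 * k - 1 - r by push_cast; ring]
    exact div_mul_cancel₀ _ h2
  linear_combination (∏ s ∈ Finset.range r,
    (((d : ℝ) + 1) * μ + k - 1 - s) / (d + 2 * k - 1 - s)) *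
    ((((d : ℝ) + 1) * μ + k - 1 - r) * h1 +
      (k.choose (r + 1) : ℝ) * ((r + 1 : ℕ) : ℝ) * h3)

/-- Here the weight enters, through the divergence (d + 1) x^a. Besides the tensorial part, the r-th
term of Q_μ(f v^k) produces errors in (∂_v^{r-1} f) ∂_v^{k-r} and in (∂_v^r f) ∂_v^{k-r-1}; the
first error of term r + 1 cancels the second error of term r. -/
theorem ad_quadratic (μ : ℝ) (a : Fin d) (k : ℕ) (f : Smooth d) (v : Fin d → ℝ) :
    ad μ (fun i => coord a * coord i) (quantHom μ k (tpow k f v)) =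
      quantHom μ k (tpow k (coord a * (euler d f - (k : ℝ) • f)) v) -
        v a • ∑ i, polarQuant μ k (coord i * f) v (Pi.single i 1) := by
  set K : VField d := fun i => coord a * coord i with hKdef
  have hK : ∀ u : Smooth d, dirDeriv K u = coord a * euler d u := fun u => by
    simp only [dirDeriv_apply, hKdef, euler_apply, Finset.mul_sum, mul_assoc]
  have hd : divergence K = ((d : ℝ) + 1) • coord a := by
    have : divergence K = ∑ i, pd i (coord i * coord a) :=
      Finset.sum_congr rfl fun i _ => by rw [mul_comm]
    rw [this, sum_pd_coord_mul, euler_apply, add_smul]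
    simp [pd_coord]
  have term : ∀ r ∈ Finset.range (k + 1), ad μ K (mul ((dv v ^ r) f) * dv v ^ (k - r)) =
      mul ((dv v ^ r) (coord a * (euler d f - (k : ℝ) • f))) * dv v ^ (k - r) -
      v a • ∑ i, (((k - r : ℕ) : ℝ) • (mul ((dv v ^ r) (coord i * f)) *
          (dv v ^ (k - r - 1) * dv (Pi.single i 1))) +
        (r : ℝ) • (mul ((dv v ^ (r - 1)) (dv (Pi.single i 1) (coord i * f))) * dv v ^ (k - r))) +
      v a • (((r : ℝ) * (d + 2 * k - r)) • (mul ((dv v ^ (r - 1)) f) * dv v ^ (k - r)) -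
        (((k - r : ℕ) : ℝ) * ((d + 1) * μ + k - 1 - r)) •
          (mul ((dv v ^ r) f) * dv v ^ (k - r - 1))) := by
    intro r hr
    have hrk : r ≤ k := by simpa [Nat.lt_succ_iff] using hr
    obtain ⟨j, rfl⟩ := Nat.exists_eq_add_of_le hrk
    rw [Nat.add_sub_cancel_left, ad_mul_mul, hK]
    ext1 h
    -- The factors j and r are kept in front of these identities so that the truncated exponents j -
    -- 1 and r - 1 do no harm at zero.
    have hp : (j : ℝ) • ∑ i, (dv v ^ r) (coord i * f) * (dv v ^ (j - 1)) (dv (Pi.single i 1) h) =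
        (j : ℝ) • ((dv v ^ r) f * euler d ((dv v ^ (j - 1)) h) +
          (r : ℝ) • ((dv v ^ (r - 1)) f * (dv v ^ j) h)) := by
      simp only [dv_pow_coord_mul, dv_single, dv_pow_pd, add_mul, Finset.sum_add_distrib,
        euler_apply, Finset.mul_sum, smul_add]
      congr 1
      · congr 1
        exact Finset.sum_congr rfl fun i _ => by ring
      · rcases j with _ | j
        · simp
        · congr 1
          rw [pow_succ', Module.End.mul_apply, dv_apply, Finset.mul_sum, Finset.smul_sum]
          refine Finset.sum_congr rfl fun i _ => ?_
          simp only [Nat.add_sub_cancel, Algebra.smul_def, map_mul]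
          ring
    have hq : (r : ℝ) • ∑ i, (dv v ^ (r - 1)) (dv (Pi.single i 1) (coord i * f)) =
        (r : ℝ) • (((d : ℝ) + r - 1) • (dv v ^ (r - 1)) f + euler d ((dv v ^ (r - 1)) f)) := by
      simp only [dv_single]
      rw [← map_sum, sum_pd_coord_mul, map_add, map_smul, dv_pow_euler]
      rcases r with _ | r
      · simp
      · push_cast
        module
    have hq' : (r : ℝ) • ∑ i, (dv v ^ (r - 1)) (dv (Pi.single i 1) (coord i * f)) * (dv v ^ j) h =
        (r : ℝ) • (((d : ℝ) + r - 1) • (dv v ^ (r - 1)) f + euler d ((dv v ^ (r - 1)) f)) *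
          (dv v ^ j) h := by
      rw [← hq, ← Finset.sum_mul, smul_mul_assoc]
    have hj : (j : ℝ) • ((dv v ^ (j - 1)) (euler d h)) = (j : ℝ) • (euler d ((dv v ^ (j - 1)) h) +
        ((j : ℝ) - 1) • (dv v ^ (j - 1)) h) := by
      rw [dv_pow_euler]
      rcases j with _ | j
      · simp
      · simp
    have hr1 : (r : ℝ) • ((dv v ^ (r - 1)) (euler d f)) = (r : ℝ) • (euler d ((dv v ^ (r - 1)) f) +
        ((r : ℝ) - 1) • (dv v ^ (r - 1)) f) := by
      rw [dv_pow_euler]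
      rcases r with _ | r
      · simp
      · simp
    simp only [LinearMap.sub_apply, LinearMap.add_apply, Module.End.mul_apply,
      LinearMap.smul_apply, LinearMap.sum_apply, mul_apply, ad_dv_pow_apply, hd, hK, map_sub,
      map_add, map_smul, smul_mul_assoc, dv_pow_coord_mul v a, Finset.sum_add_distrib,
      ← Finset.smul_sum, dv_pow_euler v j, dv_pow_euler v r]
    simp only [Algebra.smul_def, map_mul, map_sub, map_add, map_one, map_natCast, map_ofNat, Nat.cast_add] at *
    linear_combination algebraMap ℝ (Smooth d) (v a) * (hp + hq' - (dv v ^ r) f * hj -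
      (dv v ^ j) h * hr1)
  rw [quantHom_tpow, ad_sum]
  simp only [ad_smul]
  rw [Finset.sum_congr rfl fun r hr => congrArg (quantCoeff d k r μ • ·) (term r hr)]
  -- The first family of errors vanishes at r = 0 and the second at r = k; after a shift of the
  -- index they match by the recurrence.
  have cancel : ∑ r ∈ Finset.range (k + 1), quantCoeff d k r μ •
      (((r : ℝ) * (d + 2 * k - r)) • (mul ((dv v ^ (r - 1)) f) * dv v ^ (k - r)) -
        (((k - r : ℕ) : ℝ) * ((d + 1) * μ + k - 1 - r)) •
          (mul ((dv v ^ r) f) * dv v ^ (k - r - 1))) = 0 := by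
    simp only [smul_sub, Finset.sum_sub_distrib]
    rw [Finset.sum_range_succ', Finset.sum_range_succ, sub_eq_zero]
    simp only [Nat.sub_self, Nat.cast_zero, zero_mul, zero_smul, smul_zero, add_zero]
    refine Finset.sum_congr rfl fun r hr => ?_
    rw [smul_smul, smul_smul, quantCoeff_succ μ (Finset.mem_range.1 hr), Nat.add_sub_cancel,
      Nat.sub_sub]
  have hsum : ∑ i, polarQuant μ k (coord i * f) v (Pi.single i 1) =
      ∑ r ∈ Finset.range (k + 1), quantCoeff d k r μ • ∑ i,
        (((k - r : ℕ) : ℝ) • (mul ((dv v ^ r) (coord i * f)) *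
          (dv v ^ (k - r - 1) * dv (Pi.single i 1))) +
        (r : ℝ) • (mul ((dv v ^ (r - 1)) (dv (Pi.single i 1) (coord i * f))) *
          dv v ^ (k - r))) := by
    simp only [polarQuant, Finset.smul_sum]
    exact Finset.sum_comm
  rw [hsum, quantHom_tpow]
  simp only [smul_add (quantCoeff d k _ μ), smul_sub (quantCoeff d k _ μ) (mul _ * _) (v a • _),
    Finset.sum_add_distrib, Finset.sum_sub_distrib, smul_comm (quantCoeff d k _ μ) (v a),
    ← Finset.smul_sum, cancel, smul_zero, add_zero]

/-! ### Projective equivariance of the quantisation map -/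

/-- The order of the quantifiers matters: U does not depend on μ, so the symbol of ad_K Δ read off
at weight lam is the right one at every weight. -/
theorem exists_ad_quantHom {K : VField d} (hK : K ∈ projFields d) (k : ℕ) (f : Smooth d)
    (v : Fin d → ℝ) :
    ∃ U ∈ symTensors d k, ∀ μ, ad μ K (quantHom μ k (tpow k f v)) = quantHom μ k U := by
  induction hK using Submodule.span_induction with
  | mem K hK =>
    rcases hK with (⟨i, rfl⟩ | ⟨⟨a, i⟩, rfl⟩) | ⟨a, rfl⟩
    · exact ⟨_, tpow_mem _ _ _, fun μ => ad_translation μ i k f v⟩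
    · obtain ⟨U, hU, hQ⟩ := exists_quantHom_eq_polarQuant k f v (Pi.single i 1)
      refine ⟨tpow k (coord a * pd i f) v - v a • U,
        Submodule.sub_mem _ (tpow_mem _ _ _) (Submodule.smul_mem _ _ hU), fun μ => ?_⟩
      rw [map_sub, map_smul, hQ]
      exact ad_linear μ a i k f v
    · choose U hU hQ using fun i : Fin d =>
        exists_quantHom_eq_polarQuant k (coord i * f) v (Pi.single i 1)
      refine ⟨tpow k (coord a * (euler d f - (k : ℝ) • f)) v - v a • ∑ i, U i,
        Submodule.sub_mem _ (tpow_mem _ _ _)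
          (Submodule.smul_mem _ _ (Submodule.sum_mem _ fun i _ => hU i)), fun μ => ?_⟩
      rw [map_sub, map_smul, map_sum]
      simp only [hQ]
      exact ad_quadratic μ a k f v
  | zero =>
    refine ⟨0, Submodule.zero_mem _, fun μ => ?_⟩
    have := ad_smul_field μ 0 (0 : VField d) (quantHom μ k (tpow k f v))
    rw [zero_smul, zero_smul] at this
    rw [this, map_zero]
  | add K K' _ _ h h' =>
    obtain ⟨U, hU, hQ⟩ := h
    obtain ⟨U', hU', hQ'⟩ := h'
    exact ⟨U + U', Submodule.add_mem _ hU hU', fun μ => by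
      rw [ad_add_field, hQ, hQ', map_add]⟩
  | smul c K _ h =>
    obtain ⟨U, hU, hQ⟩ := h
    exact ⟨c • U, Submodule.smul_mem _ _ hU, fun μ => by rw [ad_smul_field, hQ, map_smul]⟩

/-! ### Values of the liftings on quantised symbols -/

theorem polyWeight_mul_ofPencil (P : Polynomial ℝ) (D : ℝ → Op d) :
    polyWeight d P * ofPencil D = ofPencil fun μ => P.eval μ • D μ := by
  rw [polyWeight_eq, ofPencil_mul]
  simp only [smul_mul_assoc, one_mul]

/-- A quantised homogeneous symbol has a single nonzero component, of degree k and therefore of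
index n - k. -/
theorem triangularLifting_quantHom {n k : ℕ} (hk : k ≤ n) (lam : ℝ) (P : ℕ → Polynomial ℝ)
    {S : Tensor d k} (hS : S ∈ symTensors d k) (h : quantHom lam k S ∈ diffOps d n) :
    triangularLifting d n lam P ⟨quantHom lam k S, h⟩ =
      ofPencil fun μ => (((P (n - k)).eval lam)⁻¹ * (P (n - k)).eval μ) • quantHom μ k S := by
  simp only [triangularLifting, LinearMap.comp_apply, LinearMap.sum_apply, LinearMap.smul_apply,
    Submodule.subtype_apply, LinearMap.mulLeft_apply]
  rw [Finset.sum_eq_single (n - k)]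
  · rw [component_quantHom hk lam (Nat.sub_le _ _) hS, if_pos rfl, dloLifting_quantHom hk lam hS,
      polyWeight_mul_ofPencil, ← map_smul]
    congr 1
    funext μ
    simp [mul_smul]
  · intro i hi hne
    rw [component_quantHom hk lam (by simpa [Nat.lt_succ_iff] using hi) hS, if_neg hne]
    simp
  · intro h
    simp only [Finset.mem_range] at h
    omega

/-! ### Orders of operators and regularity of the liftings -/

theorem quantHom_mem_of_le {k n : ℕ} (hk : k ≤ n) (μ : ℝ) (S : Tensor d k) :
    quantHom μ k S ∈ diffOps d n := diffOps_mono hk (quantHom_mem μ k S)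

theorem mul_mul_dv_pow_mem (a : Smooth d) (v : Fin d → ℝ) (k : ℕ) :
    mul a * dv v ^ k ∈ diffOps d k := by
  have h := contracted_mem k 0 (tpow k a v)
  rwa [contracted_tpow k 0 (Nat.zero_le _), pow_zero, Nat.sub_zero] at h

theorem diffOpsHat_eq (n : ℕ) : diffOpsHat d n = Submodule.span ℝ
    {T | ∃ (a : Smooth d) (j : ℕ) (l : List (Fin d)), j + l.length ≤ n ∧
      T = ofPencil fun μ => μ ^ j • (mul a * pdList l)} := by
  have h : ∀ (a : Smooth d) (j : ℕ) (l : List (Fin d)),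
      const (mul a) * weightOp d ^ j * const (pdList l) =
        ofPencil fun μ => μ ^ j • (mul a * pdList l) := fun a j l => by
    rw [weightOp_pow, const_apply, const_apply, ofPencil_mul, ofPencil_mul]
    simp only [mul_smul_comm, smul_mul_assoc, mul_one]
  simp only [diffOpsHat, h]

theorem ofPencil_eval_smul_mem {n m j : ℕ} (hn : j + m ≤ n) {p : Polynomial ℝ}
    (hp : p.natDegree ≤ j) {X : Op d} (hX : X ∈ diffOps d m) :
    (ofPencil fun μ => p.eval μ • X) ∈ diffOpsHat d n := by
  induction hX using Submodule.span_induction with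
  | mem X hX =>
    obtain ⟨a, l, hl, rfl⟩ := hX
    have : (ofPencil fun μ => p.eval μ • (mul a * pdList l)) =
        ∑ i ∈ Finset.range (p.natDegree + 1),
          p.coeff i • ofPencil fun μ => μ ^ i • (mul a * pdList l) := by
      simp only [← map_smul, ← map_sum]
      congr 1
      funext μ
      simp [Polynomial.eval_eq_sum_range, Finset.sum_smul, mul_smul]
    rw [this, diffOpsHat_eq]
    refine Submodule.sum_mem _ fun i hi => Submodule.smul_mem _ _
      (Submodule.subset_span ⟨a, i, l, ?_, rfl⟩)
    rw [Finset.mem_range] at hi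
    omega
  | zero =>
    convert Submodule.zero_mem _
    rw [← map_zero ofPencil]
    congr 1
    funext μ
    simp
  | add X Y _ _ h h' =>
    convert Submodule.add_mem _ h h'
    rw [← map_add]
    congr 1
    funext μ
    simp
  | smul c X _ h =>
    convert Submodule.smul_mem _ c h
    rw [← map_smul]
    congr 1
    funext μ
    simp [smul_comm c]

/-- `quantCoeff` as a polynomial in the weight. -/
def quantPoly (d k r : ℕ) : Polynomial ℝ :=
  Polynomial.C (k.choose r : ℝ) * ∏ s ∈ Finset.range r,
    (Polynomial.C (((d : ℝ) + 1) / ((d : ℝ) + 2 * k - 1 - s)) * Polynomial.X +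
      Polynomial.C (((k : ℝ) - 1 - s) / ((d : ℝ) + 2 * k - 1 - s)))

theorem eval_quantPoly (d k r : ℕ) (μ : ℝ) : (quantPoly d k r).eval μ = quantCoeff d k r μ := by
  simp only [quantPoly, quantCoeff, Polynomial.eval_mul, Polynomial.eval_C, Polynomial.eval_prod,
    Polynomial.eval_add, Polynomial.eval_X]
  congr 1
  exact Finset.prod_congr rfl fun s _ => by ring

theorem natDegree_quantPoly_le (d k r : ℕ) : (quantPoly d k r).natDegree ≤ r := by
  refine (Polynomial.natDegree_C_mul_le _ _).trans ((Polynomial.natDegree_prod_le _ _).trans ?_)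
  calc _ ≤ ∑ s ∈ Finset.range r, 1 := Finset.sum_le_sum fun s _ => Polynomial.natDegree_linear_le
    _ = r := by simp

/-- In the r-th term the weight enters with degree at most (n - k) + r, and k - r derivatives
remain: the total order is at most n. -/
theorem ofPencil_quantHom_mem {n k : ℕ} (hk : k ≤ n) {p : Polynomial ℝ}
    (hp : p.natDegree ≤ n - k) (f : Smooth d) (v : Fin d → ℝ) :
    (ofPencil fun μ => p.eval μ • quantHom μ k (tpow k f v)) ∈ diffOpsHat d n := by
  have : (ofPencil fun μ => p.eval μ • quantHom μ k (tpow k f v)) =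
      ∑ r ∈ Finset.range (k + 1), ofPencil fun μ =>
        (p * quantPoly d k r).eval μ • (mul ((dv v ^ r) f) * dv v ^ (k - r)) := by
    rw [← map_sum]
    congr 1
    funext μ
    simp [quantHom_tpow, Finset.smul_sum, eval_quantPoly, mul_smul]
  rw [this]
  refine Submodule.sum_mem _ fun r hr => ofPencil_eval_smul_mem (j := n - k + r) (m := k - r) ?_
    (Polynomial.natDegree_mul_le.trans (add_le_add hp (natDegree_quantPoly_le d k r)))
    (mul_mul_dv_pow_mem _ _ _)
  rw [Finset.mem_range] at hr
  omega

theorem isRegularLifting_triangularLifting {n : ℕ} {lam : ℝ} {P : ℕ → Polynomial ℝ}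
    (hdeg : ∀ i ≤ n, (P i).natDegree ≤ i) (hP : ∀ i ≤ n, (P i).eval lam ≠ 0) :
    IsRegularLifting lam (triangularLifting d n lam P) := by
  rintro ⟨T, hT⟩
  refine diffOps_induction lam
    (p := fun T => ∀ hT : T ∈ diffOps d n, triangularLifting d n lam P ⟨T, hT⟩ ∈ diffOpsHat d n ∧
      restrictTo lam (triangularLifting d n lam P ⟨T, hT⟩) = T) ?_ ?_ ?_ ?_ hT hT
  · intro k hk f v hT
    rw [triangularLifting_quantHom hk lam P (tpow_mem _ _ _), restrictTo_ofPencil,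
      inv_mul_cancel₀ (hP _ (Nat.sub_le _ _)), one_smul]
    refine ⟨?_, rfl⟩
    have h := ofPencil_quantHom_mem hk (p := Polynomial.C ((P (n - k)).eval lam)⁻¹ * P (n - k))
      ((Polynomial.natDegree_C_mul_le _ _).trans (hdeg _ (Nat.sub_le _ _))) f v
    simpa using h
  · intro hT
    have h0 : (⟨0, hT⟩ : diffOps d n) = 0 := rfl
    rw [h0, map_zero]
    exact ⟨Submodule.zero_mem _, by simp [restrictTo]⟩
  · intro T hT U hU h1 h2 hTU
    have h0 : (⟨T + U, hTU⟩ : diffOps d n) = ⟨T, hT⟩ + ⟨U, hU⟩ := rfl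
    rw [h0, map_add]
    refine ⟨Submodule.add_mem _ (h1 hT).1 (h2 hU).1, ?_⟩
    conv_rhs => rw [← (h1 hT).2, ← (h2 hU).2]
    ext1 f
    simp [restrictTo]
  · intro c T hT h1 hcT
    have h0 : (⟨c • T, hcT⟩ : diffOps d n) = c • ⟨T, hT⟩ := rfl
    rw [h0, map_smul]
    refine ⟨Submodule.smul_mem _ _ (h1 hT).1, ?_⟩
    conv_rhs => rw [← (h1 hT).2]
    ext1 f
    simp [restrictTo]

/-! ### Equivariance of the liftings -/

theorem adHat_add (K : VField d) (T U : OpHat d) : adHat K (T + U) = adHat K T + adHat K U := by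
  simp only [adHat, add_mul, mul_add]
  abel

theorem adHat_smul (c : ℝ) (K : VField d) (T : OpHat d) : adHat K (c • T) = c • adHat K T := by
  simp only [adHat, smul_mul_assoc, mul_smul_comm]
  exact (smul_sub c (lieDerivHat K * T) (T * lieDerivHat K)).symm

/-- The symbol U of ad_K Q(f v^k) is again homogeneous of degree k, so it is lifted with the same
scalar factor, and it serves all weights. -/
theorem isProjEquivariant_triangularLifting (n : ℕ) (lam : ℝ) (P : ℕ → Polynomial ℝ) :
    IsProjEquivariant lam (triangularLifting d n lam P) := by
  rintro K hK ⟨T, hT⟩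
  refine diffOps_induction lam
    (p := fun T => ∀ hT : T ∈ diffOps d n, ∃ h : ad lam K T ∈ diffOps d n,
      triangularLifting d n lam P ⟨ad lam K T, h⟩ =
        adHat K (triangularLifting d n lam P ⟨T, hT⟩)) ?_ ?_ ?_ ?_ hT hT
  · intro k hk f v hT
    obtain ⟨U, hU, hQ⟩ := exists_ad_quantHom hK k f v
    have h : ad lam K (quantHom lam k (tpow k f v)) ∈ diffOps d n := by
      rw [hQ]
      exact quantHom_mem_of_le hk _ _
    refine ⟨h, ?_⟩
    simp only [hQ]
    rw [triangularLifting_quantHom hk lam P hU,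
      triangularLifting_quantHom hk lam P (tpow_mem _ _ _), adHat_ofPencil]
    simp only [ad_smul, hQ]
  · intro hT
    have h0 : ad lam K (0 : Op d) = 0 := by simp [ad]
    have h1 : (⟨0, hT⟩ : diffOps d n) = 0 := rfl
    simp only [h0, h1, map_zero]
    exact ⟨hT, by simp only [adHat, mul_zero, zero_mul]; exact (sub_zero (0 : OpHat d)).symm⟩
  · intro T hT U hU h1 h2 hTU
    obtain ⟨h1, h1'⟩ := h1 hT
    obtain ⟨h2, h2'⟩ := h2 hU
    have h0 : (⟨T + U, hTU⟩ : diffOps d n) = ⟨T, hT⟩ + ⟨U, hU⟩ := rfl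
    have h3 : ad lam K (T + U) ∈ diffOps d n := by
      rw [ad_add]; exact Submodule.add_mem _ h1 h2
    have h4 : (⟨ad lam K (T + U), h3⟩ : diffOps d n) = ⟨ad lam K T, h1⟩ + ⟨ad lam K U, h2⟩ :=
      Subtype.ext (ad_add lam K T U)
    exact ⟨h3, by rw [h4, h0, map_add, map_add, h1', h2', adHat_add]⟩
  · intro c T hT h1 hcT
    obtain ⟨h1, h1'⟩ := h1 hT
    have h0 : (⟨c • T, hcT⟩ : diffOps d n) = c • ⟨T, hT⟩ := rfl
    have h3 : ad lam K (c • T) ∈ diffOps d n := by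
      rw [ad_smul]; exact Submodule.smul_mem _ _ h1
    have h4 : (⟨ad lam K (c • T), h3⟩ : diffOps d n) = c • ⟨ad lam K T, h1⟩ :=
      Subtype.ext (ad_smul lam c K T)
    exact ⟨h3, by rw [h4, h0, map_smul, map_smul, h1', adHat_smul]⟩

/-! ### Formal adjoints -/

theorem integrable_mul {f g : Smooth d} (hf : HasCompactSupport f.1) :
    MeasureTheory.Integrable fun x => f.1 x * g.1 x :=
  ((ContDiff.continuous (n := ∞) f.2).mul
    (ContDiff.continuous (n := ∞) g.2)).integrable_of_hasCompactSupport hf.mul_right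

/-- `D` preserves compact supports and `E` is its formal adjoint. -/
structure FormalAdjoint (D E : Op d) : Prop where
  supp : ∀ f : Smooth d, HasCompactSupport f.1 → HasCompactSupport (D f).1
  eq : ∀ f g : Smooth d, HasCompactSupport f.1 →
    ∫ x, (D f).1 x * g.1 x = ∫ x, f.1 x * (E g).1 x

namespace FormalAdjoint

theorem mul (a : Smooth d) : FormalAdjoint (mul a) (PencilLifting.mul a) where
  supp f hf := HasCompactSupport.mul_left (f := a.1) hf
  eq f g hf := by
    congr 1
    funext x
    change a.1 x * f.1 x * g.1 x = f.1 x * (a.1 x * g.1 x)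
    ring

/-- Integration by parts, without boundary terms because f has compact support. -/
theorem pd (i : Fin d) : FormalAdjoint (pd i) (-PencilLifting.pd i) where
  supp f hf := (hf.fderiv (𝕜 := ℝ)).comp_left
    (g := fun l : (Fin d → ℝ) →L[ℝ] ℝ => l (Pi.single i 1)) rfl
  eq f g hf := by
    have hf' : HasCompactSupport (PencilLifting.pd i f).1 := (hf.fderiv (𝕜 := ℝ)).comp_left
      (g := fun l : (Fin d → ℝ) →L[ℝ] ℝ => l (Pi.single i 1)) rfl
    have h := integral_mul_fderiv_eq_neg_fderiv_mul_of_integrable (μ := MeasureTheory.volume)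
      (v := Pi.single i 1) (integrable_mul (g := g) hf')
      (integrable_mul (g := PencilLifting.pd i g) hf) (integrable_mul (g := g) hf)
      (fun x _ => differentiable_smooth f x) (fun x _ => differentiable_smooth g x)
    have h2 : ∫ x, f.1 x * ((-PencilLifting.pd i) g).1 x =
        -∫ x, f.1 x * fderiv ℝ g.1 x (Pi.single i 1) := by
      rw [← MeasureTheory.integral_neg]
      congr 1
      funext x
      change f.1 x * -(fderiv ℝ g.1 x (Pi.single i 1)) = _
      ring
    rw [h2, h, neg_neg]
    rfl

/-- Only the first argument of the pairing must have compact support, so nothing is needed about the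
supports of E g. -/
theorem comp {D E D' E' : Op d} (h : FormalAdjoint D E) (h' : FormalAdjoint D' E') :
    FormalAdjoint (D * D') (E' * E) where
  supp f hf := h.supp _ (h'.supp f hf)
  eq f g hf := by
    rw [Module.End.mul_apply, h.eq _ _ (h'.supp f hf), h'.eq _ _ hf, Module.End.mul_apply]

theorem add {D E D' E' : Op d} (h : FormalAdjoint D E) (h' : FormalAdjoint D' E') :
    FormalAdjoint (D + D') (E + E') where
  supp f hf := HasCompactSupport.add (h.supp f hf) (h'.supp f hf)
  eq f g hf := by
    have h1 : ∀ x, ((D + D') f).1 x * g.1 x = (D f).1 x * g.1 x + (D' f).1 x * g.1 x :=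
      fun x => add_mul _ _ _
    have h2 : ∀ x, f.1 x * ((E + E') g).1 x = f.1 x * (E g).1 x + f.1 x * (E' g).1 x :=
      fun x => mul_add _ _ _
    simp only [h1, h2]
    rw [MeasureTheory.integral_add (integrable_mul (h.supp f hf))
      (integrable_mul (h'.supp f hf)), MeasureTheory.integral_add (integrable_mul hf)
      (integrable_mul hf), h.eq f g hf, h'.eq f g hf]

theorem smul {D E : Op d} (c : ℝ) (h : FormalAdjoint D E) : FormalAdjoint (c • D) (c • E) := by
  have hc : FormalAdjoint (c • 1 : Op d) (c • 1) := by
    have : (c • 1 : Op d) = PencilLifting.mul (c • 1) := by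
      rw [mul_smul']
      congr 1
      ext1 f
      simp [mul_apply]
    rw [this]
    exact mul _
  have h1 := hc.comp h
  rwa [smul_mul_assoc, one_mul, mul_smul_comm, mul_one] at h1

theorem zero : FormalAdjoint (0 : Op d) 0 := by
  have h := (mul (0 : Smooth d)).smul 0
  rwa [zero_smul] at h

theorem one : FormalAdjoint (1 : Op d) 1 where
  supp _ hf := hf
  eq _ _ _ := rfl

theorem sum {ι : Type*} (s : Finset ι) {D E : ι → Op d}
    (h : ∀ i ∈ s, FormalAdjoint (D i) (E i)) :
    FormalAdjoint (∑ i ∈ s, D i) (∑ i ∈ s, E i) := by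
  classical
  induction s using Finset.induction_on with
  | empty => exact zero
  | insert i s hi ih =>
    rw [Finset.sum_insert hi, Finset.sum_insert hi]
    exact (h i (Finset.mem_insert_self i s)).add
      (ih fun j hj => h j (Finset.mem_insert_of_mem hj))

theorem dv (v : Fin d → ℝ) : FormalAdjoint (dv v) (-PencilLifting.dv v) := by
  have h := sum Finset.univ fun i _ => (pd i).smul (v i)
  simp only [smul_neg, Finset.sum_neg_distrib] at h
  exact h

theorem pow {D E : Op d} (h : FormalAdjoint D E) (k : ℕ) : FormalAdjoint (D ^ k) (E ^ k) := by
  induction k with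
  | zero => exact one
  | succ k ih =>
    rw [pow_succ, pow_succ']
    exact ih.comp h

end FormalAdjoint

theorem exists_formalAdjoint_right {n : ℕ} {T : Op d} (hT : T ∈ diffOps d n) :
    ∃ E, FormalAdjoint E T := by
  induction hT using Submodule.span_induction with
  | mem T hT =>
    obtain ⟨a, l, -, rfl⟩ := hT
    suffices h : ∃ E, FormalAdjoint E (pdList l) from
      ⟨_, h.choose_spec.comp (FormalAdjoint.mul a)⟩
    induction l with
    | nil => exact ⟨1, FormalAdjoint.one⟩
    | cons i l ih =>
      obtain ⟨E, hE⟩ := ih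
      have h := hE.comp ((FormalAdjoint.pd i).smul (-1))
      rw [smul_neg, neg_smul, one_smul, neg_neg] at h
      rw [show pdList (i :: l) = pd i * pdList l by simp [pdList]]
      exact ⟨_, h⟩
  | zero => exact ⟨0, FormalAdjoint.zero⟩
  | add T U _ _ h h' =>
    obtain ⟨E, hE⟩ := h
    obtain ⟨E', hE'⟩ := h'
    exact ⟨_, hE.add hE'⟩
  | smul c T _ h =>
    obtain ⟨E, hE⟩ := h
    exact ⟨_, hE.smul c⟩

/-- The fundamental lemma of the calculus of variations gives vanishing almost everywhere, and
continuity does the rest. -/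
theorem eq_zero_of_integral_eq_zero (h : Smooth d)
    (H : ∀ f : Smooth d, HasCompactSupport f.1 → ∫ x, f.1 x * h.1 x = 0) : h = 0 := by
  have hc : Continuous h.1 := ContDiff.continuous (n := ∞) h.2
  have h0 : ∀ᵐ x, h.1 x = 0 := ae_eq_zero_of_integral_contDiff_smul_eq_zero
    hc.locallyIntegrable fun g hg hs => H ⟨g, hg⟩ hs
  have h1 : h.1 = fun _ => 0 :=
    MeasureTheory.Measure.eq_of_ae_eq h0 hc continuous_const
  ext x
  exact congrFun h1 x

/-! ### Adjoints of pencils -/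

theorem pairing_single (μ : ℝ) (f : Smooth d) (s : Densities d) :
    pairing (Finsupp.single μ f) s = ∫ x, f.1 x * (s (1 - μ)).1 x := by
  rw [pairing, Finsupp.sum_single_index]
  have : ∀ x, (0 : Smooth d).1 x * (s (1 - μ)).1 x = 0 := fun x => zero_mul _
  simp [this]

theorem compactlySupported_single {f : Smooth d} (hf : HasCompactSupport f.1) (μ : ℝ) :
    CompactlySupported (Finsupp.single μ f) := by
  intro ν
  rcases eq_or_ne μ ν with rfl | h
  · rwa [Finsupp.single_eq_same]
  · rw [Finsupp.single_eq_of_ne h.symm]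
    exact HasCompactSupport.zero

/-- The scalar product couples weight μ only with 1 - μ, so it suffices to test on densities of one
weight. -/
theorem adjointIs_ofPencil_iff (D E : ℝ → Op d) :
    AdjointIs (ofPencil D) (ofPencil E) ↔ ∀ (μ : ℝ) (f g : Smooth d), HasCompactSupport f.1 →
      HasCompactSupport g.1 → ∫ x, (D μ f).1 x * g.1 x = ∫ x, f.1 x * (E (1 - μ) g).1 x := by
  constructor
  · intro h μ f g hf hg
    have := h _ _ (compactlySupported_single hf μ) (compactlySupported_single hg (1 - μ))
    rw [ofPencil_single, ofPencil_single, pairing_single, pairing_single] at this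
    simpa using this
  · intro h s₁ s₂ h₁ h₂
    -- Applying the pencil may kill components, so both pairings are summed over the larger support.
    have hsub : (ofPencil D s₁).support ⊆ s₁.support := by
      intro μ hμ
      rw [Finsupp.mem_support_iff, ofPencil_apply] at hμ
      rw [Finsupp.mem_support_iff]
      rintro h0
      exact hμ (by rw [h0, map_zero])
    rw [pairing, pairing, Finsupp.sum_of_support_subset _ hsub]
    · refine Finset.sum_congr rfl fun μ _ => ?_
      rw [ofPencil_apply]
      have := h μ _ _ (h₁ μ) (h₂ (1 - μ))
      rwa [← ofPencil_apply E] at this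
    · intro μ _
      have : ∀ x, (0 : Smooth d).1 x * (s₂ (1 - μ)).1 x = 0 := fun x => zero_mul _
      simp [this]

theorem adjointIs_ofPencil {D E : ℝ → Op d} (h : ∀ μ, FormalAdjoint (D μ) (E (1 - μ))) :
    AdjointIs (ofPencil D) (ofPencil E) :=
  (adjointIs_ofPencil_iff D E).2 fun μ f g hf _ => (h μ).eq f g hf

/-! ### The adjoint of the quantisation map -/

theorem dv_pow_mul_mul (v : Fin d → ℝ) (u : Smooth d) (j : ℕ) :
    dv v ^ j * mul u = ∑ i ∈ Finset.range (j + 1),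
      (j.choose i : ℝ) • (mul ((dv v ^ i) u) * dv v ^ (j - i)) := by
  induction j with
  | zero => simp
  | succ j ih =>
    have hstep : ∀ i ∈ Finset.range (j + 1),
        dv v * ((j.choose i : ℝ) • (mul ((dv v ^ i) u) * dv v ^ (j - i))) =
        (j.choose i : ℝ) • (mul ((dv v ^ i) u) * dv v ^ (j + 1 - i)) +
        (j.choose i : ℝ) • (mul ((dv v ^ (i + 1)) u) * dv v ^ (j + 1 - (i + 1))) := by
      intro i hi
      have hi' : i ≤ j := by simpa [Nat.lt_succ_iff] using hi
      rw [mul_smul_comm, ← mul_assoc, dv_mul_mul, add_mul, smul_add, Nat.succ_sub hi',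
        pow_succ' _ (j - i), ← mul_assoc, Nat.add_sub_add_right, pow_succ' _ i,
        Module.End.mul_apply]
    rw [pow_succ', mul_assoc, ih, Finset.mul_sum, Finset.sum_congr rfl hstep,
      Finset.sum_add_distrib, Finset.sum_range_succ' _ (j + 1)]
    have h1 : ∑ i ∈ Finset.range (j + 1),
        (j.choose i : ℝ) • (mul ((dv v ^ i) u) * dv v ^ (j + 1 - i)) =
        ∑ i ∈ Finset.range (j + 1), (j.choose (i + 1) : ℝ) •
          (mul ((dv v ^ (i + 1)) u) * dv v ^ (j + 1 - (i + 1))) +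
        (mul u * dv v ^ (j + 1)) := by
      rw [Finset.sum_range_succ']
      simp only [Nat.choose_zero_right, Nat.cast_one, one_smul, pow_zero, Nat.sub_zero,
        Module.End.one_apply]
      rw [Finset.sum_range_succ _ j]
      simp
    rw [h1, add_right_comm, ← Finset.sum_add_distrib]
    simp only [Nat.choose_zero_right, Nat.cast_one, one_smul, pow_zero, Nat.sub_zero,
      Module.End.one_apply]
    congr 1
    refine Finset.sum_congr rfl fun i _ => ?_
    rw [← add_smul, Nat.choose_succ_succ]
    push_cast
    rw [add_comm]

/-- The Chu–Vandermonde identity. -/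
theorem sum_neg_one_pow_choose_mul_prod (s : ℕ) (a N : ℝ) (hN : ∀ i < s, N - (i : ℕ) ≠ 0) :
    ∑ r ∈ Finset.range (s + 1), (-1 : ℝ) ^ r * s.choose r *
      ∏ i ∈ Finset.range r, (a - i) / (N - i) = ∏ i ∈ Finset.range s, (N - a - i) / (N - i) := by
  induction s generalizing a N with
  | zero => simp
  | succ s ih =>
    have hN0 : N ≠ 0 := by simpa using hN 0 (Nat.succ_pos s)
    have h1 := ih a N fun i hi => hN i (by omega)
    have h2 := ih (a - 1) (N - 1) fun i hi => by
      have := hN (i + 1) (by omega)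
      push_cast at this
      rwa [sub_sub, add_comm 1]
    -- Pascal's rule: writing F_s(a, N) for the left-hand sum, F_{s+1}(a, N) = F_s(a, N) - (a/N)
    -- F_s(a - 1, N - 1). The difference N - a is unchanged, so the induction hypothesis gives the
    -- same numerators twice.
    have e1 : ∑ r ∈ Finset.range (s + 1 + 1), (-1 : ℝ) ^ r * (s + 1).choose r *
        ∏ i ∈ Finset.range r, (a - i) / (N - i) =
        ∑ r ∈ Finset.range (s + 1), (-1 : ℝ) ^ r * s.choose r *
          ∏ i ∈ Finset.range r, (a - i) / (N - i) - a / N *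
        ∑ r ∈ Finset.range (s + 1), (-1 : ℝ) ^ r * s.choose r *
          ∏ i ∈ Finset.range r, (a - 1 - i) / (N - 1 - i) := by
      have e2 : ∑ r ∈ Finset.range (s + 1), (-1 : ℝ) ^ r * s.choose r *
          ∏ i ∈ Finset.range r, (a - i) / (N - i) =
          ∑ r ∈ Finset.range (s + 1), (-1 : ℝ) ^ (r + 1) * s.choose (r + 1) *
          ∏ i ∈ Finset.range (r + 1), (a - i) / (N - i) + 1 := by
        rw [Finset.sum_range_succ', Finset.sum_range_succ _ s]
        simp
      rw [e2, Finset.sum_range_succ', Finset.mul_sum, add_sub_right_comm,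
        ← Finset.sum_sub_distrib]
      congr 1
      · refine Finset.sum_congr rfl fun r _ => ?_
        have e3 : ∏ i ∈ Finset.range (r + 1), (a - i) / (N - i) =
            (∏ i ∈ Finset.range r, (a - 1 - i) / (N - 1 - i)) * (a / N) := by
          rw [Finset.prod_range_succ']
          simp [sub_sub, add_comm]
        rw [Nat.choose_succ_succ, e3]
        push_cast
        ring
      · simp
    rw [e1, h1, h2]
    have hB : ∏ i ∈ Finset.range s, (N - i) ≠ 0 :=
      Finset.prod_ne_zero_iff.2 fun i hi => hN i (by have := Finset.mem_range.1 hi; omega)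
    have hB' : ∏ i ∈ Finset.range s, (N - 1 - i) ≠ 0 :=
      Finset.prod_ne_zero_iff.2 fun i hi => by
        have := hN (i + 1) (by have := Finset.mem_range.1 hi; omega)
        push_cast at this
        rwa [sub_sub, add_comm 1]
    have hs : N - s ≠ 0 := hN s (by omega)
    have hBB : (∏ i ∈ Finset.range s, (N - i)) * (N - s) =
        (∏ i ∈ Finset.range s, (N - 1 - i)) * N := by
      have := Finset.prod_range_succ (fun i : ℕ => N - i) s
      rw [← this, Finset.prod_range_succ']
      simp [sub_sub, add_comm]
    have e4 : ∀ i : ℕ, N - 1 - (a - 1) - (i : ℝ) = N - a - i := fun i => by ring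
    simp only [e4]
    rw [Finset.prod_range_succ, Finset.prod_div_distrib, Finset.prod_div_distrib]
    field_simp
    linear_combination (-a * ∏ i ∈ Finset.range s, (N - a - i)) * hBB

/-- The left side is the coefficient of (∂_v^s f) ∂_v^{k-s} in the adjoint of Q_μ(f v^k).
Chu–Vandermonde applies with a = (d+1)μ + k - 1 and N = d + 2k - 1, and N - a = (d+1)(1-μ) + k - 1
is a with μ replaced by 1 - μ. -/
theorem sum_quantCoeff (μ : ℝ) {k s : ℕ} (hs : s ≤ k) :
    ∑ r ∈ Finset.range (s + 1), quantCoeff d k r μ * ((-1) ^ (k - r) * (k - r).choose (s - r)) =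
      (-1) ^ k * quantCoeff d k s (1 - μ) := by
  have hN : ∀ i < s, (d : ℝ) + 2 * k - 1 - (i : ℕ) ≠ 0 := fun i hi => by
    have h1 : (i : ℝ) + 1 ≤ k := by exact_mod_cast (by omega : i + 1 ≤ k)
    have h2 : (0 : ℝ) ≤ d := by positivity
    have h3 : (0 : ℝ) ≤ i := by positivity
    linarith
  have h := sum_neg_one_pow_choose_mul_prod s ((d + 1) * μ + k - 1) (d + 2 * k - 1) hN
  have h1 : quantCoeff d k s (1 - μ) = k.choose s * ∏ i ∈ Finset.range s,
      ((d : ℝ) + 2 * k - 1 - ((d + 1) * μ + k - 1) - i) / (d + 2 * k - 1 - i) := by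
    rw [quantCoeff]
    congr 1
    refine Finset.prod_congr rfl fun i _ => ?_
    congr 1
    ring
  rw [h1, ← h, Finset.mul_sum, Finset.mul_sum]
  refine Finset.sum_congr rfl fun r hr => ?_
  have hrs : r ≤ s := by simpa [Nat.lt_succ_iff] using hr
  have h2 : (-1 : ℝ) ^ (k - r) = (-1) ^ k * (-1) ^ r := by
    obtain ⟨j, rfl⟩ := Nat.exists_eq_add_of_le (hrs.trans hs)
    rw [Nat.add_sub_cancel_left, pow_add, mul_right_comm, ← mul_pow]
    simp
  have h3 : ((k.choose s : ℕ) : ℝ) * (s.choose r : ℕ) =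
      (k.choose r : ℕ) * ((k - r).choose (s - r) : ℕ) := by
    exact_mod_cast Nat.choose_mul hrs
  rw [quantCoeff, h2]
  linear_combination (-((-1 : ℝ) ^ k * (-1) ^ r * ∏ i ∈ Finset.range r,
    (((d : ℝ) + 1) * μ + k - 1 - i) / (d + 2 * k - 1 - i))) * h3

/-- Each summand is transposed and expanded by Leibniz; collecting by the total number s of
derivatives on f leaves the sums of `sum_quantCoeff`. -/
theorem formalAdjoint_quantHom (μ : ℝ) (k : ℕ) (f : Smooth d) (v : Fin d → ℝ) :
    FormalAdjoint (quantHom μ k (tpow k f v))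
      ((-1 : ℝ) ^ k • quantHom (1 - μ) k (tpow k f v)) := by
  have h := FormalAdjoint.sum (Finset.range (k + 1)) fun r _ =>
    ((FormalAdjoint.mul ((dv v ^ r) f)).comp ((FormalAdjoint.dv v).pow (k - r))).smul
      (quantCoeff d k r μ)
  rw [← quantHom_tpow] at h
  convert h using 1
  have hterm : ∀ r ∈ Finset.range (k + 1),
      quantCoeff d k r μ • ((-dv v) ^ (k - r) * mul ((dv v ^ r) f)) =
        ∑ s ∈ Finset.Ico r (k + 1),
          (quantCoeff d k r μ * ((-1) ^ (k - r) * (k - r).choose (s - r))) •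
            (mul ((dv v ^ s) f) * dv v ^ (k - s)) := by
    intro r hr
    have hrk : r ≤ k := by simpa [Nat.lt_succ_iff] using hr
    have hneg : (-dv v) ^ (k - r) = (-1 : ℝ) ^ (k - r) • dv v ^ (k - r) := by
      rw [← neg_one_smul ℝ (dv v), smul_pow]
    rw [hneg, smul_mul_assoc, dv_pow_mul_mul, Finset.sum_Ico_eq_sum_range, Finset.smul_sum,
      Finset.smul_sum, Nat.succ_sub hrk]
    refine Finset.sum_congr rfl fun i _ => ?_
    rw [Nat.add_sub_cancel_left, ← Module.End.mul_apply, ← pow_add, add_comm i r, Nat.sub_sub,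
      smul_smul, smul_smul, mul_assoc]
  rw [Finset.sum_congr rfl hterm, quantHom_tpow, Finset.smul_sum,
    Finset.sum_comm' (t' := Finset.range (k + 1)) (s' := fun s => Finset.range (s + 1))
    (by intro r s; simp only [Finset.mem_range, Finset.mem_Ico]; omega)]
  refine Finset.sum_congr rfl fun s hs => ?_
  rw [← Finset.sum_smul, sum_quantCoeff μ (by simpa [Nat.lt_succ_iff] using hs), smul_smul]

/-! ### Self-adjoint liftings -/

/-- If all pairings vanished, D would kill every compactly supported f, so f would pair to zero with
E g for every smooth g, and E would be zero. -/
theorem exists_integral_ne_zero {D E : Op d} (h : FormalAdjoint D E) (hE : E ≠ 0) :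
    ∃ f g : Smooth d, HasCompactSupport f.1 ∧ HasCompactSupport g.1 ∧
      ∫ x, (D f).1 x * g.1 x ≠ 0 := by
  by_contra! H
  refine hE (LinearMap.ext fun g => eq_zero_of_integral_eq_zero _ fun f hf => ?_)
  have hDf : D f = 0 := eq_zero_of_integral_eq_zero _ fun g hg => by
    rw [← H f g hf hg]
    congr 1
    funext x
    exact mul_comm _ _
  rw [← h.eq f g hf, hDf]
  have : ∀ x, (0 : Smooth d).1 x * g.1 x = 0 := fun x => zero_mul _
  simp [this]

theorem integral_smul_left (a : ℝ) (f g : Smooth d) :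
    ∫ x, (a • f).1 x * g.1 x = a * ∫ x, f.1 x * g.1 x := by
  rw [← MeasureTheory.integral_const_mul]
  congr 1
  funext x
  exact mul_assoc a (f.1 x) (g.1 x)

theorem integral_smul_right (a : ℝ) (f g : Smooth d) :
    ∫ x, f.1 x * (a • g).1 x = a * ∫ x, f.1 x * g.1 x := by
  rw [← MeasureTheory.integral_const_mul]
  congr 1
  funext x
  exact mul_left_comm (f.1 x) a (g.1 x)

theorem adjointIs_smul_iff {D E : ℝ → Op d} (h : ∀ μ, FormalAdjoint (D μ) (E (1 - μ)))
    (hE : ∀ μ, E μ ≠ 0) (p q : ℝ → ℝ) :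
    AdjointIs (ofPencil fun μ => p μ • D μ) (ofPencil fun μ => q μ • E μ) ↔
      ∀ μ, p μ = q (1 - μ) := by
  constructor
  · intro H μ
    obtain ⟨f, g, hf, hg, hne⟩ := exists_integral_ne_zero (h μ) (hE (1 - μ))
    have h1 := (adjointIs_ofPencil_iff _ _).1 H μ f g hf hg
    rw [LinearMap.smul_apply, LinearMap.smul_apply, integral_smul_left, integral_smul_right,
      ← (h μ).eq f g hf] at h1
    exact mul_right_cancel₀ hne h1
  · intro H
    refine adjointIs_ofPencil fun μ => ?_
    rw [H μ]
    exact (h μ).smul _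

theorem adjointIs_polyWeight_iff (P : Polynomial ℝ) (i : ℕ) :
    AdjointIs (polyWeight d P) ((-1 : ℝ) ^ i • polyWeight d P) ↔
      ∀ μ, P.eval μ = (-1) ^ i * P.eval (1 - μ) := by
  have h1 : (1 : Op d) ≠ 0 := fun h => by
    have := congrArg (fun T : Op d => (T 1).1 0) h
    exact one_ne_zero (α := ℝ) this
  have h : (-1 : ℝ) ^ i • polyWeight d P =
      ofPencil fun μ => ((-1 : ℝ) ^ i * P.eval μ) • (1 : Op d) := by
    rw [polyWeight_eq, ← map_smul]
    congr 1
    funext μ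
    simp [mul_smul]
  rw [h, polyWeight_eq]
  exact adjointIs_smul_iff (D := fun _ => 1) (E := fun _ => 1) (fun _ => FormalAdjoint.one)
    (fun _ => h1) _ _

theorem dv_single_pow_ne_zero (i : Fin d) (k : ℕ) : dv (Pi.single i 1) ^ k ≠ (0 : Op d) := by
  intro h
  have h1 := principalSymbol_mul_dv_pow k k (1 : Smooth d) (Pi.single i 1)
  rw [h, mul_zero, map_zero, if_pos rfl] at h1
  have h2 := congrArg (fun f : Smooth d => f.1 0) (congrFun h1 fun _ => i)
  have h3 : tpow k (1 : Smooth d) (Pi.single i 1) (fun _ => i) = 1 := by simp [tpow]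
  simp only [h3] at h2
  exact one_ne_zero (α := ℝ) h2.symm

theorem quantHom_tpow_one (μ : ℝ) (k : ℕ) (v : Fin d → ℝ) :
    quantHom μ k (tpow k 1 v) = dv v ^ k := by
  rw [quantHom_tpow, Finset.sum_eq_single 0]
  · rw [quantCoeff_zero, one_smul, pow_zero, Nat.sub_zero]
    ext1 f
    simp [mul_apply]
  · intro r _ hr
    rw [dv_pow_one v hr]
    ext1 f
    simp [mul_apply]
  · simp

/-- The sign (-1)^n treats both parities of n together. Necessity is tested on the constant symbol
v^{n-i}, whose quantisation is ∂_v^{n-i} at every weight; sufficiency combines the parity of P_{n-k}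
with the sign (-1)^k of `formalAdjoint_quantHom`. -/
theorem adjointIs_triangularLifting_iff (hd : 0 < d) {n : ℕ} {lam : ℝ} {P : ℕ → Polynomial ℝ}
    (hP : ∀ i ≤ n, (P i).eval lam ≠ 0) :
    (∀ T, AdjointIs (triangularLifting d n lam P T)
        ((-1 : ℝ) ^ n • triangularLifting d n lam P T)) ↔
      ∀ i ≤ n, ∀ μ, (P i).eval μ = (-1) ^ i * (P i).eval (1 - μ) := by
  constructor
  · intro H i hi μ
    have hk : n - i ≤ n := Nat.sub_le _ _
    let v : Fin d → ℝ := Pi.single ⟨0, hd⟩ 1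
    have h := H ⟨quantHom lam (n - i) (tpow (n - i) 1 v), quantHom_mem_of_le hk _ _⟩
    rw [triangularLifting_quantHom hk lam P (tpow_mem _ _ _), Nat.sub_sub_self hi, ← map_smul] at h
    simp only [quantHom_tpow_one] at h
    -- The sign is split so that the operator part becomes (-∂_v)^{n-i}, the actual adjoint of
    -- ∂_v^{n-i}.
    have e : (-1 : ℝ) ^ n • (fun μ => (((P i).eval lam)⁻¹ * (P i).eval μ) • dv v ^ (n - i)) =
        fun μ => ((-1 : ℝ) ^ n * (-1) ^ (n - i) * (((P i).eval lam)⁻¹ * (P i).eval μ)) •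
          (-dv v) ^ (n - i) := by
      funext μ
      rw [Pi.smul_apply, ← neg_one_smul ℝ (dv v), smul_pow, smul_smul, smul_smul]
      congr 1
      have : (-1 : ℝ) ^ (n - i) * (-1) ^ (n - i) = 1 := by rw [← mul_pow]; simp
      linear_combination (-(-1 : ℝ) ^ n * (((P i).eval lam)⁻¹ * (P i).eval μ)) * this
    rw [e] at h
    have h1 := (adjointIs_smul_iff (D := fun _ => dv v ^ (n - i))
      (E := fun _ => (-dv v) ^ (n - i)) (fun _ => (FormalAdjoint.dv v).pow _)
      (fun _ => by
        rw [← neg_one_smul ℝ (dv v), smul_pow]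
        exact smul_ne_zero (by simp) (dv_single_pow_ne_zero _ _)) _ _).1 h μ
    have h2 : (-1 : ℝ) ^ n * (-1) ^ (n - i) = (-1) ^ i := by
      obtain ⟨j, rfl⟩ := Nat.exists_eq_add_of_le hi
      rw [Nat.add_sub_cancel_left, pow_add, mul_assoc, ← mul_pow]
      simp
    rw [h2, mul_left_comm] at h1
    exact mul_left_cancel₀ (inv_ne_zero (hP i hi)) h1
  · rintro H ⟨T, hT⟩
    -- The claim is strengthened to weightwise formal adjoints, which are stable under sums and
    -- scalar multiples.
    suffices h : ∀ hT : T ∈ diffOps d n, ∃ D : ℝ → Op d,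
        triangularLifting d n lam P ⟨T, hT⟩ = ofPencil D ∧
          ∀ μ, FormalAdjoint (D μ) ((-1 : ℝ) ^ n • D (1 - μ)) by
      obtain ⟨D, hD, hA⟩ := h hT
      rw [hD, ← map_smul]
      exact adjointIs_ofPencil hA
    refine diffOps_induction lam (p := fun T => ∀ hT : T ∈ diffOps d n, ∃ D : ℝ → Op d,
        triangularLifting d n lam P ⟨T, hT⟩ = ofPencil D ∧
          ∀ μ, FormalAdjoint (D μ) ((-1 : ℝ) ^ n • D (1 - μ))) ?_ ?_ ?_ ?_ hT
    · intro k hk f v hT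
      refine ⟨_, triangularLifting_quantHom hk lam P (tpow_mem _ _ _) hT, fun μ => ?_⟩
      have h := (formalAdjoint_quantHom μ k f v).smul
        (((P (n - k)).eval lam)⁻¹ * (P (n - k)).eval μ)
      convert h using 1
      rw [smul_smul, smul_smul, H (n - k) (Nat.sub_le _ _) μ]
      congr 1
      have h2 : (-1 : ℝ) ^ (n - k) * (-1) ^ k = (-1) ^ n := by
        rw [← pow_add, Nat.sub_add_cancel hk]
      rw [← h2]
      ring
    · intro hT
      refine ⟨0, ?_, fun μ => by simpa using FormalAdjoint.zero⟩
      have h0 : (⟨0, hT⟩ : diffOps d n) = 0 := rfl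
      rw [h0, map_zero, map_zero]
    · intro T hT U hU h1 h2 hTU
      obtain ⟨D, hD, hA⟩ := h1 hT
      obtain ⟨D', hD', hA'⟩ := h2 hU
      have h0 : (⟨T + U, hTU⟩ : diffOps d n) = ⟨T, hT⟩ + ⟨U, hU⟩ := rfl
      refine ⟨D + D', by rw [h0, map_add, map_add, hD, hD'], fun μ => ?_⟩
      rw [Pi.add_apply, Pi.add_apply, smul_add]
      exact (hA μ).add (hA' μ)
    · intro c T hT h1 hcT
      obtain ⟨D, hD, hA⟩ := h1 hT
      have h0 : (⟨c • T, hcT⟩ : diffOps d n) = c • ⟨T, hT⟩ := rfl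
      refine ⟨c • D, by rw [h0, map_smul, map_smul, hD], fun μ => ?_⟩
      rw [Pi.smul_apply, Pi.smul_apply, smul_comm]
      exact (hA μ).smul c

theorem isSelfAdjointLifting_iff {n : ℕ} (hn : Even n) (L : LiftMap d n) :
    IsSelfAdjointLifting L ↔ ∀ T, AdjointIs (L T) ((-1 : ℝ) ^ n • L T) := by
  simp only [hn.neg_one_pow, one_smul]
  rfl

theorem isAntiSelfAdjointLifting_iff {n : ℕ} (hn : Odd n) (L : LiftMap d n) :
    IsAntiSelfAdjointLifting L ↔ ∀ T, AdjointIs (L T) ((-1 : ℝ) ^ n • L T) := by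
  have h : ∀ T, (-1 : ℝ) ^ n • L T = -L T := fun T => by
    rw [hn.neg_one_pow]
    exact neg_one_smul ℝ (L T)
  simp only [h]
  rfl

/-! ### Polynomials with a parity about `1/2` -/

/-- After the shift Q(x) = P(x + 1/2) the reflection μ ↦ 1 - μ becomes x ↦ -x, and the coefficients
of the wrong parity vanish; e = 0 is the even case, e = 1 the odd one. -/
theorem eval_reflect_iff {P : Polynomial ℝ} {i e : ℕ} (he : e ≤ 1)
    (hP : P.natDegree ≤ 2 * i + e) :
    (∀ μ, P.eval μ = (-1) ^ e * P.eval (1 - μ)) ↔ ∃ c : ℕ → ℝ, P = ∑ k ∈ Finset.range (i + 1),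
      Polynomial.C (c k) * (Polynomial.X - Polynomial.C (1 / 2 : ℝ)) ^ (2 * k + e) := by
  constructor
  · intro H
    set Q : Polynomial ℝ := P.comp (Polynomial.X + Polynomial.C (1 / 2 : ℝ)) with hQ
    have hsym : Q.comp (Polynomial.C (-1) * Polynomial.X) = Polynomial.C ((-1 : ℝ) ^ e) * Q := by
      refine Polynomial.funext fun x => ?_
      simp only [hQ, Polynomial.eval_comp, Polynomial.eval_add, Polynomial.eval_X,
        Polynomial.eval_C, Polynomial.eval_mul]
      rw [H (-1 * x + 1 / 2)]
      congr 2
      ring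
    have hdegQ : Q.natDegree ≤ 2 * i + e := by
      rw [hQ, Polynomial.natDegree_comp, Polynomial.natDegree_X_add_C, mul_one]
      exact hP
    have hcoeff : ∀ j, (j + e) % 2 = 1 → Q.coeff j = 0 := by
      intro j hj
      have h1 := congrArg (fun R => Polynomial.coeff R j) hsym
      simp only [Polynomial.comp_C_mul_X_coeff, Polynomial.coeff_C_mul] at h1
      have h2 : (-1 : ℝ) ^ j = -(-1) ^ e := by
        have h3 : (-1 : ℝ) ^ (j + e) = -1 := (Nat.odd_iff.2 hj).neg_one_pow
        have h4 : (-1 : ℝ) ^ e * (-1) ^ e = 1 := by rw [← mul_pow]; simp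
        rw [pow_add] at h3
        linear_combination (-1 : ℝ) ^ e * h3 - (-1) ^ j * h4
      have h5 : (-1 : ℝ) ^ e ≠ 0 := by simp
      rw [h2] at h1
      have h6 : (-1 : ℝ) ^ e * Q.coeff j = 0 := by linarith
      exact (mul_eq_zero.1 h6).resolve_left h5
    have hQsum : Q = ∑ k ∈ Finset.range (i + 1),
        Polynomial.C (Q.coeff (2 * k + e)) * Polynomial.X ^ (2 * k + e) := by
      ext j
      simp only [Polynomial.finsetSum_coeff, Polynomial.coeff_C_mul, Polynomial.coeff_X_pow,
        mul_ite, mul_one, mul_zero]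
      by_cases hj : (j + e) % 2 = 1
      · rw [hcoeff j hj, Finset.sum_eq_zero]
        intro k _
        rw [if_neg (by omega)]
      · by_cases hji : j ≤ 2 * i + e
        · rcases lt_or_ge j e with hlt | hge
          · omega
          rw [Finset.sum_eq_single ((j - e) / 2)]
          · have : 2 * ((j - e) / 2) + e = j := by omega
            rw [this, if_pos rfl]
          · intro k _ hk
            rw [if_neg (by omega)]
          · intro h
            rw [Finset.mem_range] at h
            omega
        · rw [Polynomial.coeff_eq_zero_of_natDegree_lt (by omega), Finset.sum_eq_zero]
          intro k hk
          rw [Finset.mem_range] at hk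
          rw [if_neg (by omega)]
    refine ⟨fun k => Q.coeff (2 * k + e), ?_⟩
    have hPQ : P = Q.comp (Polynomial.X - Polynomial.C (1 / 2 : ℝ)) := by
      rw [hQ, Polynomial.comp_assoc]
      simp
    conv_lhs => rw [hPQ, hQsum]
    simp
  · rintro ⟨c, hc⟩ μ
    rw [hc]
    simp only [Polynomial.eval_finsetSum, Polynomial.eval_mul, Polynomial.eval_C,
      Polynomial.eval_pow, Polynomial.eval_sub, Polynomial.eval_X, Finset.mul_sum]
    refine Finset.sum_congr rfl fun k _ => ?_
    have h : (1 - μ - 1 / 2 : ℝ) = -1 * (μ - 1 / 2) := by ring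
    have h4 : (-1 : ℝ) ^ e * (-1) ^ e = 1 := by rw [← mul_pow]; simp
    rw [h, mul_pow, pow_add (-1 : ℝ), pow_mul (-1 : ℝ)]
    simp only [even_two, Even.neg_pow, one_pow, one_mul]
    linear_combination (-(c k * (μ - 1 / 2) ^ (2 * k + e))) * h4

theorem adjointIs_polyWeight_even_iff {P : Polynomial ℝ} {i : ℕ} (hP : P.natDegree ≤ 2 * i) :
    AdjointIs (polyWeight d P) ((-1 : ℝ) ^ (2 * i) • polyWeight d P) ↔
      ∃ c : ℕ → ℝ, P = ∑ k ∈ Finset.range (i + 1),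
        Polynomial.C (c k) * (Polynomial.X - Polynomial.C (1 / 2 : ℝ)) ^ (2 * k) := by
  rw [adjointIs_polyWeight_iff]
  simpa using eval_reflect_iff (e := 0) (by simp) hP

theorem adjointIs_polyWeight_odd_iff {P : Polynomial ℝ} {i : ℕ} (hP : P.natDegree ≤ 2 * i + 1) :
    AdjointIs (polyWeight d P) ((-1 : ℝ) ^ (2 * i + 1) • polyWeight d P) ↔
      ∃ c : ℕ → ℝ, P = ∑ k ∈ Finset.range (i + 1),
        Polynomial.C (c k) * (Polynomial.X - Polynomial.C (1 / 2 : ℝ)) ^ (2 * k + 1) := by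
  rw [adjointIs_polyWeight_iff, ← eval_reflect_iff (e := 1) le_rfl hP]
  simp [pow_succ]

/-! ### Liftings of second order operators -/

theorem liftMap_ext {n : ℕ} (lam : ℝ) {L L' : LiftMap d n}
    (h : ∀ k (hk : k ≤ n) f v, L ⟨quantHom lam k (tpow k f v), quantHom_mem_of_le hk _ _⟩ =
      L' ⟨quantHom lam k (tpow k f v), quantHom_mem_of_le hk _ _⟩) : L = L' := by
  refine LinearMap.ext fun ⟨T, hT⟩ => ?_
  refine diffOps_induction lam (p := fun T => ∀ hT : T ∈ diffOps d n, L ⟨T, hT⟩ = L' ⟨T, hT⟩)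
    (fun k hk f v hT => h k hk f v) ?_ ?_ ?_ hT hT
  · intro hT
    have h0 : (⟨0, hT⟩ : diffOps d n) = 0 := rfl
    rw [h0, map_zero, map_zero]
  · intro T hT U hU h1 h2 hTU
    have h0 : (⟨T + U, hTU⟩ : diffOps d n) = ⟨T, hT⟩ + ⟨U, hU⟩ := rfl
    rw [h0, map_add, map_add, h1, h2]
  · intro c T hT h1 hcT
    have h0 : (⟨c • T, hcT⟩ : diffOps d n) = c • ⟨T, hT⟩ := rfl
    rw [h0, map_smul, map_smul, h1]

theorem triangularLifting_congr {n : ℕ} {lam : ℝ} {P P' : ℕ → Polynomial ℝ}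
    (h : ∀ i ≤ n, ∀ μ, ((P i).eval lam)⁻¹ * (P i).eval μ =
      ((P' i).eval lam)⁻¹ * (P' i).eval μ) :
    triangularLifting d n lam P = triangularLifting d n lam P' := by
  refine liftMap_ext lam fun k hk f v => ?_
  rw [triangularLifting_quantHom hk lam P (tpow_mem _ _ _),
    triangularLifting_quantHom hk lam P' (tpow_mem _ _ _)]
  simp only [h (n - k) (Nat.sub_le _ _)]

/-- The polynomials `1`, `2w - 1`, `p + q w (w - 1)`. -/
def linePolys (p q : ℝ) : ℕ → Polynomial ℝ
  | 0 => 1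
  | 1 => 2 * Polynomial.X - 1
  | _ => linePoly p q

theorem linePolys_two (p q : ℝ) : linePolys p q 2 = linePoly p q := rfl

theorem eval_linePoly (p q μ : ℝ) : (linePoly p q).eval μ = p + q * (μ * (μ - 1)) := by
  simp [linePoly]

theorem tensor_zero_mem (S : Tensor d 0) : S ∈ symTensors d 0 := by
  convert tpow_mem 0 (S Fin.elim0) (0 : Fin d → ℝ)
  funext I
  simp [tpow, Subsingleton.elim I Fin.elim0]

theorem quantHom_zero (μ ν : ℝ) (S : Tensor d 0) : quantHom μ 0 S = quantHom ν 0 S := by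
  simp [quantHom, quantCoeff]

/-- Quantisation in degree zero does not involve the weight, so the DLO lifting of Δ_0 is Δ_0
itself. -/
theorem lineLifting_eq (lam p q : ℝ) :
    lineLifting d lam p q = triangularLifting d 2 lam (linePolys p q) := by
  refine LinearMap.ext fun T => ?_
  have h2 : dloLifting 2 lam (component 2 lam 2 (T : Op d)) =
      const (component 2 lam 2 (T : Op d)) := by
    simp only [component, LinearMap.comp_apply]
    rw [dloLifting_quantHom (by omega) lam (tensor_zero_mem _), const_apply]
    exact congrArg ofPencil (funext fun μ => quantHom_zero _ _ _)
  have h1 : polyWeight d (2 * Polynomial.X - 1) = 2 • weightOp d - 1 := by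
    rw [polyWeight, map_sub, map_mul, Polynomial.aeval_X, map_one, map_ofNat, nsmul_eq_mul]
    rfl
  have h0 : polyWeight d 1 = 1 := by simp [polyWeight]
  simp only [lineLifting, triangularLifting, LinearMap.comp_apply, LinearMap.add_apply,
    LinearMap.smul_apply, Submodule.subtype_apply, LinearMap.mulLeft_apply,
    Finset.sum_range_succ, Finset.sum_range_zero, linePolys, h2, h1, h0, zero_add, one_mul,
    Polynomial.eval_one, inv_one, one_smul, eval_linePoly]
  simp

theorem linePolys_natDegree_le (p q : ℝ) : ∀ i ≤ 2, (linePolys p q i).natDegree ≤ i := by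
  intro i hi
  interval_cases i
  · simp [linePolys]
  · simp only [linePolys]
    compute_degree
  · simp only [linePolys, linePoly]
    compute_degree

theorem linePolys_eval_ne_zero {lam p q : ℝ} (hl : lam ≠ 1 / 2)
    (h : p + q * (lam * (lam - 1)) ≠ 0) : ∀ i ≤ 2, (linePolys p q i).eval lam ≠ 0 := by
  intro i hi
  interval_cases i
  · simp [linePolys]
  · simp only [linePolys, Polynomial.eval_sub, Polynomial.eval_mul, Polynomial.eval_ofNat,
      Polynomial.eval_X, Polynomial.eval_one]
    intro h0
    exact hl (by linarith)
  · simpa only [linePolys, eval_linePoly] using h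

theorem isSelfAdjointLifting_lineLifting (hd : 0 < d) {lam p q : ℝ} (hl : lam ≠ 1 / 2)
    (h : p + q * (lam * (lam - 1)) ≠ 0) : IsSelfAdjointLifting (lineLifting d lam p q) := by
  rw [lineLifting_eq, isSelfAdjointLifting_iff (by decide),
    adjointIs_triangularLifting_iff hd (linePolys_eval_ne_zero hl h)]
  intro i hi μ
  interval_cases i
  · simp [linePolys]
  · simp [linePolys]
    ring
  · simp [linePolys, eval_linePoly]
    ring

theorem isSelfAdjointLifting_triangularLifting_two_iff (hd : 0 < d) {lam : ℝ}
    {P : ℕ → Polynomial ℝ} (hdeg : ∀ i ≤ 2, (P i).natDegree ≤ i)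
    (hP : ∀ i ≤ 2, (P i).eval lam ≠ 0) :
    IsSelfAdjointLifting (triangularLifting d 2 lam P) ↔
      lam ≠ 1 / 2 ∧ ∃ p q : ℝ, p + q * (lam * (lam - 1)) ≠ 0 ∧
        triangularLifting d 2 lam P = lineLifting d lam p q := by
  constructor
  · intro H
    rw [isSelfAdjointLifting_iff (by decide), adjointIs_triangularLifting_iff hd hP] at H
    obtain ⟨c, hc⟩ := (eval_reflect_iff (P := P 1) (i := 0) (e := 1) le_rfl
      (hdeg 1 (by omega))).1 (H 1 (by omega))
    obtain ⟨b, hb⟩ := (eval_reflect_iff (P := P 2) (i := 1) (e := 0) (by omega)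
      (hdeg 2 le_rfl)).1 (by simpa using H 2 le_rfl)
    have h0 : ∀ μ, (P 0).eval μ = (P 0).coeff 0 := fun μ => by
      conv_lhs => rw [Polynomial.eq_C_of_natDegree_le_zero (hdeg 0 (by omega))]
      simp
    have h1 : ∀ μ, (P 1).eval μ = c 0 / 2 * (2 * μ - 1) := fun μ => by
      rw [hc]
      simp
      ring
    have h2 : ∀ μ, (P 2).eval μ = (b 0 + b 1 / 4) + b 1 * (μ * (μ - 1)) := fun μ => by
      rw [hb]
      simp [Finset.sum_range_succ]
      ring
    have hP0 := hP 0 (by omega)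
    have hP1 := hP 1 (by omega)
    have hP2 := hP 2 le_rfl
    rw [h0] at hP0
    rw [h1] at hP1
    rw [h2] at hP2
    have hl : lam ≠ 1 / 2 := by
      rintro rfl
      norm_num at hP1
    -- From (w - 1/2)^2 = w(w - 1) + 1/4.
    refine ⟨hl, b 0 + b 1 / 4, b 1, hP2, ?_⟩
    rw [lineLifting_eq]
    refine triangularLifting_congr fun i hi μ => ?_
    interval_cases i
    · simp [linePolys, h0, hP0]
    · rw [h1, h1, mul_inv, mul_mul_mul_comm, inv_mul_cancel₀ (left_ne_zero_of_mul hP1)]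
      simp [linePolys]
    · simp only [h2, linePolys, eval_linePoly]
  · rintro ⟨hl, p, q, h, he⟩
    rw [he]
    exact isSelfAdjointLifting_lineLifting hd hl h

theorem lineLifting_eq_iff {lam p q p' q' : ℝ} (h : p + q * (lam * (lam - 1)) ≠ 0)
    (h' : p' + q' * (lam * (lam - 1)) ≠ 0) :
    lineLifting d lam p q = lineLifting d lam p' q' ↔ p * q' = p' * q := by
  rw [lineLifting_eq, lineLifting_eq]
  constructor
  · intro H
    have hk : (0 : ℕ) ≤ 2 := by omega
    have h1 := LinearMap.congr_fun H ⟨quantHom lam 0 (tpow 0 1 0), quantHom_mem_of_le hk _ _⟩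
    rw [triangularLifting_quantHom hk lam _ (tpow_mem 0 1 0),
      triangularLifting_quantHom hk lam _ (tpow_mem 0 1 0)] at h1
    have h3 : ∀ μ : ℝ, (p + q * (lam * (lam - 1)))⁻¹ * (p + q * (μ * (μ - 1))) =
        (p' + q' * (lam * (lam - 1)))⁻¹ * (p' + q' * (μ * (μ - 1))) := fun μ => by
      have h2 := congrArg (fun T : Op d => (T 1).1 0) (congrFun (ofPencil_injective h1) μ)
      have : ∀ c : ℝ, ((c • (1 : Op d)) (1 : Smooth d)).1 0 = c := fun c => mul_one c
      simpa only [quantHom_tpow_one, pow_zero, this, Nat.sub_zero, linePolys_two, eval_linePoly] using h2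
    -- The liftings are compared on Δ = 1; at weights 0 and 2 the polynomial w(w - 1) takes the
    -- distinct values 0 and 2.
    have e0 := h3 0
    have e2 := h3 2
    rw [inv_mul_eq_div, inv_mul_eq_div, div_eq_div_iff h h'] at e0 e2
    linear_combination (e0 - e2) / 2
  · intro H
    refine triangularLifting_congr fun i hi μ => ?_
    interval_cases i
    · simp only [linePolys]
    · simp only [linePolys]
    · simp only [linePolys_two, eval_linePoly]
      rw [inv_mul_eq_div, inv_mul_eq_div, div_eq_div_iff h h']
      linear_combination (lam * (lam - 1) - μ * (μ - 1)) * H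

/-! ### Coefficients of second order operators -/

theorem evalOne_mul_dv_pow (a : Smooth d) (v : Fin d → ℝ) (j : ℕ) :
    evalOne d (mul a * dv v ^ j) = if j = 0 then a else 0 := by
  change a * (dv v ^ j) 1 = _
  split_ifs with h
  · simp [h]
  · simp [dv_pow_one v h]

section Coeff

variable (f₀ f₁ f₂ : Smooth d) (v : Fin d → ℝ)

/-- The operator `f₀ ∂_v^2 + f₁ ∂_v + f₂`. -/
def dirOp (f₀ f₁ f₂ : Smooth d) (v : Fin d → ℝ) : Op d :=
  mul f₀ * dv v ^ 2 + mul f₁ * dv v ^ 1 + mul f₂ * dv v ^ 0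

theorem coeffS_dirOp (i k : Fin d) : coeffS (dirOp f₀ f₁ f₂ v) i k = (v i * v k) • f₀ := by
  simp only [coeffS, dirOp, map_add, commCoord_mul_dv_pow, map_smul, evalOne_mul_dv_pow]
  simp [smul_smul]
  congr 1
  ring

theorem coeffA_dirOp (i : Fin d) : coeffA (dirOp f₀ f₁ f₂ v) i = v i • f₁ := by
  simp only [coeffA, dirOp, map_add, commCoord_mul_dv_pow, map_smul, evalOne_mul_dv_pow]
  simp

theorem coeffF_dirOp : coeffF (dirOp f₀ f₁ f₂ v) = f₂ := by
  simp only [coeffF, dirOp, map_add, evalOne_mul_dv_pow]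
  simp

theorem sum_pd_smul (f : Smooth d) : ∑ k, pd k (v k • f) = dv v f := by
  simp [dv_apply]

theorem sum_pd_coeffS_dirOp (i : Fin d) :
    ∑ k, pd k (coeffS (dirOp f₀ f₁ f₂ v) i k) = v i • dv v f₀ := by
  simp only [coeffS_dirOp, mul_smul, map_smul, ← Finset.smul_sum, dv_apply]

theorem sum_sum_pd_coeffS_dirOp :
    ∑ i, ∑ k, pd i (pd k (coeffS (dirOp f₀ f₁ f₂ v) k i)) = dv v (dv v f₀) := by
  rw [Finset.sum_comm]
  simp only [coeffS_dirOp, mul_smul, map_smul, ← Finset.smul_sum, dv_apply, map_sum]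

theorem sum_pd_coeffA_dirOp : ∑ i, pd i (coeffA (dirOp f₀ f₁ f₂ v) i) = dv v f₁ := by
  simp only [coeffA_dirOp, sum_pd_smul]

theorem schwarzScalar_dirOp (lam : ℝ) : schwarzScalar lam (dirOp f₀ f₁ f₂ v) =
    f₂ - lam • dv v f₁ + (lam * coeffa d lam - coeffb d lam) • dv v (dv v f₀) := by
  rw [schwarzScalar, coeffF_dirOp, sum_pd_coeffA_dirOp, sum_sum_pd_coeffS_dirOp]

theorem canonicalB_dirOp (lam : ℝ) (i : Fin d) : canonicalB lam (dirOp f₀ f₁ f₂ v) i =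
    v i • (2 * lam - 1)⁻¹ • (f₁ - dv v f₀) := by
  have h : ∑ k, pd k (coeffS (dirOp f₀ f₁ f₂ v) k i) = v i • dv v f₀ := by
    rw [← sum_pd_coeffS_dirOp f₀ f₁ f₂ v i]
    simp only [coeffS_dirOp, mul_comm]
  rw [canonicalB, coeffA_dirOp, h, ← smul_sub, smul_comm]

theorem canonicalC_dirOp (lam : ℝ) : canonicalC lam (dirOp f₀ f₁ f₂ v) =
    (lam * (lam - 1))⁻¹ • f₂ -
      ((lam - 1) * (2 * lam - 1))⁻¹ • (dv v f₁ - dv v (dv v f₀)) := by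
  rw [canonicalC, coeffF_dirOp, sum_pd_coeffA_dirOp, sum_sum_pd_coeffS_dirOp]

end Coeff

theorem quantCoeff_one_one (μ : ℝ) : quantCoeff d 1 1 μ = μ := by
  have : (d : ℝ) + 1 ≠ 0 := by positivity
  simp only [quantCoeff, Nat.choose_self, Nat.cast_one, Finset.prod_range_one, Nat.cast_zero]
  rw [show (d : ℝ) + 2 * 1 - 1 - 0 = d + 1 by ring]
  field_simp
  ring

theorem quantCoeff_two_one (μ : ℝ) : quantCoeff d 2 1 μ = coeffa d μ := by
  have : (d : ℝ) + 3 ≠ 0 := by positivity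
  simp only [quantCoeff, coeffa, Nat.choose_one_right, Nat.cast_ofNat, Finset.prod_range_one,
    Nat.cast_zero]
  rw [show (d : ℝ) + 2 * 2 - 1 - 0 = d + 3 by ring]
  field_simp
  ring

theorem quantCoeff_two_two (μ : ℝ) : quantCoeff d 2 2 μ = coeffb d μ := by
  have h3 : (d : ℝ) + 3 ≠ 0 := by positivity
  have h2 : (d : ℝ) + 2 ≠ 0 := by positivity
  simp only [quantCoeff, coeffb, Nat.choose_self, Nat.cast_ofNat, Finset.prod_range_succ,
    Finset.prod_range_zero, Nat.cast_zero, Nat.cast_one]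
  rw [show (d : ℝ) + 2 * 2 - 1 - 0 = d + 3 by ring, show (d : ℝ) + 2 * 2 - 1 - 1 = d + 2 by ring]
  field_simp
  ring

theorem mul_zero' : mul (0 : Smooth d) = 0 := map_zero mulₗ

theorem quantHom_eq_dirOp_zero (μ : ℝ) (f : Smooth d) (v : Fin d → ℝ) :
    quantHom μ 0 (tpow 0 f v) = dirOp 0 0 f v := by
  rw [quantHom_tpow, dirOp, Finset.sum_range_one, quantCoeff_zero]
  simp [mul_zero']

theorem quantHom_eq_dirOp_one (μ : ℝ) (f : Smooth d) (v : Fin d → ℝ) :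
    quantHom μ 1 (tpow 1 f v) = dirOp 0 f (μ • dv v f) v := by
  rw [quantHom_tpow, dirOp, Finset.sum_range_succ, Finset.sum_range_one, quantCoeff_zero,
    quantCoeff_one_one]
  simp [mul_smul', mul_zero']

theorem quantHom_eq_dirOp_two (μ : ℝ) (f : Smooth d) (v : Fin d → ℝ) :
    quantHom μ 2 (tpow 2 f v) =
      dirOp f (coeffa d μ • dv v f) (coeffb d μ • dv v (dv v f)) v := by
  rw [quantHom_tpow, dirOp, Finset.sum_range_succ, Finset.sum_range_succ, Finset.sum_range_one,
    quantCoeff_zero, quantCoeff_two_one, quantCoeff_two_two]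
  simp [mul_smul', pow_two]

/-! ### The canonical lifting -/

/-- `S^{ik}` as a linear map. -/
def coeffSₗ (i k : Fin d) : Op d →ₗ[ℝ] Smooth d :=
  (1 / 2 : ℝ) • (evalOne d ∘ₗ commCoord i ∘ₗ commCoord k)

theorem coeffS_eq (T : Op d) (i k : Fin d) : coeffS T i k = coeffSₗ i k T := rfl

/-- `A^i` as a linear map. -/
def coeffAₗ (i : Fin d) : Op d →ₗ[ℝ] Smooth d := evalOne d ∘ₗ commCoord i

theorem coeffA_eq (T : Op d) (i : Fin d) : coeffA T i = coeffAₗ i T := rfl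

theorem coeffF_eq (T : Op d) : coeffF T = evalOne d T := rfl

/-- The scalar `S_Δ` as a linear map. -/
def schwarzScalarₗ (lam : ℝ) : Op d →ₗ[ℝ] Smooth d :=
  evalOne d - lam • ∑ i, pd i ∘ₗ coeffAₗ i +
    (lam * coeffa d lam - coeffb d lam) • ∑ i, ∑ k, pd i ∘ₗ pd k ∘ₗ coeffSₗ k i

theorem schwarzScalar_eq (lam : ℝ) (T : Op d) : schwarzScalar lam T = schwarzScalarₗ lam T := by
  simp [schwarzScalar, schwarzScalarₗ, coeffS_eq, coeffA_eq, coeffF_eq]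

/-- `B^i` as a linear map. -/
def canonicalBₗ (lam : ℝ) (i : Fin d) : Op d →ₗ[ℝ] Smooth d :=
  (2 * lam - 1)⁻¹ • (coeffAₗ i - ∑ k, pd k ∘ₗ coeffSₗ k i)

theorem canonicalB_eq (lam : ℝ) (T : Op d) (i : Fin d) :
    canonicalB lam T i = canonicalBₗ lam i T := by
  simp [canonicalB, canonicalBₗ, coeffS_eq, coeffA_eq]

/-- `C` as a linear map. -/
def canonicalCₗ (lam : ℝ) : Op d →ₗ[ℝ] Smooth d :=
  (lam * (lam - 1))⁻¹ • evalOne d - ((lam - 1) * (2 * lam - 1))⁻¹ •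
    (∑ i, pd i ∘ₗ coeffAₗ i - ∑ i, ∑ k, pd i ∘ₗ pd k ∘ₗ coeffSₗ k i)

theorem canonicalC_eq (lam : ℝ) (T : Op d) : canonicalC lam T = canonicalCₗ lam T := by
  simp [canonicalC, canonicalCₗ, coeffS_eq, coeffA_eq, coeffF_eq]

/-- The restrictions of the canonical lifting to densities of given weights. -/
def canonicalPencil (lam : ℝ) (T : Op d) (μ : ℝ) : Op d :=
  ∑ i, ∑ k, mul (coeffS T i k) * (pd i * pd k) +
  ∑ i, mul (∑ k, pd k (coeffS T i k)) * pd i +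
  (2 * μ - 1) • ∑ i, mul (canonicalB lam T i) * pd i +
  μ • mul (∑ i, pd i (canonicalB lam T i)) +
  (μ * (μ - 1)) • mul (canonicalC lam T)

theorem canonicalLift_eq_ofPencil (lam : ℝ) (T : Op d) :
    canonicalLift lam T = ofPencil (canonicalPencil lam T) := by
  have h1 : (2 • weightOp d - 1 : OpHat d) = polyWeight d (2 * Polynomial.X - 1) := by
    rw [polyWeight, map_sub, map_mul, Polynomial.aeval_X, map_one, map_ofNat, nsmul_eq_mul]
    rfl
  have h2 : weightOp d = polyWeight d Polynomial.X := by
    rw [polyWeight, Polynomial.aeval_X]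
  have h3 : weightOp d * (weightOp d - 1) =
      polyWeight d (Polynomial.X * (Polynomial.X - 1)) := by
    rw [polyWeight, map_mul, map_sub, Polynomial.aeval_X, map_one]
  rw [canonicalLift, h1, h3, h2]
  simp only [const_apply, polyWeight_mul_ofPencil, ← map_add]
  refine congrArg ofPencil (funext fun μ => ?_)
  simp [canonicalPencil]

theorem canonicalPencil_add (lam : ℝ) (T U : Op d) (μ : ℝ) :
    canonicalPencil lam (T + U) μ = canonicalPencil lam T μ + canonicalPencil lam U μ := by
  simp only [canonicalPencil, coeffS_eq, canonicalB_eq, canonicalC_eq, map_add, mul_add', add_mul,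
    Finset.sum_add_distrib, smul_add]
  abel

theorem canonicalPencil_smul (lam c : ℝ) (T : Op d) (μ : ℝ) :
    canonicalPencil lam (c • T) μ = c • canonicalPencil lam T μ := by
  simp only [canonicalPencil, coeffS_eq, canonicalB_eq, canonicalC_eq, map_smul, mul_smul',
    smul_mul_assoc, ← Finset.smul_sum, smul_add, smul_comm c]

theorem mul_sub' (a b : Smooth d) : mul (a - b) = mul a - mul b := map_sub mulₗ a b

theorem sum_mul_smul_mul_pd (f : Smooth d) (v : Fin d → ℝ) :
    ∑ i, mul (v i • f) * pd i = mul f * dv v := by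
  simp [dv_def, mul_smul', Finset.mul_sum]

theorem canonicalPencil_dirOp (lam μ : ℝ) (f₀ f₁ f₂ : Smooth d) (v : Fin d → ℝ) :
    canonicalPencil lam (dirOp f₀ f₁ f₂ v) μ =
      mul f₀ * dv v ^ 2 + mul (dv v f₀) * dv v +
      ((2 * μ - 1) * (2 * lam - 1)⁻¹) • (mul f₁ * dv v - mul (dv v f₀) * dv v) +
      (μ * (2 * lam - 1)⁻¹) • (mul (dv v f₁) - mul (dv v (dv v f₀))) +
      (μ * (μ - 1)) • ((lam * (lam - 1))⁻¹ • mul f₂ -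
        ((lam - 1) * (2 * lam - 1))⁻¹ • (mul (dv v f₁) - mul (dv v (dv v f₀)))) := by
  have h1 : ∑ i, ∑ k, mul (coeffS (dirOp f₀ f₁ f₂ v) i k) * (pd i * pd k) =
      mul f₀ * dv v ^ 2 := by
    simp only [coeffS_dirOp, mul_smul', smul_mul_assoc, pow_two, dv_def, Finset.sum_mul,
      Finset.mul_sum, mul_smul_comm, mul_smul, ← Finset.smul_sum]
    exact Finset.sum_congr rfl fun i _ => congrArg _
      (Finset.sum_congr rfl fun j _ => by rw [(pd_commute i j).eq])
  rw [canonicalPencil, h1]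
  simp only [sum_pd_coeffS_dirOp, canonicalB_dirOp, canonicalC_dirOp, sum_mul_smul_mul_pd,
    sum_pd_smul]
  simp only [map_smul, map_sub, mul_smul', mul_sub', smul_mul_assoc,
    sub_mul (mul f₁) (mul (dv v f₀))]
  module

/-- The correction only concerns the degree-zero component: on quantised symbols of degree 1 and 2
the scalar vanishes and the canonical pencil is already the lifting. Each degree becomes a
comparison of coefficients. -/
theorem lineLifting_apply {lam : ℝ} (h0 : lam ≠ 0) (h12 : lam ≠ 1 / 2) (h1 : lam ≠ 1)
    (p q : ℝ) {T : Op d} (hT : T ∈ diffOps d 2) :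
    lineLifting d lam p q ⟨T, hT⟩ = ofPencil fun μ => canonicalPencil lam T μ +
      ((p + q * (lam * (lam - 1)))⁻¹ * (p + q * (μ * (μ - 1))) -
        (lam * (lam - 1))⁻¹ * (μ * (μ - 1))) • mul (schwarzScalar lam T) := by
  rw [lineLifting_eq]
  have h1' : lam - 1 ≠ 0 := sub_ne_zero.2 h1
  have h12' : 2 * lam - 1 ≠ 0 := fun h => h12 (by linarith)
  refine diffOps_induction lam (p := fun T => ∀ hT : T ∈ diffOps d 2,
    triangularLifting d 2 lam (linePolys p q) ⟨T, hT⟩ = ofPencil fun μ => canonicalPencil lam T μ +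
      ((p + q * (lam * (lam - 1)))⁻¹ * (p + q * (μ * (μ - 1))) -
        (lam * (lam - 1))⁻¹ * (μ * (μ - 1))) • mul (schwarzScalar lam T)) ?_ ?_ ?_ ?_ hT hT
  · intro k hk f v hT
    rw [triangularLifting_quantHom hk lam _ (tpow_mem _ _ _)]
    refine congrArg ofPencil (funext fun μ => ?_)
    interval_cases k
    · rw [quantHom_eq_dirOp_zero, quantHom_eq_dirOp_zero, canonicalPencil_dirOp,
        schwarzScalar_dirOp, Nat.sub_zero, linePolys_two, eval_linePoly, eval_linePoly]
      simp only [dirOp, map_zero, mul_zero', zero_mul, pow_zero, mul_one, smul_zero, sub_zero,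
        add_zero, zero_add]
      module
    · rw [quantHom_eq_dirOp_one, quantHom_eq_dirOp_one, canonicalPencil_dirOp,
        schwarzScalar_dirOp]
      have e : ∀ x, (linePolys p q (2 - 1)).eval x = 2 * x - 1 := fun x => by simp [linePolys]
      rw [e, e]
      simp only [dirOp, map_zero, mul_zero', zero_mul, pow_zero, mul_one, smul_zero, sub_zero,
        add_zero, zero_add, sub_self, mul_smul', pow_one]
      match_scalars <;> field_simp
      ring
    · rw [quantHom_eq_dirOp_two, quantHom_eq_dirOp_two, canonicalPencil_dirOp,
        schwarzScalar_dirOp]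
      have e : ∀ x, (linePolys p q (2 - 2)).eval x = 1 := fun x => by simp [linePolys]
      have hd2 : (d : ℝ) + 2 ≠ 0 := by positivity
      have hd3 : (d : ℝ) + 3 ≠ 0 := by positivity
      have hS : (coeffb d lam • dv v (dv v f) - lam • dv v (coeffa d lam • dv v f) +
          (lam * coeffa d lam - coeffb d lam) • dv v (dv v f)) = 0 := by
        rw [map_smul]
        module
      rw [e, e, hS]
      simp only [dirOp, mul_zero', pow_zero, mul_one, smul_zero, add_zero, mul_smul', map_smul,
        pow_one, smul_mul_assoc, coeffa, coeffb]
      match_scalars <;> field_simp <;> ring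
  · intro hT
    have h0 : (⟨0, hT⟩ : diffOps d 2) = 0 := rfl
    have h1 : canonicalPencil lam (0 : Op d) = 0 := funext fun μ => by
      simpa using canonicalPencil_smul lam 0 (0 : Op d) μ
    rw [h0, map_zero, h1, schwarzScalar_eq, map_zero, mul_zero']
    simp only [smul_zero, Pi.zero_apply, add_zero]
    exact (map_zero ofPencil).symm
  · intro T hT U hU h1 h2 hTU
    have h0 : (⟨T + U, hTU⟩ : diffOps d 2) = ⟨T, hT⟩ + ⟨U, hU⟩ := rfl
    rw [h0, map_add, h1, h2, ← map_add]
    refine congrArg ofPencil (funext fun μ => ?_)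
    simp only [Pi.add_apply, canonicalPencil_add, schwarzScalar_eq, map_add, mul_add']
    module
  · intro c T hT h1 hcT
    have h0 : (⟨c • T, hcT⟩ : diffOps d 2) = c • ⟨T, hT⟩ := rfl
    rw [h0, map_smul, h1, ← map_smul]
    refine congrArg ofPencil (funext fun μ => ?_)
    simp only [Pi.smul_apply, canonicalPencil_smul, schwarzScalar_eq, map_smul, mul_smul']
    module

theorem lineLifting_eq_canonicalLift_add {lam : ℝ} (h0 : lam ≠ 0) (h12 : lam ≠ 1 / 2)
    (h1 : lam ≠ 1) (p q : ℝ) (T : diffOps d 2) :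
    lineLifting d lam p q T = canonicalLift lam (T : Op d) +
      ((p + q * (lam * (lam - 1)))⁻¹ • polyWeight d (linePoly p q) -
        (lam * (lam - 1))⁻¹ • polyWeight d (linePoly 0 1)) *
      const (mul (schwarzScalar lam (T : Op d))) := by
  have h2 : (p + q * (lam * (lam - 1)))⁻¹ • polyWeight d (linePoly p q) -
      (lam * (lam - 1))⁻¹ • polyWeight d (linePoly 0 1) =
      polyWeight d (Polynomial.C (p + q * (lam * (lam - 1)))⁻¹ * linePoly p q -
        Polynomial.C (lam * (lam - 1))⁻¹ * linePoly 0 1) := by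
    simp only [polyWeight, map_sub, map_mul, Polynomial.aeval_C, Algebra.smul_def]
  rw [h2, const_apply, polyWeight_mul_ofPencil, canonicalLift_eq_ofPencil,
    lineLifting_apply h0 h12 h1 p q T.2, ← map_add]
  refine congrArg ofPencil (funext fun μ => ?_)
  simp [eval_linePoly]

theorem lineLifting_zero_one {lam : ℝ} (h0 : lam ≠ 0) (h12 : lam ≠ 1 / 2) (h1 : lam ≠ 1)
    (T : diffOps d 2) : lineLifting d lam 0 1 T = canonicalLift lam (T : Op d) := by
  rw [canonicalLift_eq_ofPencil, lineLifting_apply h0 h12 h1 0 1 T.2]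
  refine congrArg ofPencil (funext fun μ => ?_)
  simp

theorem isRegularLifting_lineLifting {lam p q : ℝ} (hl : lam ≠ 1 / 2)
    (h : p + q * (lam * (lam - 1)) ≠ 0) : IsRegularLifting lam (lineLifting d lam p q) := by
  rw [lineLifting_eq]
  exact isRegularLifting_triangularLifting (linePolys_natDegree_le p q)
    (linePolys_eval_ne_zero hl h)

/-- Regularity and self-adjointness come from the lifting Π^{[0:1]}. At weight 0 each term acting on
1 either differentiates it or carries a factor μ = 0. -/
theorem isCanonicalLift_canonicalLift (hd : 0 < d) {lam : ℝ} (h0 : lam ≠ 0) (h12 : lam ≠ 1 / 2)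
    (h1 : lam ≠ 1) (T : diffOps d 2) :
    IsCanonicalLift lam (T : Op d) (canonicalLift lam (T : Op d)) := by
  have hpq : (0 : ℝ) + 1 * (lam * (lam - 1)) ≠ 0 := by
    simp [h0, sub_ne_zero.2 h1]
  have hr := isRegularLifting_lineLifting (d := d) h12 hpq T
  have hs := isSelfAdjointLifting_lineLifting hd h12 hpq T
  rw [lineLifting_zero_one h0 h12 h1] at hr hs
  refine ⟨hr.1, hs, ?_, hr.2⟩
  rw [canonicalLift_eq_ofPencil, ofPencil_single]
  simp [canonicalPencil, mul_apply, pd_one]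

/-! ### Uniqueness of the canonical lifting -/

theorem eq_zero_of_compactlySupported {n : ℕ} {R : Op d} (hR : R ∈ diffOps d n)
    (h : ∀ g : Smooth d, HasCompactSupport g.1 → R g = 0) : R = 0 := by
  obtain ⟨E, hE⟩ := exists_formalAdjoint_right hR
  by_contra hne
  obtain ⟨f, g, hf, hg, hi⟩ := exists_integral_ne_zero hE hne
  apply hi
  rw [hE.eq f g hf, h g hg]
  have : ∀ x, f.1 x * (0 : Smooth d).1 x = 0 := fun x => mul_zero _
  simp [this]

/-- The second power of the weight exhausts the order, so Z contains no derivatives; this is the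
only sharp bound needed. -/
theorem exists_quadratic_pencil {D : OpHat d} (hD : D ∈ diffOpsHat d 2) :
    ∃ X ∈ diffOps d 2, ∃ Y ∈ diffOps d 2, ∃ Z ∈ diffOps d 0,
      D = ofPencil fun μ => X + μ • Y + μ ^ 2 • Z := by
  rw [diffOpsHat_eq] at hD
  induction hD using Submodule.span_induction with
  | mem D hD =>
    obtain ⟨a, j, l, hjl, rfl⟩ := hD
    have hm : ∀ m, l.length ≤ m → mul a * pdList l ∈ diffOps d m := fun m hm =>
      Submodule.subset_span ⟨a, l, hm, rfl⟩
    have hj : j ≤ 2 := by omega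
    interval_cases j
    · exact ⟨_, hm 2 (by omega), 0, Submodule.zero_mem _, 0, Submodule.zero_mem _, by simp⟩
    · exact ⟨0, Submodule.zero_mem _, _, hm 2 (by omega), 0, Submodule.zero_mem _, by simp⟩
    · exact ⟨0, Submodule.zero_mem _, 0, Submodule.zero_mem _, _, hm 0 (by omega), by simp⟩
  | zero =>
    refine ⟨0, Submodule.zero_mem _, 0, Submodule.zero_mem _, 0, Submodule.zero_mem _, ?_⟩
    simp only [smul_zero, add_zero]
    exact (map_zero ofPencil).symm
  | add D D' _ _ h h' =>
    obtain ⟨X, hX, Y, hY, Z, hZ, rfl⟩ := h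
    obtain ⟨X', hX', Y', hY', Z', hZ', rfl⟩ := h'
    refine ⟨X + X', Submodule.add_mem _ hX hX', Y + Y', Submodule.add_mem _ hY hY',
      Z + Z', Submodule.add_mem _ hZ hZ', ?_⟩
    rw [← map_add]
    refine congrArg ofPencil (funext fun μ => ?_)
    rw [Pi.add_apply]
    module
  | smul c D _ h =>
    obtain ⟨X, hX, Y, hY, Z, hZ, rfl⟩ := h
    refine ⟨c • X, Submodule.smul_mem _ _ hX, c • Y, Submodule.smul_mem _ _ hY,
      c • Z, Submodule.smul_mem _ _ hZ, ?_⟩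
    rw [← map_smul]
    refine congrArg ofPencil (funext fun μ => ?_)
    rw [Pi.smul_apply]
    module

theorem eq_zero_of_mem_diffOps_zero {Z : Op d} (hZ : Z ∈ diffOps d 0) (h : Z 1 = 0) : Z = 0 := by
  have key : Z = mul (Z 1) := by
    clear h
    induction hZ using Submodule.span_induction with
    | mem Z hZ =>
      obtain ⟨a, l, hl, rfl⟩ := hZ
      obtain rfl : l = [] := List.eq_nil_of_length_eq_zero (by omega)
      simp [pdList, mul_apply]
    | zero => simp [mul_zero']
    | add Z W _ _ h h' => rw [LinearMap.add_apply, mul_add', ← h, ← h']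
    | smul c Z _ h => rw [LinearMap.smul_apply, mul_smul', ← h]
  rw [key, h, mul_zero']

theorem IsCanonicalLift.unique {lam : ℝ} (h0 : lam ≠ 0) (h12 : lam ≠ 1 / 2) (h1 : lam ≠ 1)
    {T : Op d} {D D' : OpHat d} (hD : IsCanonicalLift lam T D) (hD' : IsCanonicalLift lam T D') :
    D = D' := by
  obtain ⟨hm, hs, hone, hr⟩ := hD
  obtain ⟨hm', hs', hone', hr'⟩ := hD'
  obtain ⟨X, hX, Y, hY, Z, hZ, rfl⟩ := exists_quadratic_pencil hm
  obtain ⟨X', hX', Y', hY', Z', hZ', rfl⟩ := exists_quadratic_pencil hm'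
  rw [restrictTo_ofPencil] at hr hr'
  rw [adjointIs_ofPencil_iff] at hs hs'
  rw [ofPencil_single, Finsupp.single_eq_zero] at hone hone'
  have hlam : (X - X') + lam • (Y - Y') + lam ^ 2 • (Z - Z') = 0 := by
    rw [← sub_eq_zero.2 (hr.trans hr'.symm)]
    module
  -- Self-adjointness carries agreement at weight lam over to weight 1 - lam.
  have hlam' : (X - X') + (1 - lam) • (Y - Y') + (1 - lam) ^ 2 • (Z - Z') = 0 := by
    refine eq_zero_of_compactlySupported (n := 2) (Submodule.add_mem _ (Submodule.add_mem _
      (Submodule.sub_mem _ hX hX') (Submodule.smul_mem _ _ (Submodule.sub_mem _ hY hY')))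
      (Submodule.smul_mem _ _ (diffOps_mono (by omega) (Submodule.sub_mem _ hZ hZ')))) ?_
    intro g hg
    have e : ((X - X') + (1 - lam) • (Y - Y') + (1 - lam) ^ 2 • (Z - Z')) g =
        (X + (1 - lam) • Y + (1 - lam) ^ 2 • Z) g -
          (X' + (1 - lam) • Y' + (1 - lam) ^ 2 • Z') g := by
      rw [← LinearMap.sub_apply]
      congr 1
      module
    rw [e]
    refine eq_zero_of_integral_eq_zero _ fun f hf => ?_
    have e1 := hs lam f g hf hg
    have e2 := hs' lam f g hf hg
    rw [hr] at e1
    rw [hr', e1] at e2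
    have e3 := sub_eq_zero.2 e2
    rw [← MeasureTheory.integral_sub (integrable_mul hf) (integrable_mul hf)] at e3
    rw [← e3]
    congr 1
    funext x
    exact mul_sub (f.1 x) _ _
  -- With two distinct zeros lam and 1 - lam, the difference of the pencils is (μ - lam)(μ - 1 +
  -- lam)(Z - Z').
  have hYZ : (1 - 2 * lam) • ((Y - Y') + (Z - Z')) = 0 := by
    have := sub_eq_zero.2 (hlam'.trans hlam.symm)
    rw [← this]
    module
  have hY0 : Y - Y' = -(Z - Z') := by
    rw [smul_eq_zero] at hYZ
    exact eq_neg_of_add_eq_zero_left (hYZ.resolve_left fun h => h12 (by linarith))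
  have hX0 : X - X' = (lam * (1 - lam)) • (Z - Z') := by
    rw [hY0] at hlam
    rw [← sub_eq_zero, ← hlam]
    module
  have hZ0 : Z - Z' = 0 := by
    refine eq_zero_of_mem_diffOps_zero (Submodule.sub_mem _ hZ hZ') ?_
    have e : (X - X') 1 = 0 := by
      have e1 : X 1 = 0 := by simpa using hone
      have e2 : X' 1 = 0 := by simpa using hone'
      rw [LinearMap.sub_apply, e1, e2, sub_zero]
    rw [hX0, LinearMap.smul_apply, smul_eq_zero] at e
    exact e.resolve_left (mul_ne_zero h0 (sub_ne_zero.2 h1.symm))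
  rw [hZ0, neg_zero] at hY0
  rw [hZ0, smul_zero] at hX0
  rw [sub_eq_zero.1 hX0, sub_eq_zero.1 hY0, sub_eq_zero.1 hZ0]

/-! ### The Schwarzian-type scalar -/

theorem mul_mul_dv_pow_eq_dirOp_two (f : Smooth d) (v : Fin d → ℝ) :
    mul f * dv v ^ 2 = dirOp f 0 0 v := by
  simp [dirOp, mul_zero']

theorem mul_mul_dv_eq_dirOp (f : Smooth d) (v : Fin d → ℝ) : mul f * dv v = dirOp 0 f 0 v := by
  simp [dirOp, mul_zero']

theorem mul_eq_dirOp (f : Smooth d) : mul f = dirOp 0 0 f 0 := by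
  simp [dirOp, mul_zero']

theorem schwarzScalar_mul (lam : ℝ) (f : Smooth d) : schwarzScalar lam (mul f) = f := by
  rw [mul_eq_dirOp, schwarzScalar_dirOp]
  simp

theorem schwarzScalar_mul_mul_dv (lam : ℝ) (f : Smooth d) (v : Fin d → ℝ) :
    schwarzScalar lam (mul f * dv v) = -(lam • dv v f) := by
  rw [mul_mul_dv_eq_dirOp, schwarzScalar_dirOp]
  simp

/-- Polarisation of the formula for squares: twice ∂_v ∂_w is ∂_{v+w}^2 - ∂_v^2 - ∂_w^2. -/
theorem schwarzScalar_mul_mul_dv_mul_dv (lam : ℝ) (f : Smooth d) (v w : Fin d → ℝ) :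
    schwarzScalar lam (mul f * (dv w * dv v)) =
      (lam * coeffa d lam - coeffb d lam) • dv w (dv v f) := by
  have h : ∀ u : Fin d → ℝ, schwarzScalarₗ lam (mul f * dv u ^ 2) =
      (lam * coeffa d lam - coeffb d lam) • dv u (dv u f) := fun u => by
    rw [← schwarzScalar_eq, mul_mul_dv_pow_eq_dirOp_two, schwarzScalar_dirOp]
    simp
  have e : mul f * (dv w * dv v) = (1 / 2 : ℝ) •
      (mul f * dv (v + (1 : ℝ) • w) ^ 2 - mul f * dv v ^ 2 - mul f * dv w ^ 2) := by
    rw [dv_add_smul, one_smul, (dv_commute v w).add_sq, ← mul_sub, ← mul_sub, mul_assoc 2,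
      (dv_commute v w).eq, two_mul (dv w * dv v), ← mul_smul_comm]
    congr 1
    module
  have c : dv v (dv w f) = dv w (dv v f) := congrArg (fun T : Op d => T f) (dv_commute v w).eq
  rw [e, schwarzScalar_eq, map_smul, map_sub, map_sub, h, h, h, dv_add_smul]
  simp only [one_smul, LinearMap.add_apply, map_add, c]
  module

theorem mul_mul_dirDeriv (f : Smooth d) (K : VField d) :
    mul f * dirDeriv K = ∑ i, mul (f * K i) * dv (Pi.single i 1) := by
  ext1 h
  simp [dirDeriv_apply, mul_apply, dv_single, mul_assoc]

theorem sum_pd_mul (f : Smooth d) (K : VField d) :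
    ∑ i, pd i (f * K i) = dirDeriv K f + f * divergence K := by
  simp only [pd_mul, Finset.sum_add_distrib, dirDeriv_apply, divergence, Finset.mul_sum]
  congr 1
  exact Finset.sum_congr rfl fun i _ => mul_comm _ _

theorem schwarzScalar_mul_mul_dirDeriv (lam : ℝ) (f : Smooth d) (K : VField d) :
    schwarzScalar lam (mul f * dirDeriv K) = -(lam • (dirDeriv K f + f * divergence K)) := by
  rw [mul_mul_dirDeriv, schwarzScalar_eq, map_sum]
  simp only [← schwarzScalar_eq, schwarzScalar_mul_mul_dv]
  rw [← sum_pd_mul, Finset.sum_neg_distrib, Finset.smul_sum]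
  simp only [dv_single]

theorem schwarzScalar_mul_mul_dirDeriv_mul_dv (lam : ℝ) (f : Smooth d) (K : VField d)
    (v : Fin d → ℝ) : schwarzScalar lam (mul f * (dirDeriv K * dv v)) =
      (lam * coeffa d lam - coeffb d lam) • dv v (dirDeriv K f + f * divergence K) := by
  rw [← mul_assoc, mul_mul_dirDeriv, Finset.sum_mul, schwarzScalar_eq, map_sum]
  simp only [mul_assoc (mul _), ← schwarzScalar_eq, schwarzScalar_mul_mul_dv_mul_dv]
  rw [← sum_pd_mul, map_sum, Finset.smul_sum]
  refine Finset.sum_congr rfl fun i _ => congrArg _ ?_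
  rw [dv_single]
  exact congrArg (fun T : Op d => T (f * K i)) (dv_commute_pd v i).eq.symm

/-! ### Commutators with arbitrary vector fields and the cocycle -/

/-- The componentwise derivative of a vector field in a constant direction. -/
def dvField (v : Fin d → ℝ) (K : VField d) : VField d := fun i => dv v (K i)

theorem dv_dirDeriv (v : Fin d → ℝ) (K : VField d) (h : Smooth d) :
    dv v (dirDeriv K h) = dirDeriv (dvField v K) h + dirDeriv K (dv v h) := by
  simp only [dirDeriv_apply, map_sum, dv_mul, Finset.sum_add_distrib, dvField]
  congr 1
  exact Finset.sum_congr rfl fun i _ => congrArg _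
    (congrArg (fun T : Op d => T h) (dv_commute_pd v i).eq)

theorem divergence_dvField (v : Fin d → ℝ) (K : VField d) :
    divergence (dvField v K) = dv v (divergence K) := by
  simp only [divergence, map_sum, dvField]
  exact Finset.sum_congr rfl fun i _ =>
    (congrArg (fun T : Op d => T (K i)) (dv_commute_pd v i).eq).symm

theorem ad_dv (μ : ℝ) (K : VField d) (v : Fin d → ℝ) :
    ad μ K (dv v) = (-1 : ℝ) • (dirDeriv (dvField v K) + μ • mul (dv v (divergence K))) := by
  ext1 h
  simp only [ad, LinearMap.sub_apply, LinearMap.add_apply,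
    LinearMap.smul_apply, Module.End.mul_apply, lieDeriv_apply, map_add, map_smul, dv_dirDeriv,
    dv_mul, mul_apply]
  module

theorem ad_dv_sq (μ : ℝ) (K : VField d) (v : Fin d → ℝ) :
    ad μ K (dv v ^ 2) = (-1 : ℝ) • ((2 : ℝ) • (dirDeriv (dvField v K) * dv v) +
      dirDeriv (dvField v (dvField v K)) + (2 * μ) • (mul (dv v (divergence K)) * dv v) +
      μ • mul (dv v (dv v (divergence K)))) := by
  ext1 h
  simp only [ad, pow_two, LinearMap.sub_apply, LinearMap.add_apply,
    LinearMap.smul_apply, Module.End.mul_apply, lieDeriv_apply, map_add, map_smul, dv_dirDeriv,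
    dv_mul, mul_apply]
  module

theorem ad_mul (μ : ℝ) (K : VField d) (f : Smooth d) : ad μ K (mul f) = mul (dirDeriv K f) := by
  have h := ad_mul_mul μ K f 1
  have h1 : ad μ K (1 : Op d) = 0 := by
    simp only [ad, mul_one, one_mul]
    exact sub_self (lieDeriv μ K)
  rwa [h1, mul_zero, add_zero, mul_one, mul_one] at h

/-- For a first-order operator the scalar F - lam ∂_i A^i is what is left after subtracting the Lie
derivative along A, so it is covariant under every vector field. -/
theorem schwarzScalar_ad_mul_mul_dv (lam : ℝ) (K : VField d) (f : Smooth d) (v : Fin d → ℝ) :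
    schwarzScalar lam (ad lam K (mul f * dv v)) =
      dirDeriv K (schwarzScalar lam (mul f * dv v)) := by
  rw [ad_mul_mul, ad_dv, mul_smul_comm, mul_add, mul_smul_comm, schwarzScalar_eq]
  have hm : mul f * mul (dv v (divergence K)) = mul (f * dv v (divergence K)) := by
    ext1 h
    simp [mul_apply, mul_assoc]
  rw [hm, map_add, map_smul, map_add, map_smul]
  simp only [← schwarzScalar_eq, schwarzScalar_mul_mul_dv, schwarzScalar_mul_mul_dirDeriv,
    schwarzScalar_mul, divergence_dvField, dv_dirDeriv, map_neg, map_smul]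
  module

theorem schwarzScalar_ad_mul_mul_dv_sq (lam : ℝ) (K : VField d) (f : Smooth d) (v : Fin d → ℝ) :
    schwarzScalar lam (ad lam K (mul f * dv v ^ 2)) -
        dirDeriv K (schwarzScalar lam (mul f * dv v ^ 2)) =
      (lam * (lam - 1) / ((d : ℝ) + 2)) • ((2 : ℝ) • (f * dv v (dv v (divergence K))) +
        (2 : ℝ) • (dv v f * dv v (divergence K)) -
        ((d : ℝ) + 1) • dirDeriv (dvField v (dvField v K)) f) := by
  have hm : ∀ g, mul f * mul g = mul (f * g) := fun g => by
    ext1 h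
    simp [mul_apply, mul_assoc]
  -- This closed form is what produces the factor lam (lam - 1)/(d + 2) below.
  have hc : lam * coeffa d lam - coeffb d lam = lam * (lam * (d + 1) + 1) / (d + 2) := by
    have h2 : (d : ℝ) + 2 ≠ 0 := by positivity
    have h3 : (d : ℝ) + 3 ≠ 0 := by positivity
    rw [coeffa, coeffb]
    field_simp
    ring
  rw [ad_mul_mul, ad_dv_sq, mul_smul_comm, mul_add, mul_add, mul_add, mul_smul_comm, mul_smul_comm,
    mul_smul_comm, ← mul_assoc (mul f) (mul _), hm, hm, schwarzScalar_eq]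
  simp only [map_add, map_smul]
  simp only [← schwarzScalar_eq, schwarzScalar_mul, schwarzScalar_mul_mul_dv,
    schwarzScalar_mul_mul_dirDeriv, schwarzScalar_mul_mul_dirDeriv_mul_dv, pow_two,
    schwarzScalar_mul_mul_dv_mul_dv, divergence_dvField, dv_dirDeriv, dv_mul, map_add, map_smul, hc]
  have h2 : (d : ℝ) + 2 ≠ 0 := by positivity
  match_scalars <;> field_simp <;> ring

theorem schwarzCocycle_coeffS_dirOp (K : VField d) (f₀ f₁ f₂ : Smooth d) (v : Fin d → ℝ) :
    schwarzCocycle K (coeffS (dirOp f₀ f₁ f₂ v)) =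
      (2 : ℝ) • (f₀ * dv v (dv v (divergence K))) + (2 : ℝ) • (dv v f₀ * dv v (divergence K)) -
        ((d : ℝ) + 1) • dirDeriv (dvField v (dvField v K)) f₀ := by
  have h : ∀ g : Smooth d, dv v (dv v g) = ∑ i, ∑ j, (v i * v j) • pd i (pd j g) := fun g => by
    simp only [dv_apply, map_sum, map_smul, Finset.smul_sum, smul_smul]
    exact Finset.sum_congr rfl fun i _ => Finset.sum_congr rfl fun j _ => by rw [pd_comm]
  have h1 : ∑ i, ∑ j, coeffS (dirOp f₀ f₁ f₂ v) i j * pd i (pd j (divergence K)) =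
      f₀ * dv v (dv v (divergence K)) := by
    simp only [coeffS_dirOp, h, Finset.mul_sum, smul_mul_assoc, mul_smul_comm]
  have h2 : ∑ i, ∑ j, pd j (coeffS (dirOp f₀ f₁ f₂ v) i j) * pd i (divergence K) =
      dv v f₀ * dv v (divergence K) := by
    simp only [← Finset.sum_mul, sum_pd_coeffS_dirOp, dv_apply v (divergence K), Finset.mul_sum,
      smul_mul_assoc, mul_smul_comm]
  have h3 : ∑ i, ∑ j, ∑ m, pd m (coeffS (dirOp f₀ f₁ f₂ v) i j) * pd i (pd j (K m)) =
      dirDeriv (dvField v (dvField v K)) f₀ := by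
    simp only [coeffS_dirOp, dirDeriv_apply, dvField, h, Finset.sum_mul, map_smul]
    conv_rhs => rw [Finset.sum_comm]
    refine Finset.sum_congr rfl fun i _ => ?_
    conv_rhs => rw [Finset.sum_comm]
    refine Finset.sum_congr rfl fun j _ => Finset.sum_congr rfl fun m _ => ?_
    rw [smul_mul_assoc, smul_mul_assoc, mul_comm (v i), mul_comm (pd m f₀)]
  rw [schwarzCocycle, h1, h2, h3]

theorem schwarzCocycle_coeffS_add (K : VField d) (T U : Op d) :
    schwarzCocycle K (coeffS (T + U)) =
      schwarzCocycle K (coeffS T) + schwarzCocycle K (coeffS U) := by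
  simp only [schwarzCocycle, coeffS_eq, map_add, add_mul, Finset.sum_add_distrib, smul_add]
  abel

theorem schwarzCocycle_coeffS_smul (K : VField d) (c : ℝ) (T : Op d) :
    schwarzCocycle K (coeffS (c • T)) = c • schwarzCocycle K (coeffS T) := by
  simp only [schwarzCocycle, coeffS_eq, map_smul, smul_mul_assoc, ← Finset.smul_sum]
  module

theorem schwarzScalar_ad_dirOp (lam : ℝ) (K : VField d) (f₀ f₁ f₂ : Smooth d) (v : Fin d → ℝ) :
    schwarzScalar lam (ad lam K (dirOp f₀ f₁ f₂ v)) -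
        dirDeriv K (schwarzScalar lam (dirOp f₀ f₁ f₂ v)) =
      (lam * (lam - 1) / ((d : ℝ) + 2)) • schwarzCocycle K (coeffS (dirOp f₀ f₁ f₂ v)) := by
  rw [schwarzCocycle_coeffS_dirOp, ← schwarzScalar_ad_mul_mul_dv_sq]
  have e : dirOp f₀ f₁ f₂ v = mul f₀ * dv v ^ 2 + mul f₁ * dv v + mul f₂ := by
    rw [dirOp, pow_one, pow_zero, mul_one]
  have h1 := schwarzScalar_ad_mul_mul_dv lam K f₁ v
  have h0 : schwarzScalar lam (ad lam K (mul f₂)) = dirDeriv K (schwarzScalar lam (mul f₂)) := by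
    rw [ad_mul, schwarzScalar_mul, schwarzScalar_mul]
  simp only [e, ad_add, schwarzScalar_eq, map_add] at h0 h1 ⊢
  rw [h0, h1]
  abel

theorem schwarzScalar_ad (lam : ℝ) (K : VField d) {T : Op d} (hT : T ∈ diffOps d 2) :
    schwarzScalar lam (ad lam K T) - dirDeriv K (schwarzScalar lam T) =
      (lam * (lam - 1) / ((d : ℝ) + 2)) • schwarzCocycle K (coeffS T) := by
  refine diffOps_induction lam (p := fun T => schwarzScalar lam (ad lam K T) -
    dirDeriv K (schwarzScalar lam T) =
      (lam * (lam - 1) / ((d : ℝ) + 2)) • schwarzCocycle K (coeffS T)) ?_ ?_ ?_ ?_ hT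
  · intro k hk f v
    interval_cases k
    · rw [quantHom_eq_dirOp_zero]
      exact schwarzScalar_ad_dirOp lam K _ _ _ v
    · rw [quantHom_eq_dirOp_one]
      exact schwarzScalar_ad_dirOp lam K _ _ _ v
    · rw [quantHom_eq_dirOp_two]
      exact schwarzScalar_ad_dirOp lam K _ _ _ v
  · have e : (0 : Op d) = dirOp 0 0 0 0 := by simp [dirOp, mul_zero']
    rw [e]
    exact schwarzScalar_ad_dirOp lam K _ _ _ _
  · intro T _ U _ h1 h2
    rw [schwarzCocycle_coeffS_add, smul_add, ← h1, ← h2]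
    simp only [ad_add, schwarzScalar_eq, map_add]
    abel
  · intro c T _ h1
    rw [schwarzCocycle_coeffS_smul, smul_comm, ← h1]
    simp only [ad_smul, schwarzScalar_eq, map_smul]
    module

/-! ### Projective invariance and non-triviality of the scalar -/

theorem schwarzScalar_quantHom {lam : ℝ} {k : ℕ} (hk : k ≤ 2) (hk0 : k ≠ 0) {S : Tensor d k}
    (hS : S ∈ symTensors d k) : schwarzScalar lam (quantHom lam k S) = 0 := by
  rw [schwarzScalar_eq]
  induction hS using Submodule.span_induction with
  | mem S hS =>
    obtain ⟨f, v, rfl⟩ := hS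
    rw [← schwarzScalar_eq]
    interval_cases k
    · exact absurd rfl hk0
    · rw [quantHom_eq_dirOp_one, schwarzScalar_dirOp]
      simp
    · rw [quantHom_eq_dirOp_two, schwarzScalar_dirOp, map_smul]
      module
  | zero => simp
  | add S U _ _ h h' => rw [map_add, map_add, h, h', add_zero]
  | smul c S _ h => rw [map_smul, map_smul, h, smul_zero]

/-- No cocycle is computed: ad_K preserves the degree of a quantised symbol, and the scalar sees
only degree zero, where ad_K is K acting on functions. -/
theorem schwarzScalar_ad_of_mem_projFields (lam : ℝ) {K : VField d} (hK : K ∈ projFields d)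
    {T : Op d} (hT : T ∈ diffOps d 2) :
    schwarzScalar lam (ad lam K T) = dirDeriv K (schwarzScalar lam T) := by
  refine diffOps_induction lam (p := fun T => schwarzScalar lam (ad lam K T) =
    dirDeriv K (schwarzScalar lam T)) ?_ ?_ ?_ ?_ hT
  · intro k hk f v
    rcases eq_or_ne k 0 with rfl | hk0
    · have e : quantHom lam 0 (tpow 0 f v) = mul f := by
        rw [quantHom_eq_dirOp_zero]
        simp [dirOp, mul_zero']
      rw [e, ad_mul, schwarzScalar_mul, schwarzScalar_mul]
    · obtain ⟨U, hU, hQ⟩ := exists_ad_quantHom hK k f v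
      rw [hQ, schwarzScalar_quantHom hk hk0 hU, schwarzScalar_quantHom hk hk0 (tpow_mem _ _ _),
        map_zero]
  · have : ad lam K (0 : Op d) = 0 := map_zero (adₗ lam K)
    rw [this, schwarzScalar_eq, map_zero, map_zero]
  · intro T _ U _ h1 h2
    simp only [schwarzScalar_eq] at h1 h2 ⊢
    rw [ad_add, map_add, map_add, map_add, h1, h2]
  · intro c T _ h1
    simp only [schwarzScalar_eq] at h1 ⊢
    rw [ad_smul, map_smul, map_smul, map_smul, h1]

/-- The witnesses are K = (x^i)^3 ∂_i and Δ = ∂_i^2. The coefficients of Δ are constant, so only the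
second derivative of the divergence 3 (x^i)^2 contributes, giving 12 lam (lam - 1)/(d + 2). -/
theorem exists_schwarzScalar_ad_ne (hd : 0 < d) {lam : ℝ} (h0 : lam ≠ 0) (h1 : lam ≠ 1) :
    ∃ K : VField d, ∃ T ∈ diffOps d 2,
      schwarzScalar lam (ad lam K T) ≠ dirDeriv K (schwarzScalar lam T) := by
  let i : Fin d := ⟨0, hd⟩
  let v : Fin d → ℝ := Pi.single i 1
  let K : VField d := Pi.single i (coord i * (coord i * coord i))
  refine ⟨K, mul 1 * dv v ^ 2, mul_mul_dv_pow_mem _ _ _, fun h => ?_⟩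
  have h2 := schwarzScalar_ad_mul_mul_dv_sq lam K 1 v
  have hdiv : divergence K = pd i (coord i * (coord i * coord i)) := by
    rw [divergence, Finset.sum_eq_single i]
    · simp [K]
    · intro j _ hj
      simp [K, hj]
    · simp
  have hD : dv v (dv v (divergence K)) = (6 : ℝ) • 1 := by
    rw [hdiv, dv_single]
    simp only [pd_mul, pd_coord, if_true, map_add, pd_one, one_mul, mul_one, mul_zero,
      add_zero]
    module
  have hK1 : dirDeriv (dvField v (dvField v K)) 1 = 0 := by
    simp [dirDeriv_apply, pd_one]
  rw [h, sub_self, hD, dv_one, hK1] at h2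
  simp only [zero_mul, smul_zero, add_zero, sub_zero, one_mul, smul_smul] at h2
  have h3 := congrArg (fun f : Smooth d => f.1 0) h2
  have e : ∀ c : ℝ, (c • (1 : Smooth d)).1 0 = c := fun c => mul_one c
  simp only [e] at h3
  have h4 : (d : ℝ) + 2 ≠ 0 := by positivity
  have h5 : lam * (lam - 1) / ((d : ℝ) + 2) * (2 * 6) ≠ 0 :=
    mul_ne_zero (div_ne_zero (mul_ne_zero h0 (sub_ne_zero.2 h1)) h4) (by norm_num)
  exact h5 h3.symm

end PencilLifting

end

/-! ### The theorem -/

open PencilLifting Polynomial in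
theorem mainTheorem5 (d : ℕ) (hd : 0 < d) (lam : ℝ) :
    -- liftings of operators of order at most `n`
    (∀ (n : ℕ) (P : ℕ → ℝ[X]),
      (∀ i ≤ n, (P i).natDegree ≤ i) → (∀ i ≤ n, (P i).eval lam ≠ 0) →
      (IsRegularLifting lam (triangularLifting d n lam P) ∧
        IsProjEquivariant lam (triangularLifting d n lam P)) ∧
      (Even n → (IsSelfAdjointLifting (triangularLifting d n lam P) ↔
        ∀ i ≤ n, AdjointIs (polyWeight d (P i)) ((-1 : ℝ) ^ i • polyWeight d (P i)))) ∧
      (Odd n → (IsAntiSelfAdjointLifting (triangularLifting d n lam P) ↔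
        ∀ i ≤ n, AdjointIs (polyWeight d (P i)) ((-1 : ℝ) ^ i • polyWeight d (P i)))) ∧
      (∀ i, 2 * i ≤ n →
        (AdjointIs (polyWeight d (P (2 * i))) ((-1 : ℝ) ^ (2 * i) • polyWeight d (P (2 * i))) ↔
          ∃ c : ℕ → ℝ, P (2 * i) =
            ∑ k ∈ Finset.range (i + 1), C (c k) * (X - C (1 / 2 : ℝ)) ^ (2 * k))) ∧
      (∀ i, 2 * i + 1 ≤ n →
        (AdjointIs (polyWeight d (P (2 * i + 1)))
            ((-1 : ℝ) ^ (2 * i + 1) • polyWeight d (P (2 * i + 1))) ↔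
          ∃ c : ℕ → ℝ, P (2 * i + 1) =
            ∑ k ∈ Finset.range (i + 1), C (c k) * (X - C (1 / 2 : ℝ)) ^ (2 * k + 1)))) ∧
    -- the projective line of self-adjoint liftings of second order operators
    (∀ P : ℕ → ℝ[X],
      (∀ i ≤ 2, (P i).natDegree ≤ i) → (∀ i ≤ 2, (P i).eval lam ≠ 0) →
      (IsSelfAdjointLifting (triangularLifting d 2 lam P) ↔
        lam ≠ 1 / 2 ∧ ∃ p q : ℝ, p + q * (lam * (lam - 1)) ≠ 0 ∧
          triangularLifting d 2 lam P = lineLifting d lam p q)) ∧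
    (lam ≠ 1 / 2 → ∀ p q : ℝ, p + q * (lam * (lam - 1)) ≠ 0 →
      IsRegularLifting lam (lineLifting d lam p q) ∧
      IsProjEquivariant lam (lineLifting d lam p q) ∧
      IsSelfAdjointLifting (lineLifting d lam p q) ∧
      ∀ p' q' : ℝ, p' + q' * (lam * (lam - 1)) ≠ 0 →
        (lineLifting d lam p q = lineLifting d lam p' q' ↔ p * q' = p' * q)) ∧
    -- comparison with the canonical lifting
    (lam ≠ 0 → lam ≠ 1 / 2 → lam ≠ 1 → ∀ T : diffOps d 2,
      (∀ D : OpHat d, IsCanonicalLift lam (T : Op d) D ↔ D = canonicalLift lam (T : Op d)) ∧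
      lineLifting d lam 0 1 T = canonicalLift lam (T : Op d) ∧
      ∀ p q : ℝ, p + q * (lam * (lam - 1)) ≠ 0 →
        lineLifting d lam p q T = canonicalLift lam (T : Op d) +
          ((p + q * (lam * (lam - 1)))⁻¹ • polyWeight d (linePoly p q) -
            (lam * (lam - 1))⁻¹ • polyWeight d (linePoly 0 1)) *
          const (mul (schwarzScalar lam (T : Op d)))) ∧
    -- the Schwarzian-type scalar
    (∀ K ∈ projFields d, ∀ T ∈ diffOps d 2,
      schwarzScalar lam (ad lam K T) = dirDeriv K (schwarzScalar lam T)) ∧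
    (∀ K : VField d, ∀ T ∈ diffOps d 2,
      schwarzScalar lam (ad lam K T) - dirDeriv K (schwarzScalar lam T) =
        (lam * (lam - 1) / ((d : ℝ) + 2)) • schwarzCocycle K (coeffS T)) ∧
    (lam ≠ 0 → lam ≠ 1 → ∃ K : VField d, ∃ T ∈ diffOps d 2,
      schwarzScalar lam (ad lam K T) ≠ dirDeriv K (schwarzScalar lam T)) := by
  refine ⟨fun n P hdeg hP => ⟨⟨isRegularLifting_triangularLifting hdeg hP,
    isProjEquivariant_triangularLifting n lam P⟩, fun hn => ?_, fun hn => ?_,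
    fun i hi => adjointIs_polyWeight_even_iff (hdeg _ hi),
    fun i hi => adjointIs_polyWeight_odd_iff (hdeg _ hi)⟩,
    fun P hdeg hP => isSelfAdjointLifting_triangularLifting_two_iff hd hdeg hP,
    fun hl p q h => ⟨isRegularLifting_lineLifting hl h, ?_,
      isSelfAdjointLifting_lineLifting hd hl h, fun p' q' h' => lineLifting_eq_iff h h'⟩,
    fun h0 h12 h1 T => ⟨fun D => ⟨fun hD => ?_, ?_⟩, lineLifting_zero_one h0 h12 h1 T,
      fun p q _ => lineLifting_eq_canonicalLift_add h0 h12 h1 p q T⟩,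
    fun K hK T hT => schwarzScalar_ad_of_mem_projFields lam hK hT,
    fun K T hT => schwarzScalar_ad lam K hT, exists_schwarzScalar_ad_ne hd⟩
  -- Both sides reduce to the same pointwise condition P_i(μ) = (-1)^i P_i(1 - μ).
  · simp only [isSelfAdjointLifting_iff hn, adjointIs_triangularLifting_iff hd hP,
      adjointIs_polyWeight_iff]
  · simp only [isAntiSelfAdjointLifting_iff hn, adjointIs_triangularLifting_iff hd hP,
      adjointIs_polyWeight_iff]
  · rw [lineLifting_eq]
    exact isProjEquivariant_triangularLifting 2 lam _
  · exact hD.unique h0 h12 h1 (isCanonicalLift_canonicalLift hd h0 h12 h1 T)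
  · rintro rfl
    exact isCanonicalLift_canonicalLift hd h0 h12 h1 T
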